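/- **Setting.** For $p\ge 0$, $q\ge1$ let $D_{p,q}=\{z\in M_{p,q}(\mathbb C): z^*z<1\}$, on which $SU(p,q)$ acts by $gz=(az+b)(cz+d)^{-1}$, $g=\begin{bmatrix}a&b\\c&d\end{bmatrix}$. Let $\widetilde{SU}(p,q)$ be the covering group of all pairs $(g,\ell)$ with $g\in SU(p,q)$ and $\ell$ a continuous branch of $z\mapsto\log\det(cz+d)$ on $D_{p,q}$; on it all powers $\det(cz+d)^{-\nu}$ are single-valued. Let $n\ge1$ be an integer and consider three cases. In each, $\nu$ is a real parameter, $V$ is a complex vector space, $D\subset V$ is a domain, $h$ is a function on $D\times D$, and $Q$ is a polynomial on $V$. * Case $\mathbb R$: $\nu>0$, $G=SU(n,1)$, $G_1=SU(n-1,1)$, $D=D_{n,1}\subset V=\mathbb C^n$, $h(z,w)=1-\langle z,w\rangle$, $Q=z_n$ (the last coordinate). * Case $\mathbb C$: $\nu>0$, $G=SU(n,1)\times SU(n,1)$, $G_1=SU(n-1,1)\times SU(n-1,1)$, $D=D_{n,1}\times D_{n,1}\subset V=\mathbb C^n\oplus\overline{\mathbb C^n}$ (so "holomorphic" on $D$ means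 holomorphic in the first and antiholomorphic in the second variable), $h((z,w),(z',w'))=(1-\langle z,z'\rangle)(1-\langle w',w\rangle)$, $Q=z_n\overline{w_n}$. * Case $\mathbb H$: $\nu>1$, $G=SU(2n,2)$, $G_1=SU(2(n-1),2)$, $D=D_{2n,2}\subset V=M_{2n,2}(\mathbb C)$, $h(z,w)=\det(1-w^*z)$, $Q=\det z_n$, where $z_n$ is the last $2\times2$ block of $z$. Here $G_1\subset G$ is the subgroup acting trivially on the last coordinate (last two coordinates in Case $\mathbb H$) of the positive definite part of each factor, and its domain $D_1$ is contained in $D$ as the set of points with $z_n=0$ (with $z_n=w_n=0$ in Case $\mathbb C$). Let $\widetilde G,\widetilde G_1$ be the corresponding coverings (products of the two coverings in Case $\mathbb C$); the inclusion $G_1\subset G$ lifts to $\widetilde G_1\to\widetilde G$. The operator $\partial_Q$ is $\partial_{z_n}$, $\partial_{z_n}\partial_{\overline{w_n}}$, $\partial_{11}\partial_{22}-\partial_{12}\partial_{21}$ (derivatives in the entries of $z_n$) in the three cases, and $\partial_{Q^j}=(\partial_Q)^j$. Then $h^{-\nu}$ (the branch equal to $1$ at the origin) is positive definite, and the Hilbert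 space $\mathcal H_\nu(D)$ with reproducing kernel $h(z,w)^{-\nu}$ consists of holomorphic functions on $D$ and carries the strongly continuous unitary representation $U_\nu$ of $\widetilde G$ given by $$U_\nu(g)f(z)=\det(cz+d)^{-\nu}f(g^{-1}z),\qquad g^{-1}=\begin{bmatrix}a&b\\c&d\end{bmatrix},$$ in Cases $\mathbb R$ and $\mathbb H$, and in Case $\mathbb C$ by $$U_\nu(g_1,g_2)f(z,w)=\det(c_1z+d_1)^{-\nu}\,\overline{\det(c_2w+d_2)^{-\nu}}\,f(g_1^{-1}z,g_2^{-1}w),$$ where $c_i,d_i$ are the lower blocks of $g_i^{-1}$. Likewise, for every integer $j\ge0$, $\mathcal H_{\nu+j}(D_1)$ and $(U_{\nu+j},\widetilde G_1)$ are defined in the same way with $n-1$ in place of $n$ and $\nu+j$ in place of $\nu$. An irreducible unitary representation of $\widetilde G_1$ is called *holomorphic* if it is equivalent to one on a Hilbert space of holomorphic functions $F:D_1\to\mathbb C^d$, for some finite $d$, with continuous point evaluations, in which the group acts by $(gF)(z)=J(g,z)F(g^{-1}z)$ for a cocycle $J$ with values in $GL_d(\mathbb C)$ that is holomorphic in $z$.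 **Theorem.** In each of the three cases: 1. The restriction of $U_\nu$ to $\widetilde G_1$ is a discrete (Hilbert) direct sum of irreducible holomorphic representations of $\widetilde G_1$. 2. For every integer $j\ge0$, the representation $(U_{\nu+j},\widetilde G_1)$ is a discrete summand of the restriction of $U_\nu$ to $\widetilde G_1$, i.e. it is unitarily equivalent to a subrepresentation. 3. For every integer $j\ge0$, $f\mapsto\partial_{Q^j}f\big|_{D_1}$ defines a non-zero bounded operator from $\mathcal H_\nu(D)$ to $\mathcal H_{\nu+j}(D_1)$ that intertwines the restriction of $U_\nu$ to $\widetilde G_1$ with $U_{\nu+j}$. -/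

import Mathlib

open Matrix
open scoped ComplexOrder
set_option linter.unusedSectionVars false

noncomputable section

namespace HoloBranching

/-! ### The matrix ball and the group `SU(p,q)` -/

/-- The matrix ball `{z ∈ M_{p,q}(ℂ) : z* z < 1}`. -/
def ballSet (p q : Type) [Fintype p] [Fintype q] [DecidableEq q] : Set (Matrix p q ℂ) :=
  {z | (1 - zᴴ * z).PosDef}

/-- The matrix ball, as a type. -/
abbrev Ball (p q : Type) [Fintype p] [Fintype q] [DecidableEq q] : Type := ↥(ballSet p q)

/-- The diagonal matrix with `p` entries `1` and `q` entries `-1`. -/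
def formJ (p q : Type) [DecidableEq p] [DecidableEq q] : Matrix (p ⊕ q) (p ⊕ q) ℂ :=
  fromBlocks 1 0 0 (-1)

lemma form_inv {m : Type} [Fintype m] [DecidableEq m] {g h J : Matrix m m ℂ} (hgh : g * h = 1)
    (hg : gᴴ * J * g = J) : hᴴ * J * h = J := by
  have h2 := congrArg conjTranspose hgh
  rw [conjTranspose_mul, conjTranspose_one] at h2
  calc _ = hᴴ * (gᴴ * J * g) * h := by rw [hg]
    _ = (hᴴ * gᴴ) * J * (g * h) := by simp only [Matrix.mul_assoc]
    _ = _ := by rw [hgh, h2]; simp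

lemma form_mul {m : Type} [Fintype m] {g h J : Matrix m m ℂ}
    (hg : gᴴ * J * g = J) (hh : hᴴ * J * h = J) : (g * h)ᴴ * J * (g * h) = J := by
  calc _ = hᴴ * (gᴴ * J * g) * h := by simp only [Matrix.mul_assoc, conjTranspose_mul]
    _ = _ := by rw [hg, hh]

/-- The group `SU(p,q)` of matrices of determinant one that preserve the form. -/
def SU (p q : Type) [Fintype p] [DecidableEq p] [Fintype q] [DecidableEq q] :
    Subgroup (SpecialLinearGroup (p ⊕ q) ℂ) where
  carrier := {g | g.1ᴴ * formJ p q * g.1 = formJ p q}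
  one_mem' := by
    change (1 : Matrix (p ⊕ q) (p ⊕ q) ℂ)ᴴ * formJ p q * (1 : Matrix (p ⊕ q) (p ⊕ q) ℂ) = _
    simp
  mul_mem' := fun {g h} hg hh => form_mul (g := g.1) (h := h.1) hg hh
  inv_mem' := fun {g} hg => form_inv (g := g.1) (h := (g⁻¹).1)
    (congrArg (fun x : SpecialLinearGroup (p ⊕ q) ℂ => x.1) (mul_inv_cancel g)) hg

section Action

variable {p q : Type} [Fintype p] [DecidableEq p] [Fintype q] [DecidableEq q]

/-- The matrix of an element of `SU(p,q)`. -/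
def mat (g : SU p q) : Matrix (p ⊕ q) (p ⊕ q) ℂ := g.1.1

lemma mat_mul (g h : SU p q) : mat (g * h) = mat g * mat h := rfl

lemma mat_one : mat (1 : SU p q) = 1 := rfl

lemma mat_form (g : SU p q) : (mat g)ᴴ * formJ p q * mat g = formJ p q := g.2

/-- The numerator `a z + b` for `g = [a b; c d]`. -/
def num (g : SU p q) (z : Matrix p q ℂ) : Matrix p q ℂ :=
  (mat g).toBlocks₁₁ * z + (mat g).toBlocks₁₂

/-- The denominator `c z + d` for `g = [a b; c d]`. -/
def den (g : SU p q) (z : Matrix p q ℂ) : Matrix q q ℂ :=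
  (mat g).toBlocks₂₁ * z + (mat g).toBlocks₂₂

lemma mul_fromRows_one (g : SU p q) (z : Matrix p q ℂ) :
    mat g * (fromRows z (1 : Matrix q q ℂ)) = fromRows (num g z) (den g z) := by
  unfold num den
  generalize mat g = g
  have h := fromBlocks_mul_fromRows z (1 : Matrix q q ℂ) g.toBlocks₁₁ g.toBlocks₁₂
    g.toBlocks₂₁ g.toBlocks₂₂
  rw [fromBlocks_toBlocks] at h
  simpa using h

lemma form_fromRows (x : Matrix p q ℂ) (y : Matrix q q ℂ) :
    (fromRows x y)ᴴ * (formJ p q * (fromRows x y : Matrix (p ⊕ q) q ℂ)) = xᴴ * x - yᴴ * y := by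
  have h := fromBlocks_mul_fromRows x y (1 : Matrix p p ℂ) 0 0 (-1 : Matrix q q ℂ)
  rw [formJ, h, conjTranspose_fromRows_eq_fromCols_conjTranspose, fromCols_mul_fromRows]
  simp [sub_eq_add_neg]

lemma num_den (g : SU p q) (z : Matrix p q ℂ) :
    (den g z)ᴴ * den g z - (num g z)ᴴ * num g z = 1 - zᴴ * z := by
  have h := form_fromRows (num g z) (den g z)
  have h0 := form_fromRows z (1 : Matrix q q ℂ)
  rw [← mul_fromRows_one, conjTranspose_mul] at h
  have h3 : (fromRows z (1 : Matrix q q ℂ))ᴴ * (mat g)ᴴ * (formJ p q *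
      (mat g * (fromRows z (1 : Matrix q q ℂ)))) = zᴴ * z - 1 := by
    calc _ = (fromRows z (1 : Matrix q q ℂ))ᴴ * (((mat g)ᴴ * formJ p q *
        mat g) * (fromRows z (1 : Matrix q q ℂ))) := by simp only [Matrix.mul_assoc]
      _ = _ := by rw [mat_form, h0]; simp
  rw [← neg_sub, ← h, h3, neg_sub]

lemma isUnit_det_den (g : SU p q) (z : Ball p q) : IsUnit (den g z.1).det := by
  have h : ((den g z.1)ᴴ * den g z.1).PosDef := by
    rw [sub_eq_iff_eq_add.1 (num_den g z.1)]
    exact PosDef.add_posSemidef z.2 (posSemidef_conjTranspose_mul_self _)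
  have h2 := (isUnit_iff_isUnit_det _).1 h.isUnit
  rw [det_mul] at h2
  exact isUnit_of_mul_isUnit_right h2

lemma smul_mem_ball (g : SU p q) (z : Ball p q) :
    num g z.1 * (den g z.1)⁻¹ ∈ ballSet p q := by
  have hu := isUnit_det_den g z
  have hh := num_den g z.1
  generalize den g z.1 = d at *
  generalize num g z.1 = e at *
  have h : (1 : Matrix q q ℂ) - (e * d⁻¹)ᴴ * (e * d⁻¹) = (d⁻¹)ᴴ * (1 - z.1ᴴ * z.1) * d⁻¹ := by
    rw [← hh, Matrix.mul_sub, Matrix.sub_mul, conjTranspose_mul]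
    have h1 : (d⁻¹)ᴴ * (dᴴ * d) * d⁻¹ = 1 := by
      calc _ = (d * d⁻¹)ᴴ * (d * d⁻¹) := by
            simp only [Matrix.mul_assoc, conjTranspose_mul]
        _ = 1 := by rw [mul_nonsing_inv _ hu]; simp
    rw [h1]; simp only [Matrix.mul_assoc]
  change ((1 : Matrix q q ℂ) - (e * d⁻¹)ᴴ * (e * d⁻¹)).PosDef
  rw [h]
  have hi : IsUnit d⁻¹ := (isUnit_nonsing_inv_iff).2 ((isUnit_iff_isUnit_det _).2 hu)
  exact (hi.posDef_star_left_conjugate_iff).2 z.2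

/-- The fractional linear map `g z = (a z + b) (c z + d)⁻¹`. -/
instance : SMul (SU p q) (Ball p q) where
  smul g z := ⟨num g z.1 * (den g z.1)⁻¹, smul_mem_ball g z⟩

lemma smul_val (g : SU p q) (z : Ball p q) : (g • z).1 = num g z.1 * (den g z.1)⁻¹ := rfl

lemma num_den_mul (g h : SU p q) (z : Ball p q) :
    num (g * h) z.1 = num g (h • z).1 * den h z.1 ∧
    den (g * h) z.1 = den g (h • z).1 * den h z.1 := by
  have h1 : mat (g * h) * (fromRows z.1 (1 : Matrix q q ℂ)) =
      mat g * (mat h * (fromRows z.1 (1 : Matrix q q ℂ))) := by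
    rw [← Matrix.mul_assoc]; rfl
  have h2 : mat h * (fromRows z.1 (1 : Matrix q q ℂ)) =
      (fromRows (h • z).1 (1 : Matrix q q ℂ) : Matrix (p ⊕ q) q ℂ) * den h z.1 := by
    rw [mul_fromRows_one, fromRows_mul, smul_val, Matrix.mul_assoc,
      nonsing_inv_mul _ (isUnit_det_den h z)]
    simp
  rw [h2, ← Matrix.mul_assoc, mul_fromRows_one, mul_fromRows_one, fromRows_mul] at h1
  exact ⟨congrArg toRows₁ h1, congrArg toRows₂ h1⟩

lemma num_one (z : Matrix p q ℂ) : num (1 : SU p q) z = z := by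
  have h1 : toBlocks₁₁ (1 : Matrix (p ⊕ q) (p ⊕ q) ℂ) = 1 := by ext i j; simp [toBlocks₁₁, one_apply]
  have h2 : toBlocks₁₂ (1 : Matrix (p ⊕ q) (p ⊕ q) ℂ) = 0 := by ext i j; simp [toBlocks₁₂, one_apply]
  rw [num, mat_one, h1, h2]; simp

lemma den_one (z : Matrix p q ℂ) : den (1 : SU p q) z = 1 := by
  have h1 : toBlocks₂₁ (1 : Matrix (p ⊕ q) (p ⊕ q) ℂ) = 0 := by ext i j; simp [toBlocks₂₁, one_apply]
  have h2 : toBlocks₂₂ (1 : Matrix (p ⊕ q) (p ⊕ q) ℂ) = 1 := by ext i j; simp [toBlocks₂₂, one_apply]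
  rw [den, mat_one, h1, h2]; simp

instance : MulAction (SU p q) (Ball p q) where
  one_smul z := by
    apply Subtype.ext
    rw [smul_val, num_one, den_one]; simp
  mul_smul g h z := by
    apply Subtype.ext
    rw [smul_val, (num_den_mul g h z).1, (num_den_mul g h z).2, smul_val g, Matrix.mul_inv_rev,
      Matrix.mul_assoc, ← Matrix.mul_assoc (den h _), mul_nonsing_inv _ (isUnit_det_den h z),
      Matrix.one_mul]

lemma continuous_smul_ball (g : SU p q) : Continuous fun z : Ball p q => g • z := by
  refine Continuous.subtype_mk ?_ _
  have hd : Continuous fun z : Ball p q => den g z.1 := by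
    unfold den; fun_prop
  have hn : Continuous fun z : Ball p q => num g z.1 := by
    unfold num; fun_prop
  refine hn.matrix_mul ?_
  simp only [Matrix.inv_def, Ring.inverse_eq_inv']
  exact (hd.matrix_det.inv₀ fun z => (isUnit_det_den g z).ne_zero).smul hd.matrix_adjugate

/-- The covering group of `SU(p,q)` on which `det (c z + d)` has a logarithm: pairs of an element
`g = [a b; c d]` and a continuous (hence holomorphic) branch of `z ↦ log det (c z + d)` on the
matrix ball. -/
structure Cover (p q : Type) [Fintype p] [DecidableEq p] [Fintype q] [DecidableEq q] where
  /-- the group element -/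
  toSU : SU p q
  /-- the branch of the logarithm -/
  log : C(Ball p q, ℂ)
  exp_log : ∀ z, Complex.exp (log z) = (den toSU z.1).det

instance : Mul (Cover p q) where
  mul γ δ :=
    { toSU := γ.toSU * δ.toSU
      log := ⟨fun z => γ.log (δ.toSU • z) + δ.log z,
        (γ.log.continuous.comp (continuous_smul_ball δ.toSU)).add δ.log.continuous⟩
      exp_log := fun z => by
        rw [(num_den_mul _ _ _).2, det_mul, ← γ.exp_log, ← δ.exp_log, ← Complex.exp_add]
        rfl }

instance : One (Cover p q) where
  one :=
    { toSU := 1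
      log := 0
      exp_log := fun z => by simp [den_one] }

instance : Inv (Cover p q) where
  inv γ :=
    { toSU := γ.toSU⁻¹
      log := ⟨fun z => -γ.log (γ.toSU⁻¹ • z),
        (γ.log.continuous.comp (continuous_smul_ball γ.toSU⁻¹)).neg⟩
      exp_log := fun z => by
        change Complex.exp (-γ.log (γ.toSU⁻¹ • z)) = _
        have h := (num_den_mul γ.toSU γ.toSU⁻¹ z).2
        rw [mul_inv_cancel, den_one] at h
        have h2 := congrArg det h
        rw [det_one, det_mul, ← γ.exp_log] at h2
        rw [Complex.exp_neg]
        exact (eq_inv_of_mul_eq_one_right h2.symm).symm }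

lemma Cover.mul_log (γ δ : Cover p q) (z : Ball p q) :
    (γ * δ).log z = γ.log (δ.toSU • z) + δ.log z := rfl

lemma Cover.ext {γ δ : Cover p q} (h : γ.toSU = δ.toSU) (h' : ∀ z, γ.log z = δ.log z) :
    γ = δ := by
  cases γ; cases δ
  obtain rfl := h
  obtain rfl := ContinuousMap.ext h'
  rfl

instance : Group (Cover p q) :=
  Group.ofLeftAxioms
    (fun a b c => Cover.ext (mul_assoc a.toSU b.toSU c.toSU) fun z => by
      simp only [Cover.mul_log, add_assoc, ← mul_smul]
      rfl)
    (fun a => Cover.ext (one_mul a.toSU) fun z => by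
      rw [Cover.mul_log]
      exact zero_add _)
    (fun a => Cover.ext (inv_mul_cancel a.toSU) fun z => by
      rw [Cover.mul_log]
      change -a.log (a.toSU⁻¹ • a.toSU • z) + a.log z = 0
      rw [inv_smul_smul, neg_add_cancel])

/-- The topology induced from `SU(p,q)` and from locally uniform convergence of the logarithm. -/
instance : TopologicalSpace (Cover p q) :=
  TopologicalSpace.induced (fun γ => (γ.toSU, γ.log)) inferInstance

/-- The covering group acts on the ball through `SU(p,q)`. -/
instance : MulAction (Cover p q) (Ball p q) where
  smul γ z := γ.toSU • z
  one_smul z := one_smul (SU p q) z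
  mul_smul γ δ z := mul_smul γ.toSU δ.toSU z

/-- The product of two covering groups acts componentwise on the product of two balls. -/
instance : MulAction (Cover p q × Cover p q) (Ball p q × Ball p q) where
  smul γ z := (γ.1 • z.1, γ.2 • z.2)
  one_smul z := Prod.ext (one_smul _ z.1) (one_smul _ z.2)
  mul_smul γ δ z := Prod.ext (mul_smul γ.1 δ.1 z.1) (mul_smul γ.2 δ.2 z.2)

end Action

/-! ### The subgroup `SU(p,q)` of `SU(p + r,q)` and its domain -/

section Embedding

variable {p r q : Type} [Fintype p] [DecidableEq p] [Fintype r] [DecidableEq r]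
  [Fintype q] [DecidableEq q]

/-- The matrix `[[a, 0, b], [0, 1, 0], [c, 0, d]]` for `g = [[a, b], [c, d]]`. -/
def embMat (r : Type) [DecidableEq r] (g : Matrix (p ⊕ q) (p ⊕ q) ℂ) :
    Matrix ((p ⊕ r) ⊕ q) ((p ⊕ r) ⊕ q) ℂ :=
  fromBlocks (fromBlocks g.toBlocks₁₁ 0 0 1) (fromRows g.toBlocks₁₂ 0)
    (fromCols g.toBlocks₂₁ 0) g.toBlocks₂₂

/-- The reordering of indices that moves the block `r` to the end. -/
def swapEquiv (p r q : Type) : (p ⊕ r) ⊕ q ≃ (p ⊕ q) ⊕ r where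
  toFun x := match x with
    | .inl (.inl i) => .inl (.inl i)
    | .inl (.inr i) => .inr i
    | .inr i => .inl (.inr i)
  invFun x := match x with
    | .inl (.inl i) => .inl (.inl i)
    | .inl (.inr i) => .inr i
    | .inr i => .inl (.inr i)
  left_inv := by rintro ((i | i) | i) <;> rfl
  right_inv := by rintro ((i | i) | i) <;> rfl

lemma embMat_eq (g : Matrix (p ⊕ q) (p ⊕ q) ℂ) :
    embMat r g = (fromBlocks g 0 0 (1 : Matrix r r ℂ)).submatrix (swapEquiv p r q)
      (swapEquiv p r q) := by
  ext ((i | i) | i) ((j | j) | j) <;> rfl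

lemma formJ_eq : formJ (p ⊕ r) q =
    (fromBlocks (formJ p q) 0 0 (1 : Matrix r r ℂ)).submatrix (swapEquiv p r q)
      (swapEquiv p r q) := by
  ext ((i | i) | i) ((j | j) | j) <;> simp [formJ, swapEquiv, one_apply]

lemma embMat_mul (g h : Matrix (p ⊕ q) (p ⊕ q) ℂ) :
    embMat r (g * h) = embMat r g * embMat r h := by
  simp only [embMat_eq, submatrix_mul_equiv, fromBlocks_multiply]
  simp

lemma embMat_star (g : Matrix (p ⊕ q) (p ⊕ q) ℂ) : embMat r gᴴ = (embMat r g)ᴴ := by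
  simp only [embMat_eq, conjTranspose_submatrix, fromBlocks_conjTranspose]
  simp

lemma embMat_det (g : Matrix (p ⊕ q) (p ⊕ q) ℂ) : (embMat r g).det = g.det := by
  rw [embMat_eq, det_submatrix_equiv_self, det_fromBlocks_zero₂₁]; simp

lemma embMat_form {g : Matrix (p ⊕ q) (p ⊕ q) ℂ} (hg : gᴴ * formJ p q * g = formJ p q) :
    (embMat r g)ᴴ * formJ (p ⊕ r) q * embMat r g = formJ (p ⊕ r) q := by
  rw [formJ_eq, ← embMat_eq, ← embMat_star, ← embMat_mul, ← embMat_mul, hg]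

lemma embMat_one : embMat r (1 : Matrix (p ⊕ q) (p ⊕ q) ℂ) = 1 := by
  rw [embMat_eq, fromBlocks_one, submatrix_one_equiv]

/-- The inclusion of `SU(p,q)` in `SU(p + r,q)` as the subgroup that fixes the block `r`. -/
def embSU (r : Type) [Fintype r] [DecidableEq r] : SU p q →* SU (p ⊕ r) q where
  toFun g := ⟨⟨embMat r (mat g), (embMat_det (mat g)).trans g.1.2⟩, embMat_form (mat_form g)⟩
  map_one' := Subtype.ext (Subtype.ext embMat_one)
  map_mul' g h := Subtype.ext (Subtype.ext (embMat_mul (mat g) (mat h)))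

/-- The inclusion `z' ↦ (z', 0)` of the ball in `M_{p,q}` in the ball in `M_{p + r,q}`. -/
def embBall (r : Type) [Fintype r] [DecidableEq r] (z : Ball p q) : Ball (p ⊕ r) q :=
  ⟨fromRows z.1 0, by
    have h : (fromRows z.1 (0 : Matrix r q ℂ))ᴴ * (fromRows z.1 0 : Matrix (p ⊕ r) q ℂ) =
        z.1ᴴ * z.1 := by
      rw [conjTranspose_fromRows_eq_fromCols_conjTranspose, fromCols_mul_fromRows]; simp
    change (1 - (fromRows z.1 (0 : Matrix r q ℂ))ᴴ *
      (fromRows z.1 0 : Matrix (p ⊕ r) q ℂ)).PosDef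
    rw [h]; exact z.2⟩

/-- The projection `(z', z'') ↦ z'` from the ball in `M_{p + r,q}` to the ball in `M_{p,q}`. -/
def projBall (z : Ball (p ⊕ r) q) : Ball p q :=
  ⟨z.1.toRows₁, by
    have h : z.1ᴴ * z.1 = z.1.toRows₁ᴴ * z.1.toRows₁ + z.1.toRows₂ᴴ * z.1.toRows₂ := by
      conv_lhs => rw [← fromRows_toRows z.1]
      rw [conjTranspose_fromRows_eq_fromCols_conjTranspose, fromCols_mul_fromRows]
    have h2 : 1 - z.1.toRows₁ᴴ * z.1.toRows₁ =
        (1 - z.1ᴴ * z.1) + z.1.toRows₂ᴴ * z.1.toRows₂ := by rw [h]; abel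
    change (1 - z.1.toRows₁ᴴ * z.1.toRows₁).PosDef
    rw [h2]
    exact PosDef.add_posSemidef z.2 (posSemidef_conjTranspose_mul_self _)⟩

lemma den_emb (g : SU p q) (z : Ball (p ⊕ r) q) :
    den (embSU r g) z.1 = den g (projBall z).1 := by
  have h := fromCols_mul_fromRows (mat g).toBlocks₂₁ (0 : Matrix q r ℂ) z.1.toRows₁ z.1.toRows₂
  rw [fromRows_toRows] at h
  change (fromCols (mat g).toBlocks₂₁ (0 : Matrix q r ℂ)) * z.1 + (mat g).toBlocks₂₂ = _
  rw [h]; simp [den, projBall]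

lemma proj_smul (g : SU p q) (z : Ball (p ⊕ r) q) :
    projBall (embSU r g • z) = g • projBall z := by
  apply Subtype.ext
  have h := fromBlocks_mul_fromRows z.1.toRows₁ z.1.toRows₂ (mat g).toBlocks₁₁ 0 0
    (1 : Matrix r r ℂ)
  rw [fromRows_toRows] at h
  change (((fromBlocks (mat g).toBlocks₁₁ 0 0 (1 : Matrix r r ℂ)) * z.1 +
    fromRows (mat g).toBlocks₁₂ 0) * (den (embSU r g) z.1)⁻¹).toRows₁ = _
  rw [h, den_emb, smul_val]
  ext i j
  simp [num, projBall, Matrix.mul_apply, toRows₁]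

/-- The inclusion of the covering groups: on the larger ball `det (c z + d)` only depends on `z'`,
and so does its logarithm. -/
def embCover (r : Type) [Fintype r] [DecidableEq r] : Cover p q →* Cover (p ⊕ r) q where
  toFun γ :=
    { toSU := embSU r γ.toSU
      log := ⟨fun z => γ.log (projBall z), γ.log.continuous.comp <|
        Continuous.subtype_mk (continuous_matrix fun i j =>
          continuous_subtype_val.matrix_elem (Sum.inl i) j) _⟩
      exp_log := fun z => by rw [den_emb]; exact γ.exp_log _ }
  map_one' := Cover.ext (map_one _) fun z => rfl
  map_mul' γ δ := Cover.ext (map_mul _ _ _) fun z => by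
    change γ.log (δ.toSU • projBall z) + _ = γ.log (projBall (embSU r δ.toSU • z)) + _
    rw [proj_smul]
    rfl

end Embedding

/-! ### Unitary representations -/

section Representations

/-- The operator-valued kernel of a scalar kernel. -/
def opKernel {X : Type} (k : X → X → ℂ) : Matrix X X (ℂ →L[ℂ] ℂ) :=
  Matrix.of fun z w => k z w • ContinuousLinearMap.id ℂ ℂ

/-- A complex-valued function of two variables is a positive definite kernel. -/
abbrev IsPosDefKernel {X : Type} (k : X → X → ℂ) : Prop := Fact (opKernel k).PosSemidef

/-- The Hilbert space of functions on `X` with reproducing kernel `k`. -/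
abbrev KernelSpace {X : Type} (k : X → X → ℂ) [IsPosDefKernel k] : Type :=
  RKHS.OfKernel (opKernel k)

variable {Γ X H : Type} [Group Γ] [MulAction Γ X] [NormedAddCommGroup H] [InnerProductSpace ℂ H]

/-- `π` is a (strongly continuous) unitary representation on a Hilbert space of holomorphic
functions on `X`, given by `(π(g) f)(x) = m(g, x) f(g⁻¹ x)`. Here `hol` is the set of holomorphic
functions on `X`. -/
structure IsScalarRep [TopologicalSpace Γ] [RKHS ℂ H X ℂ] (hol : Set (X → ℂ)) (m : Γ → X → ℂ)
    (π : Γ →* (H ≃ₗᵢ[ℂ] H)) : Prop where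
  holomorphic : ∀ f : H, ⇑f ∈ hol
  continuous : ∀ f : H, Continuous fun g => π g f
  apply : ∀ g (f : H) x, (π g f) x = m g x * f (g⁻¹ • x)

/-- The closed subspace `V` is invariant, and the unitary representation of `Γ` on it is an
irreducible holomorphic representation: it is equivalent to a representation on a
Hilbert space of holomorphic functions on `X` with values in some `ℂᵈ`, with continuous point
evaluations, on which `Γ` acts by `(g F)(x) = J(g, x) F(g⁻¹ x)` for a holomorphic cocycle `J` with
values in `GL_d(ℂ)`. Here `hol` is the set of holomorphic functions on `X`. -/
structure IsHolomorphicPiece (hol : Set (X → ℂ)) (π : Γ →* (H ≃ₗᵢ[ℂ] H)) (V : Submodule ℂ H) :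
    Prop where
  isClosed : IsClosed (V : Set H)
  invariant : ∀ g, ∀ v ∈ V, π g v ∈ V
  ne_bot : V ≠ ⊥
  irreducible : ∀ W : Submodule ℂ H, W ≤ V → IsClosed (W : Set H) →
    (∀ g, ∀ w ∈ W, π g w ∈ W) → W = ⊥ ∨ W = V
  realized : ∃ (d : ℕ) (J : Γ → X → GL (Fin d) ℂ) (T : V →ₗ[ℂ] (X → Fin d → ℂ)),
    (∀ g h x, J (g * h) x = J g x * J h (g⁻¹ • x)) ∧
    (∀ g a b, (fun x => (J g x).1 a b) ∈ hol) ∧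
    Function.Injective T ∧
    (∀ x, Continuous fun v => T v x) ∧
    (∀ v a, (fun x => T v x a) ∈ hol) ∧
    (∀ g (v : V) x, T ⟨π g v, invariant g v v.2⟩ x = (J g x).1 *ᵥ T v (g⁻¹ • x))

/-- The unitary representation `π` is a discrete (Hilbert) direct sum of irreducible holomorphic
representations. -/
def IsDiscreteSumOfHolomorphic (hol : Set (X → ℂ)) (π : Γ →* (H ≃ₗᵢ[ℂ] H)) : Prop :=
  ∃ (ι : Type) (V : ι → Submodule ℂ H),
    (∀ i, IsHolomorphicPiece hol π (V i)) ∧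
    OrthogonalFamily ℂ (fun i => V i) (fun i => (V i).subtypeₗᵢ) ∧
    (⨆ i, V i).topologicalClosure = ⊤

/-- The unitary representation `σ` is a discrete summand of `π`: it is unitarily equivalent
to a subrepresentation of `π`. -/
def IsDiscreteSummand {H' : Type} [NormedAddCommGroup H'] [InnerProductSpace ℂ H']
    (σ : Γ →* (H' ≃ₗᵢ[ℂ] H')) (π : Γ →* (H ≃ₗᵢ[ℂ] H)) : Prop :=
  ∃ S : H' →ₗᵢ[ℂ] H, ∀ g v, S (σ g v) = π g (S v)

/-- `T` intertwines `π` and `σ`. -/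
def Intertwines {H' : Type} [NormedAddCommGroup H'] [InnerProductSpace ℂ H']
    (T : H →L[ℂ] H') (π : Γ →* (H ≃ₗᵢ[ℂ] H)) (σ : Γ →* (H' ≃ₗᵢ[ℂ] H')) : Prop :=
  ∀ g v, T (π g v) = σ g (T v)

end Representations

/-! ### The scalar holomorphic representations -/

section Scalar

variable {p q : Type} [Fintype p] [DecidableEq p] [Fintype q] [DecidableEq q]

/-- The kernel `det (1 - w* z) ^ (-ν)`. When `q` has at most two elements, all eigenvalues of
`1 - w* z` have positive real part, so that the determinant avoids the cut `(-∞, 0]` and the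
principal branch is the holomorphic one that equals `1` at the origin. -/
def kern (p q : Type) [Fintype p] [Fintype q] [DecidableEq q] (ν : ℝ) (z w : Ball p q) : ℂ :=
  (1 - w.1ᴴ * z.1).det ^ (-(ν : ℂ))

/-- The multiplier `det (c z + d) ^ (-ν)`, where `g⁻¹ = [a b; c d]`. -/
def mult (ν : ℝ) (γ : Cover p q) (z : Ball p q) : ℂ := Complex.exp (-(ν : ℂ) * γ⁻¹.log z)

/-- The kernel `(1 - ⟨z₁, w₁⟩) ^ (-ν) (1 - ⟨w₂, z₂⟩) ^ (-ν)` on the product of two balls. -/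
def kernC (p q : Type) [Fintype p] [Fintype q] [DecidableEq q] (ν : ℝ)
    (z w : Ball p q × Ball p q) : ℂ := kern p q ν z.1 w.1 * kern p q ν w.2 z.2

/-- The multiplier `det (c₁ z₁ + d₁) ^ (-ν)` times the conjugate of `det (c₂ z₂ + d₂) ^ (-ν)`. -/
def multC (ν : ℝ) (γ : Cover p q × Cover p q) (z : Ball p q × Ball p q) : ℂ :=
  mult ν γ.1 z.1 * star (mult ν γ.2 z.2)

/-- Holomorphic functions on the ball. -/
def hol (p q : Type) [Fintype p] [Fintype q] [DecidableEq q] : Set (Ball p q → ℂ) :=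
  {f | ∃ F : Matrix p q ℂ → ℂ, DifferentiableOn ℂ F (ballSet p q) ∧ ∀ z, f z = F z.1}

/-- Functions `f(z₁, z₂)` on the product of two balls that are holomorphic in `z₁` and
antiholomorphic in `z₂`, that is, holomorphic in `(z₁, conj z₂)`. -/
def holC (p q : Type) [Fintype p] [Fintype q] [DecidableEq q] :
    Set (Ball p q × Ball p q → ℂ) :=
  {f | ∃ F : Matrix p q ℂ × Matrix p q ℂ → ℂ,
    DifferentiableOn ℂ F (ballSet p q ×ˢ ballSet p q) ∧
    ∀ z, f z = F (z.1.1, z.2.1.map star)}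

end Scalar

/-! ### The normal differential operators -/

section NormalDerivatives

variable {p r q : Type} [Fintype p] [DecidableEq p] [Fintype r] [DecidableEq r]
  [Fintype q] [DecidableEq q]

/-- Extension by zero of a function on the (open) ball. -/
def extBall (f : Ball p q → ℂ) : Matrix p q ℂ → ℂ := Function.extend Subtype.val f 0

/-- Extension by zero of a function on the product of two balls. -/
def extBallC (f : Ball p q × Ball p q → ℂ) : Matrix p q ℂ × Matrix p q ℂ → ℂ :=
  Function.extend (Prod.map Subtype.val Subtype.val) f 0

/-- The derivative along the `(a, b)` entry of the last block `z_n` of `z = (z', z_n)`. -/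
def pd (a : r) (b : q) (F : Matrix (p ⊕ r) q ℂ → ℂ) : Matrix (p ⊕ r) q ℂ → ℂ :=
  fun z => lineDeriv ℂ F z (Matrix.single (Sum.inr a) b 1)

/-- The operator `f ↦ ∂_{Q^j} f`, restricted to the smaller ball, for `Q = z_n`. -/
def normalDeriv (j : ℕ) (f : Ball (p ⊕ Fin 1) (Fin 1) → ℂ) (z : Ball p (Fin 1)) : ℂ :=
  ((pd 0 0)^[j] (extBall f)) (embBall (Fin 1) z).1

/-- The operator `∂_Q` for `Q = z_n conj(w_n)`, on functions of `(z, w)`: the complex derivative in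
`z_n` and the derivative in the conjugate of `w_n`. -/
def pdC (F : Matrix (p ⊕ Fin 1) (Fin 1) ℂ × Matrix (p ⊕ Fin 1) (Fin 1) ℂ → ℂ) :
    Matrix (p ⊕ Fin 1) (Fin 1) ℂ × Matrix (p ⊕ Fin 1) (Fin 1) ℂ → ℂ :=
  fun z => pd 0 0 (fun z₁ =>
    deriv (fun t : ℂ => F (z₁, z.2 + star t • Matrix.single (Sum.inr 0) 0 1)) 0) z.1

/-- The operator `f ↦ ∂_{Q^j} f`, restricted to the product of the smaller balls, for
`Q = z_n conj(w_n)`. -/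
def normalDerivC (j : ℕ) (f : Ball (p ⊕ Fin 1) (Fin 1) × Ball (p ⊕ Fin 1) (Fin 1) → ℂ)
    (z : Ball p (Fin 1) × Ball p (Fin 1)) : ℂ :=
  (pdC^[j] (extBallC f)) ((embBall (Fin 1) z.1).1, (embBall (Fin 1) z.2).1)

/-- The operator `∂_Q` for `Q = det z_n`, with `z_n` the last `2 × 2` block. -/
def pdDet (F : Matrix (p ⊕ Fin 2) (Fin 2) ℂ → ℂ) : Matrix (p ⊕ Fin 2) (Fin 2) ℂ → ℂ :=
  fun z => pd 0 0 (pd 1 1 F) z - pd 0 1 (pd 1 0 F) z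

/-- The operator `f ↦ ∂_{Q^j} f`, restricted to the smaller ball, for `Q = det z_n`. -/
def normalDerivH (j : ℕ) (f : Ball (p ⊕ Fin 2) (Fin 2) → ℂ) (z : Ball p (Fin 2)) : ℂ :=
  (pdDet^[j] (extBall f)) (embBall (Fin 2) z).1

end NormalDerivatives

end HoloBranching
end
open HoloBranching

namespace HoloBranching

open Filter Topology Metric

/-! ### Holomorphic functions on open subsets of normed spaces -/

section Analysis

variable {E : Type*} [NormedAddCommGroup E] [NormedSpace ℂ E]

/-! Write a point of `D` as (z', z''), with z'' the last block. The smaller group moves z' by its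
fractional linear action, multiplies z'' on the right by (cz'+d)⁻¹, and has a multiplier that
depends on z' alone (`coordRows_smul`, `mult_embCover`). So over `D₁` it acts linearly on the fibres
z''. In Case ℂ the same is true once the second variable is conjugated. `BranchingData` records
exactly this structure, and the decomposition is proved from it for all cases at once.

Decomposition. Scaling z'' by the unit circle is unitary and commutes with the smaller group, so its
weight spaces `homSub R n` (functions homogeneous of degree n in z'') are invariant and mutually
orthogonal. The n-th derivatives at z'' = 0 turn a function of degree n into a holomorphic function
of z' with values in the finite-dimensional space of polynomials of degree n on the fibre, and
nothing is lost; this realises every invariant subspace of degree n as a holomorphic representation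
(`isHolomorphicPiece`). Irreducible subspaces exist because base rotations s z' act on degree n as
group elements do, up to a scalar: each non-zero closed invariant subspace therefore contains a
non-zero function of z'' alone (`exists_mem_fixSub`). Such functions form a finite-dimensional
space, and an invariant subspace that meets it in the least dimension is irreducible
(`exists_irreducible`). A maximal orthogonal family of irreducible pieces exhausts the space: a
vector orthogonal to it has a non-zero jet of some order n, which yields a further piece of degree
n.

Scalar summands and intertwiners. Each functional f ↦ ∂_{Q^j} f (z', 0) is bounded, as a repeated
limit of difference quotients (`IsHolFamily.dirD`). Cayley-type identities give ∂_Q det(1-w*z)^(-s)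
= c(s) conj(Q(w)) det(1-w*z)^(-s-1), with c(s) = s or s(s-1), so the functional is represented by a
positive multiple of Q(w)^j k_{ν+j}(w', z'). Differentiating this once more returns a positive
multiple of k_{ν+j}. Hence the normalised representatives have Gram matrix k_{ν+j} and define an
isometry, which intertwines because Q^j supplies the factor det(cz'+d)^(-j); its adjoint is the
differential operator up to a scalar (`exists_summand`).

Kernels. For z, w in the ball, 1 - w*z has positive definite Hermitian part, so for blocks of size
at most 2 its determinant avoids the cut of the logarithm; connectedness then gives covariance with
the correct branch (`logK_smul`). Positive definiteness of (1-G)^(-ν) is the Gamma integral applied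
to exp(-t(1-G)). For 2×2 determinants one splits off a Schur complement S, writes a^(-ν) S^(-ν) =
a^(-(ν-1)) · a⁻¹ S^(-ν), and obtains a⁻¹ exp(-sS) from a Gaussian integral (`posSemidef_gauss`). -/

/-- A limit of holomorphic functions that is uniform near every point is holomorphic. -/
lemma differentiableOn_of_tendstoUniformlyOn_nhds {f : ℕ → E → ℂ} {g : E → ℂ} {U : Set E}
    (hU : IsOpen U) (hf : ∀ n, DifferentiableOn ℂ (f n) U)
    (h : ∀ x ∈ U, ∃ t ∈ 𝓝 x, TendstoUniformlyOn f g atTop t) : DifferentiableOn ℂ g U := by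
  intro x hx
  obtain ⟨t, ht, hft⟩ := h x hx
  obtain ⟨r', hr', hball⟩ := Metric.mem_nhds_iff.1 (inter_mem (hU.mem_nhds hx) ht)
  obtain ⟨r, hr, rfl⟩ : ∃ r : ℝ, 0 < r ∧ r' = 2 * r := ⟨r' / 2, by positivity, by ring⟩
  have hsub : ∀ y ∈ ball x r, ball y r ⊆ ball x (2 * r) := fun y hy =>
    ball_subset_ball' (by have := mem_ball.1 hy; linarith)
  have hd : ∀ n, ∀ y ∈ ball x r, DifferentiableAt ℂ (f n) y := fun n y hy =>
    (hf n).differentiableAt (hU.mem_nhds (hball (hsub y hy (mem_ball_self hr))).1)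
  -- Cauchy estimate: if f m - f n is at most εr/4 on the double ball, it oscillates by at most εr/2
  -- on each ball of radius r about y, so its derivative at y is at most ε/2.
  have hcau : UniformCauchySeqOn (fun n => fderiv ℂ (f n)) atTop (ball x r) := by
    rw [Metric.uniformCauchySeqOn_iff]
    intro ε hε
    have hc := (hft.uniformCauchySeqOn.mono fun y hy => (hball hy).2)
    obtain ⟨N, hN⟩ := Metric.uniformCauchySeqOn_iff.1 hc (ε * r / 4) (by positivity)
    refine ⟨N, fun m hm n hn y hy => ?_⟩
    have hmaps : Set.MapsTo (f m - f n) (ball y r) (closedBall ((f m - f n) y) (ε * r / 2)) := by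
      intro w hw
      have h1 := hN m hm n hn w (hsub y hy hw)
      have h2 := hN m hm n hn y (hsub y hy (mem_ball_self hr))
      rw [dist_eq_norm] at h1 h2
      rw [mem_closedBall, dist_eq_norm]
      calc _ ≤ ‖f m w - f n w‖ + ‖f m y - f n y‖ := norm_sub_le _ _
        _ ≤ _ := by linarith
    have hdiff : DifferentiableOn ℂ (f m - f n) (ball y r) :=
      ((hf m).sub (hf n)).mono fun w hw => (hball (hsub y hy hw)).1
    have h3 := Complex.norm_fderiv_le_div_of_mapsTo_ball hdiff hmaps hr
    rw [fderiv_sub (hd m y hy) (hd n y hy)] at h3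
    rw [dist_eq_norm]
    calc _ ≤ _ := h3
      _ = ε / 2 := by field_simp
      _ < ε := by linarith
  have hlim : ∀ y ∈ ball x r, ∃ L, Tendsto (fun n => fderiv ℂ (f n) y) atTop (𝓝 L) := fun y hy =>
    cauchySeq_tendsto_of_complete (hcau.cauchySeq hy)
  choose! g' hg' using hlim
  have hg := hcau.tendstoUniformlyOn_of_tendsto hg'
  exact (hasFDerivAt_of_tendstoUniformlyOn isOpen_ball hg
    (fun n y hy => (hd n y hy).hasFDerivAt)
    (fun y hy => hft.tendsto_at (hball (hsub y hy (mem_ball_self hr))).2)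
    (mem_ball_self hr)).differentiableAt.differentiableWithinAt

/-- The Schwarz lemma, twice: for `g` it bounds the difference quotient `dslope g 0` by 2M/r, and
for that quotient, whose oscillation is at most 4M/r, it bounds the distance to the value at 0. -/
lemma norm_slope_sub_deriv_le {g : ℂ → ℂ} {M r : ℝ} (hr : 0 < r)
    (hg : DifferentiableOn ℂ g (ball 0 r)) (hM : ∀ t ∈ ball (0 : ℂ) r, ‖g t‖ ≤ M) {t : ℂ}
    (ht : t ∈ ball (0 : ℂ) r) (ht0 : t ≠ 0) :
    ‖t⁻¹ * (g t - g 0) - deriv g 0‖ ≤ 4 * M / r / r * ‖t‖ := by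
  have h0 : (0 : ℂ) ∈ ball (0 : ℂ) r := mem_ball_self hr
  have hM0 : 0 ≤ M := (norm_nonneg _).trans (hM 0 h0)
  have h1 : ∀ s ∈ ball (0 : ℂ) r, ‖dslope g 0 s‖ ≤ 2 * M / r := fun s hs =>
    Complex.norm_dslope_le_div_of_mapsTo_ball hg (fun w hw => by
      rw [mem_closedBall, dist_eq_norm]
      linarith [norm_sub_le (g w) (g 0), hM w hw, hM 0 h0]) hs
  have h2 : DifferentiableOn ℂ (dslope g 0) (ball 0 r) :=
    (Complex.differentiableOn_dslope (isOpen_ball.mem_nhds h0)).2 hg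
  have h3 := Complex.dist_le_div_mul_dist_of_mapsTo_ball (R₂ := 4 * M / r) h2 (fun w hw => by
      rw [mem_closedBall, dist_eq_norm]
      calc _ ≤ _ := norm_sub_le _ _
        _ ≤ 2 * M / r + 2 * M / r := add_le_add (h1 w hw) (h1 0 h0)
        _ = _ := by ring) ht
  rw [dslope_same, dslope_of_ne _ ht0, slope_def_field, dist_eq_norm, dist_zero_right, sub_zero,
    div_eq_inv_mul] at h3
  exact h3

lemma differentiableAt_comp_line {F : E → ℂ} {z v : E} {t : ℂ}
    (h : DifferentiableAt ℂ F (z + t • v)) : DifferentiableAt ℂ (fun s : ℂ => F (z + s • v)) t :=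
  h.comp t (f := fun s : ℂ => z + s • v) (by fun_prop)

/-- Near every point, difference quotients converge uniformly to the derivative along a line. -/
lemma tendstoUniformlyOn_slope {F : E → ℂ} {U : Set E} (hU : IsOpen U)
    (hF : DifferentiableOn ℂ F U) (v : E) {x : E} (hx : x ∈ U) :
    ∃ t ∈ 𝓝 x, TendstoUniformlyOn (fun (n : ℕ) z =>
      ((n : ℂ) + 1) * (F (z + ((n : ℂ) + 1)⁻¹ • v) - F z)) (fun z => lineDeriv ℂ F z v)
      atTop t := by
  have hc : ContinuousAt F x := (hF.differentiableAt (hU.mem_nhds hx)).continuousAt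
  have hb : {z | ‖F z‖ ≤ ‖F x‖ + 1} ∈ 𝓝 x :=
    (hc.norm.eventually (ge_mem_nhds (lt_add_one _)))
  obtain ⟨R, hR, hball⟩ := Metric.mem_nhds_iff.1 (inter_mem (hU.mem_nhds hx) hb)
  set M := ‖F x‖ + 1
  have hM : 0 < M := by positivity
  obtain ⟨r, hr, hrv⟩ : ∃ r : ℝ, 0 < r ∧ r * ‖v‖ < R / 2 := by
    refine ⟨R / 2 / (‖v‖ + 1), by positivity, ?_⟩
    rw [div_mul_eq_mul_div, div_lt_iff₀ (by positivity)]
    nlinarith [norm_nonneg v]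
  have key : ∀ z ∈ ball x (R / 2), ∀ t ∈ ball (0 : ℂ) r, z + t • v ∈ U ∩ {z | ‖F z‖ ≤ M} := by
    intro z hz t ht
    refine hball ?_
    rw [mem_ball, dist_eq_norm] at *
    rw [sub_zero] at ht
    calc ‖z + t • v - x‖ = ‖(z - x) + t • v‖ := by congr 1; abel
      _ ≤ ‖z - x‖ + ‖t‖ * ‖v‖ := (norm_add_le _ _).trans (by rw [norm_smul])
      _ ≤ ‖z - x‖ + r * ‖v‖ := by gcongr
      _ < R := by linarith
  refine ⟨ball x (R / 2), ball_mem_nhds _ (by positivity), ?_⟩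
  rw [Metric.tendstoUniformlyOn_iff]
  intro ε hε
  have hlim : Tendsto (fun n : ℕ => 1 / ((n : ℝ) + 1)) atTop (𝓝 0) :=
    tendsto_one_div_add_atTop_nhds_zero_nat
  have hlim2 := hlim.const_mul (4 * M / r / r)
  rw [mul_zero] at hlim2
  filter_upwards [hlim.eventually (gt_mem_nhds hr), hlim2.eventually (gt_mem_nhds hε)]
    with n hn1 hn2 z hz
  have hnn : ((n : ℂ) + 1) ≠ 0 := Nat.cast_add_one_ne_zero n
  have hnorm : ‖((n : ℂ) + 1)⁻¹‖ = 1 / ((n : ℝ) + 1) := by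
    rw [norm_inv, one_div]; norm_cast
  have h := norm_slope_sub_deriv_le (g := fun t => F (z + t • v)) (M := M) hr
    (fun t ht => (differentiableAt_comp_line
      (hF.differentiableAt (hU.mem_nhds (key z hz t ht).1))).differentiableWithinAt)
    (fun t ht => (key z hz t ht).2) (t := ((n : ℂ) + 1)⁻¹)
    (by rw [mem_ball, dist_zero_right, hnorm]; exact hn1) (inv_ne_zero hnn)
  rw [dist_comm, dist_eq_norm]
  simp only [inv_inv, zero_smul, add_zero, hnorm] at h
  exact h.trans_lt hn2

/-- Difference quotients are holomorphic and converge locally uniformly, so their limit is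
holomorphic. This works in any complex normed space. -/
lemma differentiableOn_lineDeriv {F : E → ℂ} {U : Set E} (hU : IsOpen U)
    (hF : DifferentiableOn ℂ F U) (v : E) :
    DifferentiableOn ℂ (fun z => lineDeriv ℂ F z v) U := by
  intro x hx
  let V : ℕ → Set E := fun n => U ∩ (fun z => z + ((n : ℂ) + 1)⁻¹ • v) ⁻¹' U
  obtain ⟨t, ht, hlim⟩ := tendstoUniformlyOn_slope hU hF v hx
  obtain ⟨R, hR, hball⟩ := Metric.mem_nhds_iff.1 (inter_mem (hU.mem_nhds hx) ht)
  have h0 : Tendsto (fun n : ℕ => ‖((n : ℂ) + 1)⁻¹ • v‖) atTop (𝓝 0) := by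
    have hlim : Tendsto (fun n : ℕ => 1 / ((n : ℝ) + 1)) atTop (𝓝 0) :=
      tendsto_one_div_add_atTop_nhds_zero_nat
    have := hlim.mul_const ‖v‖
    rw [zero_mul] at this
    refine this.congr fun n => ?_
    rw [norm_smul, norm_inv, one_div]; norm_cast
  -- The first N quotients are dropped, since their translates might leave the domain.
  obtain ⟨N, hN⟩ := eventually_atTop.1 (h0.eventually (gt_mem_nhds (half_pos hR)))
  have hsub : ball x (R / 2) ⊆ ball x R := ball_subset_ball (by linarith)
  have := differentiableOn_of_tendstoUniformlyOn_nhds (U := ball x (R / 2)) isOpen_ball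
    (f := fun n z => (((n + N : ℕ) : ℂ) + 1) * (F (z + (((n + N : ℕ) : ℂ) + 1)⁻¹ • v) - F z))
    (g := fun z => lineDeriv ℂ F z v) (fun n => ?_) (fun y hy => ?_)
  · exact (this x (mem_ball_self (by positivity))).differentiableAt
      (ball_mem_nhds _ (by positivity)) |>.differentiableWithinAt
  · refine (DifferentiableOn.sub ?_ (hF.mono fun z hz => (hball (hsub hz)).1)).const_mul _
    refine hF.comp (by fun_prop) fun z hz => (hball ?_).1
    have h1 := hN (n + N) (Nat.le_add_left _ _)
    rw [mem_ball, dist_eq_norm] at *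
    calc _ = ‖(z - x) + (((n + N : ℕ) : ℂ) + 1)⁻¹ • v‖ := by congr 1; abel
      _ ≤ _ := norm_add_le _ _
      _ < R := by linarith
  · refine ⟨ball x (R / 2), isOpen_ball.mem_nhds hy, ?_⟩
    have h2 := hlim.mono (fun z hz => (hball (hsub hz)).2)
    exact fun u hu => (tendsto_add_atTop_nat N).eventually (h2 u hu)

end Analysis


open Filter Topology Metric

/-! ### Iterated directional derivatives -/

section LineDeriv

variable {E : Type*} [NormedAddCommGroup E] [NormedSpace ℂ E]

/-- The derivative along `v`, as an operator on functions. -/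
noncomputable def dirD (v : E) (F : E → ℂ) : E → ℂ := fun z => lineDeriv ℂ F z v

lemma differentiableOn_dirD {F : E → ℂ} {U : Set E} (hU : IsOpen U)
    (hF : DifferentiableOn ℂ F U) (v : E) : DifferentiableOn ℂ (dirD v F) U :=
  differentiableOn_lineDeriv hU hF v

lemma dirD_congr {F G : E → ℂ} {U : Set E} (hU : IsOpen U) (h : Set.EqOn F G U) (v : E) :
    Set.EqOn (dirD v F) (dirD v G) U := fun _ hz =>
  (h.eventuallyEq_of_mem (hU.mem_nhds hz)).lineDeriv_eq

lemma dirD_iterate_congr {F G : E → ℂ} {U : Set E} (hU : IsOpen U) (h : Set.EqOn F G U) (v : E)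
    (n : ℕ) : Set.EqOn ((dirD v)^[n] F) ((dirD v)^[n] G) U := by
  induction n generalizing F G with
  | zero => exact h
  | succ n ih => exact ih (dirD_congr hU h v)

lemma differentiableOn_dirD_iterate {F : E → ℂ} {U : Set E} (hU : IsOpen U)
    (hF : DifferentiableOn ℂ F U) (v : E) (n : ℕ) : DifferentiableOn ℂ ((dirD v)^[n] F) U := by
  induction n generalizing F with
  | zero => exact hF
  | succ n ih => exact ih (differentiableOn_dirD hU hF v)

/-- No smoothness of `F` is needed: `lineDeriv` is by definition a derivative in one variable. Fibre
jets thus become Taylor coefficients on a disc. -/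
lemma dirD_iterate_add_smul (F : E → ℂ) (z v : E) (n : ℕ) (s : ℂ) :
    ((dirD v)^[n] F) (z + s • v) = iteratedDeriv n (fun t : ℂ => F (z + t • v)) s := by
  induction n generalizing s with
  | zero => simp
  | succ n ih =>
    rw [Function.iterate_succ_apply', iteratedDeriv_succ, dirD, lineDeriv]
    have : (fun t : ℂ => ((dirD v)^[n] F) (z + s • v + t • v)) =
        fun t => iteratedDeriv n (fun t : ℂ => F (z + t • v)) (s + t) := by
      ext t
      rw [← ih, add_smul, add_assoc]
    rw [this, deriv_comp_const_add, add_zero]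

lemma dirD_iterate_eq (F : E → ℂ) (z v : E) (n : ℕ) :
    ((dirD v)^[n] F) z = iteratedDeriv n (fun t : ℂ => F (z + t • v)) 0 := by
  rw [← dirD_iterate_add_smul, zero_smul, add_zero]

lemma dirD_apply_of_differentiableAt {F : E → ℂ} {z : E} (h : DifferentiableAt ℂ F z) (v : E) :
    dirD v F z = fderiv ℂ F z v := h.lineDeriv_eq_fderiv

lemma dirD_iterate_sum {ι : Type*} (s : Finset ι) (c : ι → ℂ) {F : ι → E → ℂ} {U : Set E}
    (hU : IsOpen U) (hF : ∀ i, DifferentiableOn ℂ (F i) U) (v : E) (n : ℕ) :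
    Set.EqOn ((dirD v)^[n] (fun z => ∑ i ∈ s, c i * F i z))
      (fun z => ∑ i ∈ s, c i * ((dirD v)^[n] (F i)) z) U := by
  induction n generalizing F with
  | zero => exact fun z _ => rfl
  | succ n ih =>
    have h1 : Set.EqOn (dirD v (fun z => ∑ i ∈ s, c i * F i z))
        (fun z => ∑ i ∈ s, c i * dirD v (F i) z) U := by
      intro z hz
      have hd := fun i => (hF i).differentiableAt (hU.mem_nhds hz)
      have hd2 : ∀ i ∈ s, DifferentiableAt ℂ (fun z => c i * F i z) z :=
        fun i _ => (hd i).const_mul _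
      rw [dirD_apply_of_differentiableAt (DifferentiableAt.fun_sum hd2), fderiv_fun_sum hd2]
      simp only [_root_.sum_apply]
      refine Finset.sum_congr rfl fun i _ => ?_
      rw [fderiv_const_mul (hd i), dirD_apply_of_differentiableAt (hd i)]
      rfl
    intro z hz
    rw [Function.iterate_succ_apply, dirD_iterate_congr hU h1 v n hz,
      ih (fun i => differentiableOn_dirD hU (hF i) v) hz]
    rfl

end LineDeriv

/-! ### Homogeneous polynomials and dependence on the direction -/

section Poly

variable {E Z : Type*} [NormedAddCommGroup E] [NormedSpace ℂ E]
  [NormedAddCommGroup Z] [NormedSpace ℂ Z]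

/-- The linear functionals, as functions. -/
def linearFunctions (Z : Type*) [AddCommGroup Z] [Module ℂ Z] : Submodule ℂ (Z → ℂ) :=
  LinearMap.range (LinearMap.ltoFun ℂ Z ℂ ℂ)

lemma mem_linearFunctions {Z : Type*} [AddCommGroup Z] [Module ℂ Z] (l : Z →ₗ[ℂ] ℂ) :
    (fun y => l y) ∈ linearFunctions Z := ⟨l, rfl⟩

/-- The homogeneous polynomial functions of degree `n`. -/
def polySpace (Z : Type*) [AddCommGroup Z] [Module ℂ Z] (n : ℕ) : Submodule ℂ (Z → ℂ) :=
  linearFunctions Z ^ n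

lemma finiteDimensional_polySpace (Z : Type*) [AddCommGroup Z] [Module ℂ Z]
    [FiniteDimensional ℂ Z] (n : ℕ) : FiniteDimensional ℂ (polySpace Z n) := by
  refine Module.Finite.iff_fg.2 (Submodule.FG.pow ?_ n)
  exact Module.Finite.iff_fg.1 (LinearMap.finiteDimensional_range _)

lemma polySpace_comp {n : ℕ} {P : Z → ℂ} (hP : P ∈ polySpace Z n) (a : Z →ₗ[ℂ] Z) :
    (fun y => P (a y)) ∈ polySpace Z n := by
  induction hP using Submodule.pow_induction_on_left' with
  | algebraMap r =>
    exact Submodule.algebraMap_mem r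
  | add x y i hx hy h1 h2 => exact (polySpace Z i).add_mem h1 h2
  | mem_mul m hm i x hx h =>
    obtain ⟨l, rfl⟩ := hm
    rw [polySpace, pow_succ']
    exact Submodule.mul_mem_mul (mem_linearFunctions (l.comp a)) h

/-- The innermost derivative is linear in its direction because `F` is differentiable. Expand that
direction in a basis; the coefficients are the holomorphic functions `dirD (j (b i)) F`, to which
induction applies. -/
lemma dirD_iterate_mem_polySpace [FiniteDimensional ℂ Z] {F : E → ℂ} {U : Set E} (hU : IsOpen U)
    (hF : DifferentiableOn ℂ F U) (j : Z →ₗ[ℂ] E) {z : E} (hz : z ∈ U) (n : ℕ) :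
    (fun y => ((dirD (j y))^[n] F) z) ∈ polySpace Z n := by
  induction n generalizing F with
  | zero =>
    exact Submodule.algebraMap_mem (R := ℂ) (A := Z → ℂ) (F z)
  | succ n ih =>
    let b := Module.finBasis ℂ Z
    have h : (fun y => ((dirD (j y))^[n + 1] F) z) =
        ∑ i, (fun y => b.coord i y) * fun y => ((dirD (j y))^[n] (dirD (j (b i)) F)) z := by
      ext y
      have h1 : Set.EqOn (dirD (j y) F) (fun w => ∑ i, b.coord i y * dirD (j (b i)) F w) U := by
        intro w hw
        have hd := hF.differentiableAt (hU.mem_nhds hw)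
        simp only [dirD_apply_of_differentiableAt hd]
        conv_lhs => rw [← b.sum_repr y, map_sum, map_sum]
        refine Finset.sum_congr rfl fun i _ => ?_
        rw [map_smul, map_smul]; rfl
      rw [Function.iterate_succ_apply, dirD_iterate_congr hU h1 _ n hz,
        dirD_iterate_sum _ _ hU (fun i => differentiableOn_dirD hU hF _) _ n hz]
      simp
    rw [h, polySpace, pow_succ']
    exact Submodule.sum_mem _ fun i _ => Submodule.mul_mem_mul (mem_linearFunctions _)
      (ih (differentiableOn_dirD hU hF _))

end Poly

/-! ### Holomorphic functions on the closed unit disc -/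

section Disc

variable {g : ℂ → ℂ}

lemma diffContOnCl_disc (hg : ∀ t : ℂ, ‖t‖ ≤ 1 → DifferentiableAt ℂ g t) :
    DiffContOnCl ℂ g (ball 0 1) :=
  DifferentiableOn.diffContOnCl fun t ht => (hg t (by
    rw [closure_ball _ one_ne_zero] at ht
    simpa using ht)).differentiableWithinAt

/-- Maximum principle: values on the circle determine the function on the disc. This turns
equivariance under unimodular scalars into homogeneity under all scalars of norm at most 1. -/
lemma eq_pow_mul_of_circle (hg : ∀ t : ℂ, ‖t‖ ≤ 1 → DifferentiableAt ℂ g t) {n : ℕ} {c : ℂ}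
    (h : ∀ t : ℂ, ‖t‖ = 1 → g t = t ^ n * c) {t : ℂ} (ht : ‖t‖ ≤ 1) : g t = t ^ n * c := by
  have h2 : DiffContOnCl ℂ (fun t : ℂ => t ^ n * c) (ball 0 1) :=
    diffContOnCl_disc fun t _ => by fun_prop
  have := Complex.eqOn_closure_of_eqOn_frontier isBounded_ball (diffContOnCl_disc hg) h2
    (fun t ht => h t (by
      rw [frontier_ball _ one_ne_zero] at ht; simpa using ht))
  exact this (by rw [closure_ball _ one_ne_zero]; simpa using ht)

lemma iteratedDeriv_of_circle (hg : ∀ t : ℂ, ‖t‖ ≤ 1 → DifferentiableAt ℂ g t) {n : ℕ} {c : ℂ}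
    (h : ∀ t : ℂ, ‖t‖ = 1 → g t = t ^ n * c) : iteratedDeriv n g 0 = n.factorial * c := by
  have h1 : g =ᶠ[𝓝 0] fun t => t ^ n * c := by
    filter_upwards [ball_mem_nhds (0 : ℂ) one_pos] with t ht
    exact eq_pow_mul_of_circle hg h (by simpa using (mem_ball.1 ht).le)
  rw [h1.iteratedDeriv_eq, iteratedDeriv_mul_const_field, iteratedDeriv_pow]
  simp [Nat.descFactorial_self]

/-- The Taylor series gives zero on the open disc only; continuity reaches the boundary point 1,
which stands for the original point of the fibre. -/
lemma eq_zero_of_iteratedDeriv (hg : ∀ t : ℂ, ‖t‖ ≤ 1 → DifferentiableAt ℂ g t)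
    (h : ∀ n, iteratedDeriv n g 0 = 0) : g 1 = 0 := by
  have h0 : ∀ t ∈ ball (0 : ℂ) 1, g t = 0 := fun t ht => by
    rw [← Complex.taylorSeries_eq_on_ball' (f := g) ht (diffContOnCl_disc hg).differentiableOn]
    simp [h]
  have h1 : Set.EqOn g 0 (closure (ball (0 : ℂ) 1)) :=
    Set.EqOn.of_subset_closure h0 (diffContOnCl_disc hg).continuousOn continuousOn_const
      subset_closure subset_rfl
  exact h1 (by rw [closure_ball _ one_ne_zero]; simp)

end Disc

/-! ### Bounded functionals that depend holomorphically on a point -/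

section Families

variable {E H : Type*} [NormedAddCommGroup E] [NormedSpace ℂ E]
  [NormedAddCommGroup H] [NormedSpace ℂ H]

/-- A family of continuous linear functionals that depends holomorphically on a point of `U`. -/
structure IsHolFamily (U : Set E) (A : H → E → ℂ) : Prop where
  clm : ∀ z ∈ U, ∃ L : H →L[ℂ] ℂ, ∀ f, L f = A f z
  hol : ∀ f, DifferentiableOn ℂ (A f) U

lemma IsHolFamily.sub {U : Set E} {A B : H → E → ℂ} (hA : IsHolFamily U A)
    (hB : IsHolFamily U B) : IsHolFamily U fun f z => A f z - B f z where
  clm z hz := by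
    obtain ⟨L, hL⟩ := hA.clm z hz
    obtain ⟨M, hM⟩ := hB.clm z hz
    exact ⟨L - M, fun f => by simp [hL, hM]⟩
  hol f := (hA.hol f).sub (hB.hol f)

/-- Banach–Steinhaus: a pointwise limit of continuous functionals, here of difference quotients, is
continuous. This is where boundedness of all the differential operators comes from. -/
lemma IsHolFamily.dirD [CompleteSpace H] {U : Set E} (hU : IsOpen U) {A : H → E → ℂ}
    (hA : IsHolFamily U A) (v : E) : IsHolFamily U fun f => dirD v (A f) where
  clm z hz := by
    have h0 : Tendsto (fun n : ℕ => z + ((n : ℂ) + 1)⁻¹ • v) atTop (𝓝 z) := by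
      have h1 : Tendsto (fun n : ℕ => ((n : ℂ) + 1)⁻¹) atTop (𝓝 0) := by
        simpa using tendsto_one_div_add_atTop_nhds_zero_nat (𝕜 := ℂ)
      simpa using (h1.smul_const v).const_add z
    obtain ⟨N, hN⟩ := eventually_atTop.1 (h0.eventually (hU.mem_nhds hz))
    choose! L hL using hA.clm
    let g : ℕ → H →L[ℂ] ℂ := fun n => (((n + N : ℕ) : ℂ) + 1) •
      (L (z + (((n + N : ℕ) : ℂ) + 1)⁻¹ • v) - L z)
    have hg : Tendsto (fun n x => g n x) atTop (𝓝 fun f => HoloBranching.dirD v (A f) z) := by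
      rw [tendsto_pi_nhds]
      intro f
      obtain ⟨t, ht, hlim⟩ := tendstoUniformlyOn_slope hU (hA.hol f) v hz
      refine ((hlim.tendsto_at (mem_of_mem_nhds ht)).comp (tendsto_add_atTop_nat N)).congr
        fun n => ?_
      have h2 := hL _ (hN (n + N) (Nat.le_add_left _ _)) f
      simp only [g, _root_.smul_apply, _root_.sub_apply, h2, hL z hz f]
      rfl
    exact ⟨continuousLinearMapOfTendsto (σ₁₂ := RingHom.id ℂ) g hg, fun f => rfl⟩
  hol f := differentiableOn_dirD hU (hA.hol f) v

lemma IsHolFamily.iterate {U : Set E} {A : H → E → ℂ} (hA : IsHolFamily U A)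
    {D : (E → ℂ) → E → ℂ}
    (hD : ∀ B : H → E → ℂ, IsHolFamily U B → IsHolFamily U fun f => D (B f)) (n : ℕ) :
    IsHolFamily U fun f => D^[n] (A f) := by
  induction n with
  | zero => exact hA
  | succ n ih => simpa only [Function.iterate_succ_apply'] using hD _ ih

end Families


open Filter Topology Metric
open scoped InnerProductSpace

/-! ### Reproducing kernel Hilbert spaces of scalar kernels -/

section Kernels

variable {X : Type}

lemma isPosDefKernel_of_posSemidef {k : X → X → ℂ} (hk : (Matrix.of k).PosSemidef) :
    IsPosDefKernel k := by
  have htfae := (RKHS.posSemidef_tfae (K := opKernel k)).out 0 2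
  refine ⟨htfae.2 ⟨?_, fun c => ?_⟩⟩
  · ext x y
    have h := hk.1.apply x y
    have hid : star (ContinuousLinearMap.id ℂ ℂ) = ContinuousLinearMap.id ℂ ℂ :=
      star_one (ℂ →L[ℂ] ℂ)
    simp only [opKernel, Matrix.conjTranspose_apply, Matrix.of_apply, star_smul, hid] at h ⊢
    rw [h]
  · have h2 := (Complex.nonneg_iff.1 (hk.2 c)).1
    change 0 ≤ Complex.re _
    simp only [Finsupp.sum] at h2 ⊢
    convert h2 using 4 with x _ y _
    have h3 := hk.1.apply x y
    simp only [Matrix.of_apply] at h3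
    simp [opKernel, Matrix.of_apply, ← h3]
    ring

variable (k : X → X → ℂ) [IsPosDefKernel k]

/-- The kernel function at `y`. -/
noncomputable def ker (y : X) : KernelSpace k := RKHS.kerFun (KernelSpace k) y (1 : ℂ)

lemma ker_apply (x y : X) : ker k y x = k x y := by
  rw [ker, RKHS.kerFun_apply, RKHS.OfKernel.kernel_ofKernel]
  simp [opKernel]

variable {k}

lemma inner_ker (y : X) (f : KernelSpace k) : ⟪ker k y, f⟫_ℂ = f y := by
  rw [ker, RKHS.kerFun_inner]; simp

lemma inner_ker_ker (x y : X) : ⟪ker k x, ker k y⟫_ℂ = k x y := by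
  rw [inner_ker, ker_apply]

lemma kernel_symm (x y : X) : star (k x y) = k y x := by
  rw [← inner_ker_ker (k := k), ← inner_ker_ker (k := k)]
  exact inner_conj_symm _ _

lemma span_ker_dense : (Submodule.span ℂ (Set.range (ker k))).topologicalClosure = ⊤ := by
  rw [Submodule.topologicalClosure_eq_top_iff, Submodule.eq_bot_iff]
  intro f hf
  refine RKHS.ext fun x => ?_
  rw [← inner_ker, hf (ker k x) (Submodule.subset_span ⟨x, rfl⟩)]
  simp

lemma norm_ker_sq (x : X) : ((‖ker k x‖ ^ 2 : ℝ) : ℂ) = k x x := by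
  rw [← inner_ker_ker (k := k), inner_self_eq_norm_sq_to_K]; simp

lemma ext_ker {F : Type*} [NormedAddCommGroup F] [NormedSpace ℂ F] {A B : KernelSpace k →L[ℂ] F}
    (h : ∀ x, A (ker k x) = B (ker k x)) : A = B := by
  refine ContinuousLinearMap.ext_on (s := Set.range (ker k)) ?_ ?_
  · rw [dense_iff_closure_eq, ← Submodule.topologicalClosure_coe, span_ker_dense]; rfl
  · rintro _ ⟨x, rfl⟩
    exact h x

/-- A family of vectors with Gram matrix `k` defines an isometry of the kernel space. -/
lemma exists_isometry {H' : Type*} [NormedAddCommGroup H'] [InnerProductSpace ℂ H']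
    [CompleteSpace H'] (v : X → H') (hv : ∀ x y, ⟪v x, v y⟫_ℂ = k x y) :
    ∃ A : KernelSpace k →ₗᵢ[ℂ] H', ∀ x, A (ker k x) = v x := by
  let e := Finsupp.linearCombination ℂ (ker k)
  let f := Finsupp.linearCombination ℂ v
  -- Both families have Gram matrix `k`, so formal combinations have equal norms. This also makes
  -- the map well defined where kernel functions are linearly dependent.
  have hnorm : ∀ c, ‖f c‖ = ‖e c‖ := by
    intro c
    have h1 : ⟪f c, f c⟫_ℂ = ⟪e c, e c⟫_ℂ := by
      simp only [e, f, Finsupp.linearCombination_apply, Finsupp.sum_inner, Finsupp.inner_sum,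
        inner_smul_left, inner_smul_right, hv, inner_ker_ker]
    rw [@norm_eq_sqrt_re_inner ℂ, @norm_eq_sqrt_re_inner ℂ _ _ _ _ (e c), h1]
  have hdense : DenseRange e := by
    rw [DenseRange, dense_iff_closure_eq]
    have : Set.range e = (Submodule.span ℂ (Set.range (ker k)) : Set (KernelSpace k)) := by
      rw [← Finsupp.range_linearCombination]; rfl
    rw [this, ← Submodule.topologicalClosure_coe, span_ker_dense]; rfl
  have hb : ∃ C, ∀ x, ‖f x‖ ≤ C * ‖e x‖ := ⟨1, fun x => by rw [one_mul, hnorm]⟩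
  have hA : ∀ x, f.extendOfNorm e (e x) = f x := LinearMap.extendOfNorm_eq hdense hb
  refine ⟨⟨(f.extendOfNorm e).toLinearMap, fun x => ?_⟩, fun x => ?_⟩
  · refine hdense.induction_on (p := fun x => ‖f.extendOfNorm e x‖ = ‖x‖) x
      (isClosed_eq (by fun_prop) (by fun_prop)) fun c => ?_
    rw [hA, hnorm]
  · have := hA (Finsupp.single x 1)
    simpa [e, f] using this

end Kernels

/-! ### Unitary representations from covariant kernels -/

section WeightedComposition

variable {X : Type} {k : X → X → ℂ} [IsPosDefKernel k]

/-- A kernel that is covariant under a group acts as a unitary representation. -/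
lemma exists_weighted_rep {Γ : Type} [Group Γ] [MulAction Γ X] (m : Γ → X → ℂ)
    (h1 : ∀ x, m 1 x = 1) (hm : ∀ g h x, m (g * h) x = m g x * m h (g⁻¹ • x))
    (hk : ∀ g x y, k x y = m g x * k (g⁻¹ • x) (g⁻¹ • y) * star (m g y)) :
    ∃ U : Γ →* (KernelSpace k ≃ₗᵢ[ℂ] KernelSpace k), ∀ g f x, U g f x = m g x * f (g⁻¹ • x) := by
  have hA : ∀ g, ∃ A : KernelSpace k →ₗᵢ[ℂ] KernelSpace k,
      ∀ x, A (ker k x) = star (m g x) • ker k (g⁻¹ • x) := fun g =>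
    exists_isometry _ fun x y => by
      rw [inner_smul_left, inner_smul_right, inner_ker_ker, hk g x y]
      simp; ring
  choose A hA using hA
  -- The isometry is prescribed on kernel functions; its adjoint is the weighted composition
  -- operator, as pairing with a kernel function is evaluation.
  let T : Γ → KernelSpace k →L[ℂ] KernelSpace k := fun g => (A g).toContinuousLinearMap.adjoint
  have hT : ∀ g f x, T g f x = m g x * f (g⁻¹ • x) := by
    intro g f x
    rw [← inner_ker, ContinuousLinearMap.adjoint_inner_right]
    change ⟪A g (ker k x), f⟫_ℂ = _
    rw [hA, inner_smul_left, inner_ker]; simp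
  have hmul : ∀ g h f, T g (T h f) = T (g * h) f := by
    intro g h f
    refine RKHS.ext fun x => ?_
    rw [hT, hT, hT, hm, _root_.mul_inv_rev, mul_smul]; ring
  have hone : ∀ f, T 1 f = f := by
    intro f
    refine RKHS.ext fun x => ?_
    rw [hT, h1]; simp
  have hle : ∀ g f, ‖T g f‖ ≤ ‖f‖ := by
    intro g f
    refine (ContinuousLinearMap.le_of_opNorm_le _ (c := 1) ?_ f).trans_eq (one_mul _)
    rw [LinearIsometryEquiv.norm_map]
    exact (A g).norm_toContinuousLinearMap_le
  -- `T g` and `T g⁻¹` are mutually inverse contractions.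
  have hnorm : ∀ g f, ‖T g f‖ = ‖f‖ := fun g f => le_antisymm (hle g f) (by
    have := hle g⁻¹ (T g f)
    rwa [hmul, inv_mul_cancel, hone] at this)
  let U : Γ → KernelSpace k ≃ₗᵢ[ℂ] KernelSpace k := fun g =>
    { toFun := T g
      invFun := T g⁻¹
      map_add' := map_add _
      map_smul' := map_smul _
      left_inv := fun f => by rw [hmul, inv_mul_cancel, hone]
      right_inv := fun f => by rw [hmul, mul_inv_cancel, hone]
      norm_map' := hnorm g }
  exact ⟨{ toFun := U
           map_one' := LinearIsometryEquiv.ext hone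
           map_mul' := fun g h => LinearIsometryEquiv.ext fun f => (hmul g h f).symm }, hT⟩

/-- The unitary operator given by a symmetry of the kernel. -/
lemma exists_comp_isometry (φ : X → X) (hk : ∀ x y, k (φ x) (φ y) = k x y) :
    ∃ R : KernelSpace k →ₗᵢ[ℂ] KernelSpace k, ∀ f x, R f (φ x) = f x := by
  obtain ⟨A, hA⟩ := exists_isometry (k := k) (fun x => ker k (φ x))
    (fun x y => by rw [inner_ker_ker, hk])
  refine ⟨A, fun f x => ?_⟩
  rw [← inner_ker, ← hA, A.inner_map_map, inner_ker]

/-- The squared distance of two kernel functions is k(y,y) - k(y,x) - k(x,y) + k(x,x), which tends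
to 0 as y tends to x. -/
lemma continuous_ker [TopologicalSpace X] (hk : Continuous fun z : X × X => k z.1 z.2) :
    Continuous (ker k) := by
  rw [continuous_iff_continuousAt]
  intro x
  rw [ContinuousAt, tendsto_iff_norm_sub_tendsto_zero]
  have h : ∀ y, ‖ker k y - ker k x‖ ^ 2 = (k y y - k y x - k x y + k x x).re := by
    intro y
    rw [← inner_self_eq_norm_sq (𝕜 := ℂ), inner_sub_left, inner_sub_right, inner_sub_right]
    simp only [inner_ker_ker]
    simp; ring
  have h2 : Tendsto (fun y => ‖ker k y - ker k x‖ ^ 2) (𝓝 x) (𝓝 0) := by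
    simp only [h]
    have hc : Continuous fun y => (k y y - k y x - k x y + k x x).re := by
      have h1 : Continuous fun y : X => k y y := hk.comp (continuous_id.prodMk continuous_id)
      have h2 : Continuous fun y : X => k y x := hk.comp (continuous_id.prodMk continuous_const)
      have h3 : Continuous fun y : X => k x y := hk.comp (continuous_const.prodMk continuous_id)
      exact Complex.continuous_re.comp (((h1.sub h2).sub h3).add continuous_const)
    simpa using hc.tendsto x
  have h3 := (Real.continuous_sqrt.tendsto 0).comp h2
  simpa [Function.comp_def, Real.sqrt_sq (norm_nonneg _)] using h3

/-- The vectors with continuous orbit map form a subspace, closed because isometries make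
convergence uniform in `g`. By covariance a kernel function is sent to an explicit multiple of a
kernel function, and these span a dense subspace. -/
lemma continuous_rep {Γ : Type} [Group Γ] [MulAction Γ X] [TopologicalSpace Γ]
    {U : Γ →* (KernelSpace k ≃ₗᵢ[ℂ] KernelSpace k)} {m : Γ → X → ℂ}
    (hU : ∀ g f x, U g f x = m g x * f (g⁻¹ • x))
    (hk : ∀ g x y, k x y = m g x * k (g⁻¹ • x) (g⁻¹ • y) * star (m g y))
    (hm0 : ∀ g x, m g x ≠ 0) (hc : ∀ y, Continuous fun g => star (m g (g • y))⁻¹ • ker k (g • y)) (f : KernelSpace k) :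
    Continuous fun g => U g f := by
  have hker : ∀ g y, U g (ker k y) = star (m g (g • y))⁻¹ • ker k (g • y) := by
    intro g y
    have hne := hm0 g (g • y)
    refine RKHS.ext fun x => ?_
    rw [hU, ker_apply, RKHS.coe_smul, Pi.smul_apply, ker_apply, hk g x, inv_smul_smul]
    have : star (m g (g • y)) ≠ 0 := star_ne_zero.2 hne
    rw [star_inv₀, smul_eq_mul]
    field_simp
  have hclosed : IsClosed {f : KernelSpace k | Continuous fun g => U g f} := by
    rw [← isSeqClosed_iff_isClosed]
    intro u a hu ha
    have hu' : TendstoUniformly (fun n g => U g (u n)) (fun g => U g a) atTop := by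
      rw [Metric.tendstoUniformly_iff]
      intro ε hε
      filter_upwards [Metric.tendsto_nhds.1 ha ε hε] with n hn g
      rw [LinearIsometryEquiv.dist_map, dist_comm]
      exact hn
    exact hu'.continuous (Frequently.of_forall hu)
  let S : Submodule ℂ (KernelSpace k) :=
    { carrier := {f | Continuous fun g => U g f}
      zero_mem' := by simp only [Set.mem_ofPred_eq, map_zero]; exact continuous_const
      add_mem' := fun {a b} ha hb => by
        simp only [Set.mem_ofPred_eq, map_add] at *; exact ha.add hb
      smul_mem' := fun c a ha => by
        simp only [Set.mem_ofPred_eq, map_smul] at *; exact ha.const_smul c }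
  have hS : (Submodule.span ℂ (Set.range (ker k))).topologicalClosure ≤ S := by
    refine Submodule.topologicalClosure_minimal _ (Submodule.span_le.2 ?_) hclosed
    rintro _ ⟨y, rfl⟩
    change Continuous fun g => U g (ker k y)
    exact (hc y).congr fun g => (hker g y).symm
  rw [span_ker_dense] at hS
  exact hS (Submodule.mem_top (x := f))

end WeightedComposition


open Filter Topology Metric
open scoped InnerProductSpace

/-! ### Holomorphy of the functions in a kernel space -/

section Holomorphic

variable {X : Type} {E : Type*} [NormedAddCommGroup E] [NormedSpace ℂ E] {ι : X → E}

lemma extend_sub {f g : X → ℂ} :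
    Function.extend ι (f - g) 0 = Function.extend ι f 0 - Function.extend ι g 0 := by
  ext e
  classical
  simp only [Function.extend, Pi.sub_apply]
  split_ifs <;> simp

lemma extend_eqOn (hι : Function.Injective ι) {f : X → ℂ} {F : E → ℂ} (h : ∀ x, f x = F (ι x)) :
    Set.EqOn (Function.extend ι f 0) F (Set.range ι) := by
  rintro _ ⟨x, rfl⟩
  rw [hι.extend_apply, h]

variable {k : X → X → ℂ} [IsPosDefKernel k]

/-- If the kernel is holomorphic in the first variable and locally bounded on the diagonal, then
all functions in its Hilbert space are holomorphic. -/
lemma differentiableOn_extend (hι : Function.Injective ι) (hU : IsOpen (Set.range ι))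
    (hk : ∀ y, ∃ F : E → ℂ, DifferentiableOn ℂ F (Set.range ι) ∧ ∀ x, k x y = F (ι x))
    (hb : ∀ x, ∃ t ∈ 𝓝 (ι x), ∃ C : ℝ, ∀ y, ι y ∈ t → (k y y).re ≤ C) (f : KernelSpace k) :
    DifferentiableOn ℂ (Function.extend ι f 0) (Set.range ι) := by
  have hspan : ∀ u ∈ Submodule.span ℂ (Set.range (ker k)),
      DifferentiableOn ℂ (Function.extend ι u 0) (Set.range ι) := by
    intro u hu
    have : ∃ F : E → ℂ, DifferentiableOn ℂ F (Set.range ι) ∧ ∀ x, u x = F (ι x) := by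
      induction hu using Submodule.span_induction with
      | mem u hu =>
        obtain ⟨y, rfl⟩ := hu
        obtain ⟨F, hF, h⟩ := hk y
        exact ⟨F, hF, fun x => by rw [ker_apply, h]⟩
      | zero => exact ⟨0, differentiableOn_const 0, fun x => by simp⟩
      | add a b _ _ ha hb =>
        obtain ⟨F, hF, h⟩ := ha
        obtain ⟨G, hG, h'⟩ := hb
        exact ⟨F + G, hF.add hG, fun x => by simp [h, h']⟩
      | smul c a _ ha =>
        obtain ⟨F, hF, h⟩ := ha
        exact ⟨c • F, hF.const_smul c, fun x => by simp [h]⟩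
    obtain ⟨F, hF, h⟩ := this
    exact hF.congr (extend_eqOn hι h)
  have hf : f ∈ closure (Submodule.span ℂ (Set.range (ker k)) : Set (KernelSpace k)) := by
    rw [← Submodule.topologicalClosure_coe, span_ker_dense]; trivial
  obtain ⟨u, hu, hlim⟩ := mem_closure_iff_seq_limit.1 hf
  refine differentiableOn_of_tendstoUniformlyOn_nhds (f := fun n => Function.extend ι (u n) 0)
    hU (fun n => hspan _ (hu n)) ?_
  rintro _ ⟨x, rfl⟩
  -- Since |f(y) - u(y)| ≤ ‖f - u‖ k(y,y)^(1/2), a bound on the diagonal makes norm convergence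
  -- locally uniform.
  obtain ⟨t, ht, C, hC⟩ := hb x
  refine ⟨t, ht, ?_⟩
  rw [Metric.tendstoUniformlyOn_iff]
  intro ε hε
  have hlim2 : Tendsto (fun n => ‖f - u n‖ * √C) atTop (𝓝 0) := by
    have h1 := (tendsto_const_nhds (x := f)).sub hlim
    rw [sub_self] at h1
    simpa using h1.norm.mul_const √C
  filter_upwards [hlim2.eventually (gt_mem_nhds hε)] with n hn e he
  rw [dist_eq_norm, ← Pi.sub_apply, ← extend_sub]
  by_cases hr : ∃ y, ι y = e
  · obtain ⟨y, rfl⟩ := hr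
    rw [hι.extend_apply, ← RKHS.coe_sub, ← inner_ker]
    refine (norm_inner_le_norm _ _).trans_lt (lt_of_le_of_lt ?_ hn)
    rw [mul_comm]
    gcongr
    refine Real.le_sqrt_of_sq_le ((le_of_eq ?_).trans (hC y he))
    rw [← norm_ker_sq (k := k) y, Complex.ofReal_re]
  · rw [Function.extend_apply' _ _ _ hr]
    simpa using hε

lemma isHolFamily_extend {H : Type*} [NormedAddCommGroup H] [InnerProductSpace ℂ H]
    [RKHS ℂ H X ℂ] (hι : Function.Injective ι)
    (h : ∀ f : H, DifferentiableOn ℂ (Function.extend ι f 0) (Set.range ι)) :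
    IsHolFamily (Set.range ι) fun f : H => Function.extend ι f 0 where
  clm := by
    rintro _ ⟨x, rfl⟩
    exact ⟨.proj x ∘L RKHS.coeCLM ℂ, fun f => by rw [hι.extend_apply]; rfl⟩
  hol := h

end Holomorphic

/-! ### Embedding a kernel space by representing functionals -/

section Summand

variable {X X₁ : Type} {k : X → X → ℂ} {k₁ : X₁ → X₁ → ℂ} [IsPosDefKernel k] [IsPosDefKernel k₁]
  {Γ : Type} [Group Γ]

/-- A family of functionals on a kernel space that are represented by multiples of
`q · k₁(proj ·, z)` yields an intertwining operator and embeds the smaller representation. -/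
lemma exists_summand {proj : X → X₁} {q : X → ℂ} (lam : X₁ → KernelSpace k →L[ℂ] ℂ) {C D : ℝ}
    (hC : 0 < C) (hD : 0 < D)
    (h1 : ∀ z w, lam z (ker k w) = C * star (q w) * k₁ z (proj w))
    (h2 : ∀ u z (f : KernelSpace k), (∀ w, f w = q w * k₁ (proj w) z) → lam u f = D * k₁ u z)
    (hne : ∃ u, k₁ u u ≠ 0)
    {π : Γ →* (KernelSpace k ≃ₗᵢ[ℂ] KernelSpace k)}
    {σ : Γ →* (KernelSpace k₁ ≃ₗᵢ[ℂ] KernelSpace k₁)}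
    (hπ : ∀ g (v : KernelSpace k₁) (f : KernelSpace k), (∀ w, f w = q w * v (proj w)) →
      ∀ w, π g f w = q w * σ g v (proj w)) :
    IsDiscreteSummand σ π ∧ ∃ T : KernelSpace k →L[ℂ] KernelSpace k₁,
      (∀ f z, T f z = lam z f) ∧ T ≠ 0 ∧ Intertwines T π σ := by
  have hC' : (C : ℂ) ≠ 0 := by exact_mod_cast hC.ne'
  have hD' : (D : ℂ) ≠ 0 := by exact_mod_cast hD.ne'
  -- The Riesz representative of `lam z`. By `h1` and symmetry of the kernel it is the function C
  -- q(w) k₁(proj w, z), to which `h2` applies, so ⟨ξ u, ξ z⟩ = C D k₁(u, z).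
  let ξ : X₁ → KernelSpace k := fun z => (InnerProductSpace.toDual ℂ _).symm (lam z)
  have hξ : ∀ z f, ⟪ξ z, f⟫_ℂ = lam z f := fun z f => InnerProductSpace.toDual_symm_apply
  have hξw : ∀ z w, ξ z w = C * (q w * k₁ (proj w) z) := by
    intro z w
    rw [← inner_ker, ← inner_conj_symm, hξ, h1, ← kernel_symm (k := k₁) z]
    simp [mul_assoc]
  have hlam : ∀ u z, lam u (ξ z) = C * D * k₁ u z := by
    intro u z
    have := h2 u z ((C : ℂ)⁻¹ • ξ z) fun w => by
      rw [RKHS.coe_smul, Pi.smul_apply, hξw, smul_eq_mul, inv_mul_cancel_left₀ hC']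
    rw [map_smul, smul_eq_mul, inv_mul_eq_iff_eq_mul₀ hC'] at this
    rw [this, mul_assoc]
  -- Dividing by √(CD) normalises the Gram matrix of `ξ` to `k₁` itself.
  let a : ℝ := √(C * D)
  have ha : 0 < a := Real.sqrt_pos.2 (by positivity)
  have ha2 : (a : ℂ) * a = C * D := by
    rw [← Complex.ofReal_mul, Real.mul_self_sqrt (by positivity)]; simp
  have ha' : (a : ℂ) ≠ 0 := by exact_mod_cast ha.ne'
  obtain ⟨S, hS⟩ := exists_isometry (k := k₁) (fun z => (a : ℂ)⁻¹ • ξ z) (fun x y => by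
    rw [inner_smul_left, inner_smul_right, hξ, hlam, ← ha2]
    simp only [map_inv₀, Complex.conj_ofReal]
    field_simp)
  have hSv : ∀ v w, S v w = (a : ℂ)⁻¹ * C * (q w * v (proj w)) := by
    intro v w
    let A : KernelSpace k₁ →L[ℂ] ℂ := (.proj w ∘L RKHS.coeCLM ℂ) ∘L S.toContinuousLinearMap
    let B : KernelSpace k₁ →L[ℂ] ℂ :=
      ((a : ℂ)⁻¹ * C * q w) • (.proj (proj w) ∘L RKHS.coeCLM ℂ)
    have hAB : A = B := ext_ker fun z => by
      change S (ker k₁ z) w = ((a : ℂ)⁻¹ * C * q w) • (ker k₁ z (proj w))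
      rw [hS, RKHS.coe_smul, Pi.smul_apply, hξw, ker_apply, smul_eq_mul, smul_eq_mul]; ring
    have := congrArg (fun L : KernelSpace k₁ →L[ℂ] ℂ => L v) hAB
    change S v w = ((a : ℂ)⁻¹ * C * q w) • (v (proj w)) at this
    rw [this, smul_eq_mul]; ring
  have hSσ : ∀ g v, S (σ g v) = π g (S v) := by
    intro g v
    refine RKHS.ext fun w => ?_
    have hc : (a : ℂ)⁻¹ * C ≠ 0 := mul_ne_zero (inv_ne_zero ha') hC'
    have := hπ g v (((a : ℂ)⁻¹ * C)⁻¹ • S v) (fun w => by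
      rw [RKHS.coe_smul, Pi.smul_apply, hSv, smul_eq_mul, inv_mul_cancel_left₀ hc]) w
    rw [map_smul, RKHS.coe_smul, Pi.smul_apply, smul_eq_mul, inv_mul_eq_iff_eq_mul₀ hc] at this
    rw [hSv, this]
  have hadj : ∀ v f, ⟪v, S.toContinuousLinearMap.adjoint f⟫_ℂ = ⟪S v, f⟫_ℂ := fun v f =>
    ContinuousLinearMap.adjoint_inner_right _ _ _
  have hT : ∀ f z, ((a : ℂ) • S.toContinuousLinearMap.adjoint) f z = lam z f := by
    intro f z
    rw [_root_.smul_apply, RKHS.coe_smul, Pi.smul_apply, ← inner_ker, hadj, hS,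
      inner_smul_left, hξ, smul_eq_mul, map_inv₀, Complex.conj_ofReal, mul_inv_cancel_left₀ ha']
  -- Up to the scalar `a`, the operator is the adjoint of the embedding: pairing with the kernel
  -- function at z gives ⟨ξ z, f⟩ = lam z f. Adjoints of intertwiners between unitary
  -- representations intertwine.
  refine ⟨⟨S, hSσ⟩, (a : ℂ) • S.toContinuousLinearMap.adjoint, hT, ?_, ?_⟩
  · intro h0
    obtain ⟨u, hu⟩ := hne
    have := hT (ξ u) u
    rw [h0, hlam] at this
    simp [hC', hD', hu] at this
  · intro g f
    rw [_root_.smul_apply, _root_.smul_apply, map_smul]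
    congr 1
    refine ext_inner_left ℂ fun v => ?_
    rw [hadj, ← (π g).symm.inner_map_map, ← (σ g).symm.inner_map_map v,
      LinearIsometryEquiv.symm_apply_apply, LinearIsometryEquiv.symm_apply_apply, hadj]
    congr 1
    rw [LinearIsometryEquiv.symm_apply_eq, ← hSσ, LinearIsometryEquiv.apply_symm_apply]

end Summand


open Filter Topology Metric
open scoped InnerProductSpace

/-! ### Decomposition of a restricted representation -/

section Branching

variable {Γ X X₁ H : Type} [Group Γ] [MulAction Γ X₁] [NormedAddCommGroup H]
  [InnerProductSpace ℂ H] [RKHS ℂ H X ℂ]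
  {E₁ Z : Type*} [NormedAddCommGroup E₁] [NormedSpace ℂ E₁] [NormedAddCommGroup Z]
  [NormedSpace ℂ Z]

/-- The extension by zero of a function on `X`, in the coordinates `ι`. -/
noncomputable def hat (ι : X → E₁ × Z) (f : H) : E₁ × Z → ℂ := Function.extend ι f 0

/-- A unitary representation `π` of `Γ` on a Hilbert space of holomorphic functions on a balanced
domain `X ⊂ E₁ × Z`, given by a multiplier `μ` and by an action on `X` that covers the action on
`X₁ ⊂ E₁` and is linear (by `δ`) on the fibres. -/
structure BranchingData (ι : X → E₁ × Z) (ι₁ : X₁ → E₁) (hol₁ : Set (X₁ → ℂ))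
    (π : Γ →* (H ≃ₗᵢ[ℂ] H)) (μ : Γ → X₁ → ℂ) (δ : Γ → X₁ → Z →ₗ[ℂ] Z)
    (R : ℂ → ℂ → H →ₗᵢ[ℂ] H) : Prop where
  inj : Function.Injective ι
  isOpen : IsOpen (Set.range ι)
  scale : ∀ z (s t : ℂ), ‖s‖ ≤ 1 → ‖t‖ ≤ 1 → (s • (ι z).1, t • (ι z).2) ∈ Set.range ι
  base : ∀ z, ∃ x, ι₁ x = (ι z).1
  zero : ∀ x, (ι₁ x, 0) ∈ Set.range ι
  hol : ∀ f : H, DifferentiableOn ℂ (hat ι f) (Set.range ι)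
  rot : ∀ s t : ℂ, ‖s‖ = 1 → ‖t‖ = 1 → ∀ (f : H) z w, ι w = (s • (ι z).1, t • (ι z).2) →
    R s t f z = f w
  act : ∀ g (f : H) x y z w, ι z = (ι₁ x, y) → ι w = (ι₁ (g⁻¹ • x), δ g x y) →
    π g f z = μ g x * f w
  act_mem : ∀ g x y, (ι₁ x, y) ∈ Set.range ι → (ι₁ (g⁻¹ • x), δ g x y) ∈ Set.range ι
  mu_one : ∀ x, μ 1 x = 1
  mu_mul : ∀ g h x, μ (g * h) x = μ g x * μ h (g⁻¹ • x)
  delta_one : ∀ x y, δ 1 x y = y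
  delta_mul : ∀ g h x y, δ (g * h) x y = δ h (g⁻¹ • x) (δ g x y)
  hol_const : ∀ c : ℂ, (fun _ => c) ∈ hol₁
  hol_add : ∀ f g, f ∈ hol₁ → g ∈ hol₁ → (fun x => f x + g x) ∈ hol₁
  hol_mul : ∀ f g, f ∈ hol₁ → g ∈ hol₁ → (fun x => f x * g x) ∈ hol₁
  hol_restrict : ∀ F : E₁ × Z → ℂ, DifferentiableOn ℂ F (Set.range ι) →
    (fun x => F (ι₁ x, 0)) ∈ hol₁
  hol_mu : ∀ g, μ g ∈ hol₁
  hol_delta : ∀ g (l : Z →ₗ[ℂ] ℂ) y, (fun x => l (δ g x y)) ∈ hol₁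
  trans : ∃ o, ι₁ o = 0 ∧ ∀ x, ∃ g : Γ, g⁻¹ • x = o
  circle : ∀ s : ℂ, ‖s‖ = 1 → ∃ (g : Γ) (c t : ℂ), ‖t‖ = 1 ∧
    ∀ x, ι₁ (g⁻¹ • x) = s • ι₁ x ∧ μ g x = c ∧ ∀ y, δ g x y = t • y

namespace BranchingData

variable {ι : X → E₁ × Z} {ι₁ : X₁ → E₁} {hol₁ : Set (X₁ → ℂ)} {π : Γ →* (H ≃ₗᵢ[ℂ] H)}
  {μ : Γ → X₁ → ℂ} {δ : Γ → X₁ → Z →ₗ[ℂ] Z} {R : ℂ → ℂ → H →ₗᵢ[ℂ] H}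
  (D : BranchingData ι ι₁ hol₁ π μ δ R)

include D

lemma hat_apply (f : H) (z : X) : hat ι f (ι z) = f z := D.inj.extend_apply _ _ _

lemma hat_of_eq (f : H) {z : X} {e : E₁ × Z} (h : ι z = e) : hat ι f e = f z := by
  rw [← h, D.hat_apply]

lemma scale_mem {x : E₁} {y : Z} (h : (x, y) ∈ Set.range ι) {s t : ℂ} (hs : ‖s‖ ≤ 1)
    (ht : ‖t‖ ≤ 1) : (s • x, t • y) ∈ Set.range ι := by
  obtain ⟨z, hz⟩ := h
  have := D.scale z s t hs ht
  rwa [hz] at this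

lemma scale_mem_iff {x : E₁} {y : Z} {s t : ℂ} (hs : ‖s‖ = 1) (ht : ‖t‖ = 1) :
    (s • x, t • y) ∈ Set.range ι ↔ (x, y) ∈ Set.range ι := by
  refine ⟨fun h => ?_, fun h => D.scale_mem h hs.le ht.le⟩
  have hs0 : s ≠ 0 := norm_ne_zero_iff.1 (by rw [hs]; exact one_ne_zero)
  have ht0 : t ≠ 0 := norm_ne_zero_iff.1 (by rw [ht]; exact one_ne_zero)
  have := D.scale_mem h (s := s⁻¹) (t := t⁻¹) (by rw [norm_inv, hs, inv_one])
    (by rw [norm_inv, ht, inv_one])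
  rwa [inv_smul_smul₀ hs0, inv_smul_smul₀ ht0] at this

/-- No membership hypothesis is needed: the domain is stable under unimodular scalings, and off it
both sides are the default value 0. -/
lemma hat_rot {s t : ℂ} (hs : ‖s‖ = 1) (ht : ‖t‖ = 1) (f : H) (x : E₁) (y : Z) :
    hat ι (R s t f) (x, y) = hat ι f (s • x, t • y) := by
  by_cases h : (x, y) ∈ Set.range ι
  · obtain ⟨w, hw⟩ := (D.scale_mem_iff hs ht).2 h
    obtain ⟨z, hz⟩ := h
    rw [D.hat_of_eq _ hz, D.hat_of_eq _ hw]
    exact D.rot s t hs ht f z w (by rw [hw, hz])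
  · have h' := mt (D.scale_mem_iff hs ht).1 h
    rw [hat, hat, Function.extend_apply' _ _ _ h, Function.extend_apply' _ _ _ h']
    rfl

lemma ext_hat {f g : H} (h : ∀ x y, hat ι f (x, y) = hat ι g (x, y)) : f = g :=
  RKHS.ext fun z => by rw [← D.hat_apply, ← D.hat_apply, ← Prod.mk.eta (p := ι z), h]

lemma rot_rot {s t s' t' : ℂ} (hs : ‖s‖ = 1) (ht : ‖t‖ = 1) (hs' : ‖s'‖ = 1) (ht' : ‖t'‖ = 1)
    (f : H) : R s t (R s' t' f) = R (s' * s) (t' * t) f :=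
  D.ext_hat fun x y => by
    rw [D.hat_rot hs ht, D.hat_rot hs' ht', D.hat_rot (by rw [norm_mul, hs, hs', one_mul])
      (by rw [norm_mul, ht, ht', one_mul]), mul_smul, mul_smul]

lemma rot_one (f : H) : R 1 1 f = f :=
  D.ext_hat fun x y => by rw [D.hat_rot norm_one norm_one, one_smul, one_smul]

lemma rot_inv {s t : ℂ} (hs : ‖s‖ = 1) (ht : ‖t‖ = 1) (f : H) :
    R s t (R s⁻¹ t⁻¹ f) = f := by
  have hs0 : s ≠ 0 := norm_ne_zero_iff.1 (by rw [hs]; exact one_ne_zero)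
  have ht0 : t ≠ 0 := norm_ne_zero_iff.1 (by rw [ht]; exact one_ne_zero)
  rw [D.rot_rot hs ht (by rw [norm_inv, hs, inv_one]) (by rw [norm_inv, ht, inv_one]),
    inv_mul_cancel₀ hs0, inv_mul_cancel₀ ht0, D.rot_one]

/-- `R s t` is unitary with inverse `R s⁻¹ t⁻¹`. -/
lemma inner_rot {s t : ℂ} (hs : ‖s‖ = 1) (ht : ‖t‖ = 1) (f g : H) :
    ⟪R s t f, g⟫_ℂ = ⟪f, R s⁻¹ t⁻¹ g⟫_ℂ := by
  conv_lhs => rw [← D.rot_inv hs ht g, LinearIsometry.inner_map_map]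

lemma fibre_differentiableAt (f : H) {x : E₁} {y : Z} (h : (x, y) ∈ Set.range ι) {t : ℂ}
    (ht : ‖t‖ ≤ 1) : DifferentiableAt ℂ (fun t : ℂ => hat ι f (x, t • y)) t := by
  have h1 := D.scale_mem h (s := 1) norm_one.le ht
  rw [one_smul] at h1
  exact ((D.hol f).differentiableAt (D.isOpen.mem_nhds h1)).comp t
    (f := fun t : ℂ => (x, t • y)) (by fun_prop)

lemma base_differentiableAt (f : H) {x : E₁} {y : Z} (h : (x, y) ∈ Set.range ι) {s : ℂ}
    (hs : ‖s‖ ≤ 1) : DifferentiableAt ℂ (fun s : ℂ => hat ι f (s • x, y)) s := by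
  have h1 := D.scale_mem h (t := 1) hs norm_one.le
  rw [one_smul] at h1
  exact ((D.hol f).differentiableAt (D.isOpen.mem_nhds h1)).comp s
    (f := fun s : ℂ => (s • x, y)) (by fun_prop)

omit D in
/-- The derivative of order `n` at zero along the fibre direction `y`. -/
noncomputable def jet (ι : X → E₁ × Z) (n : ℕ) (f : H) (x : E₁) (y : Z) : ℂ :=
  ((dirD ((0 : E₁), y))^[n] (hat ι f)) (x, 0)

omit D in
lemma jet_eq (n : ℕ) (f : H) (x : E₁) (y : Z) :
    jet ι n f x y = iteratedDeriv n (fun t : ℂ => hat ι f (x, t • y)) 0 := by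
  rw [jet, dirD_iterate_eq]
  simp

omit D in
lemma jet_smul (n : ℕ) (f : H) (x : E₁) (y : Z) (t : ℂ) :
    jet ι n f x (t • y) = t ^ n * jet ι n f x y := by
  have h1 : ∀ F : E₁ × Z → ℂ, dirD ((0 : E₁), t • y) F = t • dirD ((0 : E₁), y) F := by
    intro F
    ext z
    rw [Pi.smul_apply, dirD, dirD, ← lineDeriv_smul, Prod.smul_mk, smul_zero]
  have h2 : ∀ (c : ℂ) (F : E₁ × Z → ℂ), dirD ((0 : E₁), y) (c • F) = c • dirD ((0 : E₁), y) F := by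
    intro c F
    ext z
    simp only [dirD, lineDeriv, Pi.smul_apply, smul_eq_mul]
    rw [deriv_const_mul_field]
  have h3 : ∀ F : E₁ × Z → ℂ, (dirD ((0 : E₁), t • y))^[n] F =
      t ^ n • (dirD ((0 : E₁), y))^[n] F := by
    intro F
    induction n with
    | zero => simp
    | succ n ih =>
      rw [Function.iterate_succ_apply', ih, Function.iterate_succ_apply', h1, h2, smul_smul,
        pow_succ']
  rw [jet, h3]; rfl

variable [CompleteSpace H]

lemma exists_jet_clm (n : ℕ) {x : E₁} (hx : (x, (0 : Z)) ∈ Set.range ι) (y : Z) :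
    ∃ L : H →L[ℂ] ℂ, ∀ f, L f = jet ι n f x y :=
  ((isHolFamily_extend D.inj D.hol).iterate (D := dirD ((0 : E₁), y))
    (fun _ hB => hB.dirD D.isOpen _) n).clm _ hx

lemma zero_mem {x : E₁} {y : Z} (h : (x, y) ∈ Set.range ι) : (x, (0 : Z)) ∈ Set.range ι := by
  simpa using D.scale_mem h (s := 1) (t := 0) norm_one.le (by simp)

lemma zero_mem' {x : E₁} {y : Z} (h : (x, y) ∈ Set.range ι) : ((0 : E₁), y) ∈ Set.range ι := by
  simpa using D.scale_mem h (s := 0) (t := 1) (by simp) norm_one.le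

omit D in
/-- Functions that are homogeneous of degree `n` in the fibre variable. -/
def homSub (R : ℂ → ℂ → H →ₗᵢ[ℂ] H) (n : ℕ) : Submodule ℂ H where
  carrier := {f | ∀ t : ℂ, ‖t‖ = 1 → R 1 t f = t ^ n • f}
  zero_mem' := fun t _ => by simp
  add_mem' := fun {a b} ha hb t ht => by rw [map_add, ha t ht, hb t ht, smul_add]
  smul_mem' := fun c a ha t ht => by rw [map_smul, ha t ht, smul_comm]

omit D in
lemma isClosed_homSub (n : ℕ) : IsClosed (homSub R n : Set H) := by
  have : (homSub R n : Set H) = ⋂ (t : ℂ) (_ : ‖t‖ = 1), {f | R 1 t f = t ^ n • f} := by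
    ext f; simp [homSub]
  rw [this]
  exact isClosed_iInter fun t => isClosed_iInter fun _ =>
    isClosed_eq (R 1 t).continuous (continuous_const_smul _)

lemma hat_of_mem_homSub {n : ℕ} {f : H} (hf : f ∈ homSub R n) {t : ℂ} (ht : ‖t‖ = 1) (x : E₁)
    (y : Z) : hat ι f (x, t • y) = t ^ n * hat ι f (x, y) := by
  have h := D.hat_rot norm_one ht f x y
  rw [one_smul, hf t ht] at h
  rw [← h]
  by_cases h : (x, y) ∈ Set.range ι
  · obtain ⟨z, hz⟩ := h
    rw [D.hat_of_eq _ hz, D.hat_of_eq _ hz, RKHS.coe_smul]; rfl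
  · rw [hat, hat, Function.extend_apply' _ _ _ h, Function.extend_apply' _ _ _ h]
    simp

/-- On each fibre disc the function is a multiple of t^n, so its n-th Taylor coefficient is its
value. Jets of order n therefore determine functions of degree n. -/
lemma jet_of_mem_homSub {n : ℕ} {f : H} (hf : f ∈ homSub R n) {x : E₁} {y : Z}
    (h : (x, y) ∈ Set.range ι) : jet ι n f x y = n.factorial * hat ι f (x, y) := by
  rw [jet_eq]
  exact iteratedDeriv_of_circle (fun t ht => D.fibre_differentiableAt f h ht)
    fun t ht => D.hat_of_mem_homSub hf ht x y

/-- Distinct characters of the circle: one rotation that multiplies the inner product by -1 while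
preserving it suffices. -/
lemma inner_homSub {m n : ℕ} (hmn : m ≠ n) {f g : H} (hf : f ∈ homSub R m)
    (hg : g ∈ homSub R n) : ⟪f, g⟫_ℂ = 0 := by
  wlog hlt : m < n generalizing m n f g
  · rw [← inner_conj_symm, this hmn.symm hg hf (by omega), map_zero]
  obtain ⟨k, rfl⟩ := Nat.exists_eq_add_of_lt hlt
  -- The degrees differ by k + 1, so t must satisfy t^(k+1) = -1.
  set t : ℂ := Complex.exp ((Real.pi / (k + 1) : ℝ) * Complex.I) with ht
  have htn : ‖t‖ = 1 := Complex.norm_exp_ofReal_mul_I _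
  have htp : t ^ (k + 1) = -1 := by
    rw [ht, ← Complex.exp_nat_mul, ← Complex.exp_pi_mul_I]
    congr 1
    have : (k : ℂ) + 1 ≠ 0 := Nat.cast_add_one_ne_zero k
    push_cast
    field_simp
  have h1 : ⟪R 1 t f, R 1 t g⟫_ℂ = ⟪f, g⟫_ℂ := LinearIsometry.inner_map_map _ _ _
  have h2 : (starRingEnd ℂ) (t ^ m) * t ^ m = 1 := by
    rw [mul_comm, Complex.mul_conj, Complex.normSq_eq_norm_sq, norm_pow, htn]; simp
  rw [hf t htn, hg t htn, inner_smul_left, inner_smul_right, add_assoc, pow_add, htp] at h1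
  have h3 : (starRingEnd ℂ) (t ^ m) * (t ^ m * -1 * ⟪f, g⟫_ℂ) = -⟪f, g⟫_ℂ := by
    linear_combination (-⟪f, g⟫_ℂ) * h2
  rw [h3] at h1
  exact self_eq_neg.1 h1.symm

/-- The jet functional is homogeneous of degree n under fibre rotations, so its Riesz representative
lies in the weight space of degree n. A vector with non-zero n-jet thus has a non-zero projection
there. -/
lemma exists_jet_repr (n : ℕ) {x : E₁} {y : Z} (hx : (x, (0 : Z)) ∈ Set.range ι) :
    ∃ η ∈ homSub R n, ∀ f, ⟪η, f⟫_ℂ = jet ι n f x y := by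
  obtain ⟨L, hL⟩ := D.exists_jet_clm n hx y
  have hη : ∀ f, ⟪(InnerProductSpace.toDual ℂ H).symm L, f⟫_ℂ = jet ι n f x y := fun f => by
    rw [InnerProductSpace.toDual_symm_apply, hL]
  refine ⟨_, fun t ht => ext_inner_right ℂ fun f => ?_, hη⟩
  have ht0 : t ≠ 0 := norm_ne_zero_iff.1 (by rw [ht]; exact one_ne_zero)
  have hi : ‖t⁻¹‖ = 1 := by rw [norm_inv, ht, inv_one]
  rw [D.inner_rot norm_one ht, inner_smul_left, hη, hη, inv_one, jet_eq]
  have h1 : (fun τ : ℂ => hat ι (R 1 t⁻¹ f) (x, τ • y)) =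
      fun τ : ℂ => hat ι f (x, τ • t⁻¹ • y) := by
    ext τ
    rw [D.hat_rot norm_one hi, one_smul, smul_comm]
  rw [h1, ← jet_eq, jet_smul, map_pow, ← Complex.inv_eq_conj ht]

/-- Taylor expansion in the fibre from the base point (x, 0) recovers the function. -/
lemma exists_jet_ne_zero {f : H} (hf : f ≠ 0) : ∃ (n : ℕ) (x : E₁) (y : Z),
    (x, (0 : Z)) ∈ Set.range ι ∧ jet ι n f x y ≠ 0 := by
  by_contra! h
  refine hf (RKHS.ext fun z => ?_)
  have hz : ((ι z).1, (ι z).2) ∈ Set.range ι := ⟨z, rfl⟩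
  have := eq_zero_of_iteratedDeriv (fun t ht => D.fibre_differentiableAt f hz ht) fun n => by
    rw [← jet_eq]; exact h n _ _ (D.zero_mem hz)
  rw [one_smul, Prod.mk.eta, D.hat_apply] at this
  rw [this]; simp

lemma act_mem_iff (g : Γ) (x : X₁) (y : Z) :
    (ι₁ (g⁻¹ • x), δ g x y) ∈ Set.range ι ↔ (ι₁ x, y) ∈ Set.range ι := by
  refine ⟨fun h => ?_, D.act_mem g x y⟩
  have := D.act_mem g⁻¹ _ _ h
  rwa [inv_inv, smul_inv_smul, ← D.delta_mul, mul_inv_cancel, D.delta_one] at this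

lemma hat_act (g : Γ) (f : H) (x : X₁) (y : Z) :
    hat ι (π g f) (ι₁ x, y) = μ g x * hat ι f (ι₁ (g⁻¹ • x), δ g x y) := by
  by_cases h : (ι₁ x, y) ∈ Set.range ι
  · obtain ⟨w, hw⟩ := D.act_mem g x y h
    obtain ⟨z, hz⟩ := h
    rw [D.hat_of_eq _ hz, D.hat_of_eq _ hw, D.act g f x y z w hz hw]
  · have h' := mt (D.act_mem_iff g x y).1 h
    rw [hat, hat, Function.extend_apply' _ _ _ h, Function.extend_apply' _ _ _ h']
    simp

lemma ext_base {f g : H} (h : ∀ x y, hat ι f (ι₁ x, y) = hat ι g (ι₁ x, y)) : f = g :=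
  RKHS.ext fun z => by
    obtain ⟨x, hx⟩ := D.base z
    rw [← D.hat_apply, ← D.hat_apply, ← Prod.mk.eta (p := ι z), ← hx, h]

lemma jet_act (n : ℕ) (g : Γ) (f : H) (x : X₁) (y : Z) :
    jet ι n (π g f) (ι₁ x) y = μ g x * jet ι n f (ι₁ (g⁻¹ • x)) (δ g x y) := by
  simp only [jet_eq, D.hat_act, map_smul]
  rw [iteratedDeriv_const_mul_field]

/-- The group is linear on fibres, hence commutes with fibre rotations. -/
lemma act_mem_homSub {n : ℕ} (g : Γ) {f : H} (hf : f ∈ homSub R n) : π g f ∈ homSub R n := by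
  intro t ht
  rw [← map_smul, ← hf t ht]
  refine D.ext_base fun x y => ?_
  rw [D.hat_rot norm_one ht, one_smul, D.hat_act, D.hat_act, D.hat_rot norm_one ht, one_smul,
    map_smul]

/-- Circle rotations of the base act on homogeneous functions as group elements do. -/
lemma exists_act_eq_rot {n : ℕ} {s : ℂ} (hs : ‖s‖ = 1) :
    ∃ (g : Γ) (c : ℂ), c ≠ 0 ∧ ∀ f ∈ homSub R n, π g f = c • R s 1 f := by
  obtain ⟨g, c, t, ht, h⟩ := D.circle s hs
  have ht0 : t ≠ 0 := norm_ne_zero_iff.1 (by rw [ht]; exact one_ne_zero)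
  obtain ⟨o, -, -⟩ := D.trans
  -- The cocycle identity for g g⁻¹ = 1 writes 1 as a multiple of c.
  have hc : c ≠ 0 := by
    intro h0
    have h1 := D.mu_mul g g⁻¹ o
    rw [mul_inv_cancel, D.mu_one, (h o).2.1, h0, zero_mul] at h1
    exact one_ne_zero h1
  -- The element `g` also rotates the fibre by t, but in degree n this is only the scalar t^n.
  refine ⟨g, c * t ^ n, mul_ne_zero hc (pow_ne_zero _ ht0), fun f hf => ?_⟩
  rw [mul_smul, ← map_smul, ← hf t ht, D.rot_rot hs norm_one norm_one ht, one_mul, mul_one]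
  refine D.ext_base fun x y => ?_
  have h2 : hat ι (c • R s t f) (ι₁ x, y) = c * hat ι (R s t f) (ι₁ x, y) := by
    by_cases h : (ι₁ x, y) ∈ Set.range ι
    · obtain ⟨z, hz⟩ := h
      rw [D.hat_of_eq _ hz, D.hat_of_eq _ hz, RKHS.coe_smul]; rfl
    · rw [hat, hat, Function.extend_apply' _ _ _ h, Function.extend_apply' _ _ _ h]
      simp
  rw [D.hat_act, h2, D.hat_rot hs ht, (h x).1, (h x).2.1, (h x).2.2]

end BranchingData

end Branching


open Filter Topology Metric
open scoped InnerProductSpace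

/-! ### Irreducible subspaces, their realisation by jets, and exhaustion -/

section Branching

variable {Γ X X₁ H : Type} [Group Γ] [MulAction Γ X₁] [NormedAddCommGroup H]
  [InnerProductSpace ℂ H] [RKHS ℂ H X ℂ] [CompleteSpace H]
  {E₁ Z : Type*} [NormedAddCommGroup E₁] [NormedSpace ℂ E₁] [NormedAddCommGroup Z]
  [NormedSpace ℂ Z]

lemma rep_inv_apply (π : Γ →* (H ≃ₗᵢ[ℂ] H)) (g : Γ) (v : H) : π g (π g⁻¹ v) = v := by
  change (π g * π g⁻¹) v = v
  rw [← map_mul, mul_inv_cancel, map_one]; rfl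

lemma orthogonal_invariant {π : Γ →* (H ≃ₗᵢ[ℂ] H)} {V : Submodule ℂ H}
    (hV : ∀ g, ∀ v ∈ V, π g v ∈ V) (g : Γ) {f : H} (hf : f ∈ Vᗮ) : π g f ∈ Vᗮ := by
  intro v hv
  rw [← rep_inv_apply π g v, LinearIsometryEquiv.inner_map_map]
  exact hf _ (hV _ _ hv)

/-- Point evaluations separate functions, so in finite dimension they span the dual. Coordinates of
a polynomial-valued jet are thus finite combinations of scalar jets, whose continuity and holomorphy
are known. -/
lemma exists_sum_eval {Z : Type*} {P : Submodule ℂ (Z → ℂ)} [FiniteDimensional ℂ P]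
    (φ : P →ₗ[ℂ] ℂ) : ∃ c : Z →₀ ℂ, ∀ p : P, φ p = c.sum fun y a => a * (p : Z → ℂ) y := by
  let ev : Z → P →ₗ[ℂ] ℂ := fun y => LinearMap.proj y ∘ₗ P.subtype
  have h : φ ∈ Submodule.span ℂ (Set.range ev) := by
    refine FiniteDimensional.mem_span_of_iInf_ker_le_ker fun p hp => ?_
    have : p = 0 := by
      refine Subtype.ext (funext fun y => ?_)
      exact LinearMap.mem_ker.1 ((Submodule.mem_iInf _).1 hp y)
    rw [this]; exact Submodule.zero_mem _
  obtain ⟨c, hc⟩ := Finsupp.mem_span_range_iff_exists_finsupp.1 h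
  refine ⟨c, fun p => ?_⟩
  rw [← hc, Finsupp.sum, LinearMap.sum_apply]
  rfl

namespace BranchingData

variable {ι : X → E₁ × Z} {ι₁ : X₁ → E₁} {hol₁ : Set (X₁ → ℂ)} {π : Γ →* (H ≃ₗᵢ[ℂ] H)}
  {μ : Γ → X₁ → ℂ} {δ : Γ → X₁ → Z →ₗ[ℂ] Z} {R : ℂ → ℂ → H →ₗᵢ[ℂ] H}
  (D : BranchingData ι ι₁ hol₁ π μ δ R)

include D

omit [CompleteSpace H] D in
/-- Functions that are invariant under rotations of the base. -/
def fixSub (R : ℂ → ℂ → H →ₗᵢ[ℂ] H) : Submodule ℂ H where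
  carrier := {f | ∀ s : ℂ, ‖s‖ = 1 → R s 1 f = f}
  zero_mem' := fun t _ => by simp
  add_mem' := fun {a b} ha hb t ht => by rw [map_add, ha t ht, hb t ht]
  smul_mem' := fun c a ha t ht => by rw [map_smul, ha t ht]

/-- Maximum principle in the base direction: the function is constant on the disc of the points (s
x, y), so it depends on the fibre variable only. -/
lemma hat_zero_of_mem_fixSub {f : H} (hf : f ∈ fixSub R) {x : E₁} {y : Z}
    (h : (x, y) ∈ Set.range ι) : hat ι f (0, y) = hat ι f (x, y) := by
  have := eq_pow_mul_of_circle (n := 0) (c := hat ι f (x, y))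
    (fun t ht => D.base_differentiableAt f h ht) (fun t ht => by
      have h1 := D.hat_rot ht norm_one f x y
      rw [hf t ht, one_smul] at h1
      rw [← h1, pow_zero, one_mul]) (t := 0) (by simp)
  simpa using this

/-- A non-zero closed invariant subspace of homogeneous functions contains a non-zero function
that only depends on the fibre variable. -/
lemma exists_mem_fixSub {n : ℕ} {V : Submodule ℂ H} (hV : IsClosed (V : Set H))
    (hinv : ∀ g, ∀ v ∈ V, π g v ∈ V) (hle : V ≤ homSub R n) (hne : V ≠ ⊥) :
    ∃ e ∈ V, e ≠ 0 ∧ e ∈ fixSub R := by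
  -- A base rotation need not come from the group, but on `homSub R n` it is a scalar multiple of a
  -- group element, so it preserves `V`.
  have hrot : ∀ s : ℂ, ‖s‖ = 1 → ∀ v ∈ V, R s 1 v ∈ V := by
    intro s hs v hv
    obtain ⟨g, c, hc, h⟩ := D.exists_act_eq_rot (n := n) hs
    have h1 := hinv g v hv
    rw [h v (hle hv)] at h1
    exact (V.smul_mem_iff hc).1 h1
  obtain ⟨v, hv, hv0⟩ := Submodule.exists_mem_ne_zero_of_ne_bot hne
  -- Transitivity on the base moves a point where some vector of `V` does not vanish to the fibre
  -- over the origin.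
  obtain ⟨u, hu, w, y, hw, huw⟩ : ∃ u ∈ V, ∃ (w : X) (y : Z), ι w = (0, y) ∧ u w ≠ 0 := by
    obtain ⟨z, hz⟩ : ∃ z, v z ≠ 0 := by
      by_contra! h
      exact hv0 (RKHS.ext fun z => by rw [h]; simp)
    obtain ⟨x, hx⟩ := D.base z
    obtain ⟨o, ho, htr⟩ := D.trans
    obtain ⟨g, hg⟩ := htr x
    have hz' : ι z = (ι₁ x, (ι z).2) := by rw [hx]
    obtain ⟨w, hw⟩ := D.act_mem g x (ι z).2 ⟨z, hz'⟩
    refine ⟨π g⁻¹ v, hinv _ _ hv, w, δ g x (ι z).2, by rw [hw, hg, ho], fun h0 => hz ?_⟩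
    rw [← rep_inv_apply π g v, D.act g _ x _ z w hz' hw, h0, mul_zero]
  have : CompleteSpace V := hV.completeSpace_coe
  -- Evaluation at a point over the base origin is fixed by base rotations, and so is its projection
  -- to the rotation-invariant space `V`. The projection is not zero because `u` does not vanish at
  -- that point.
  let κ : H := (InnerProductSpace.toDual ℂ H).symm (.proj w ∘L RKHS.coeCLM ℂ)
  have hκ : ∀ f, ⟪κ, f⟫_ℂ = f w := fun f => by
    rw [InnerProductSpace.toDual_symm_apply]; rfl
  refine ⟨V.starProjection κ, V.starProjection_apply_mem κ, fun h0 => huw ?_, fun s hs => ?_⟩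
  · rw [← hκ, ← V.starProjection_eq_self_iff.2 hu, ← V.inner_starProjection_left_eq_right, h0,
      inner_zero_left]
  · have hs0 : s ≠ 0 := norm_ne_zero_iff.1 (by rw [hs]; exact one_ne_zero)
    have hsi : ‖s⁻¹‖ = 1 := by rw [norm_inv, hs, inv_one]
    have hκs : R s 1 κ = κ := ext_inner_right ℂ fun f => by
      rw [D.inner_rot hs norm_one, hκ, hκ, inv_one]
      exact D.rot s⁻¹ 1 hsi norm_one f w w (by rw [hw]; simp)
    symm
    refine Submodule.eq_starProjection_of_mem_orthogonal (hrot s hs _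
      (V.starProjection_apply_mem κ)) fun v hv => ?_
    have h1 : κ - R s 1 (V.starProjection κ) = R s 1 (κ - V.starProjection κ) := by
      rw [map_sub, hκs]
    rw [h1, ← inner_conj_symm, D.inner_rot hs norm_one, inv_one, inner_conj_symm]
    exact V.sub_starProjection_mem_orthogonal κ _ (hrot _ hsi v hv)

/-- The polynomial in the fibre variable given by the derivatives of order `n` at a point of the
base. -/
lemma jet_mem_polySpace [FiniteDimensional ℂ Z] (n : ℕ) (f : H) {x : E₁}
    (hx : (x, (0 : Z)) ∈ Set.range ι) : jet ι n f x ∈ polySpace Z n :=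
  dirD_iterate_mem_polySpace D.isOpen (D.hol f) (LinearMap.inr ℂ E₁ Z) hx n

lemma jet_add (n : ℕ) (f g : H) {x : E₁} (hx : (x, (0 : Z)) ∈ Set.range ι) :
    jet ι n (f + g) x = jet ι n f x + jet ι n g x := by
  ext y
  obtain ⟨L, hL⟩ := D.exists_jet_clm n hx y
  rw [Pi.add_apply, ← hL, ← hL, ← hL, map_add]

lemma jet_const_smul (n : ℕ) (c : ℂ) (f : H) {x : E₁} (hx : (x, (0 : Z)) ∈ Set.range ι) :
    jet ι n (c • f) x = c • jet ι n f x := by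
  ext y
  obtain ⟨L, hL⟩ := D.exists_jet_clm n hx y
  rw [Pi.smul_apply, ← hL, ← hL, map_smul]

/-- Such a function is determined by its values over the base origin, hence by its n-jet there, a
homogeneous polynomial of degree n. -/
lemma finiteDimensional_fixSub [FiniteDimensional ℂ Z] (n : ℕ) :
    FiniteDimensional ℂ (homSub R n ⊓ fixSub R : Submodule ℂ H) := by
  obtain ⟨o, ho, -⟩ := D.trans
  have h0 : ((0 : E₁), (0 : Z)) ∈ Set.range ι := by rw [← ho]; exact D.zero o
  have := finiteDimensional_polySpace Z n
  let T : (homSub R n ⊓ fixSub R : Submodule ℂ H) →ₗ[ℂ] polySpace Z n :=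
    { toFun := fun f => ⟨jet ι n (f : H) 0, D.jet_mem_polySpace n f h0⟩
      map_add' := fun f g => Subtype.ext (D.jet_add n f g h0)
      map_smul' := fun c f => Subtype.ext (D.jet_const_smul n c f h0) }
  refine FiniteDimensional.of_injective T ((injective_iff_map_eq_zero T).2 fun f hf => ?_)
  have hf' : jet ι n (f : H) 0 = 0 := congrArg Subtype.val hf
  refine Subtype.ext (RKHS.ext fun z => ?_)
  have hz : ((ι z).1, (ι z).2) ∈ Set.range ι := ⟨z, rfl⟩
  have h1 := D.jet_of_mem_homSub f.2.1 (D.zero_mem' hz)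
  rw [hf', D.hat_zero_of_mem_fixSub f.2.2 hz, Prod.mk.eta, D.hat_apply, Pi.zero_apply] at h1
  have h2 : (n.factorial : ℂ) ≠ 0 := Nat.cast_ne_zero.2 n.factorial_ne_zero
  rw [(mul_eq_zero.1 h1.symm).resolve_left h2]
  simp

/-- A non-zero closed invariant space of homogeneous functions contains an irreducible one. -/
lemma exists_irreducible [FiniteDimensional ℂ Z] {n : ℕ} {V : Submodule ℂ H}
    (hV : IsClosed (V : Set H)) (hinv : ∀ g, ∀ v ∈ V, π g v ∈ V) (hle : V ≤ homSub R n)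
    (hne : V ≠ ⊥) :
    ∃ W ≤ V, IsClosed (W : Set H) ∧ (∀ g, ∀ w ∈ W, π g w ∈ W) ∧ W ≠ ⊥ ∧
      ∀ W' : Submodule ℂ H, W' ≤ W → IsClosed (W' : Set H) → (∀ g, ∀ w ∈ W', π g w ∈ W') →
        W' = ⊥ ∨ W' = W := by
  let S : Set (Submodule ℂ H) := {W | W ≤ V ∧ IsClosed (W : Set H) ∧
    (∀ g, ∀ w ∈ W, π g w ∈ W) ∧ W ≠ ⊥}
  -- Among the non-zero closed invariant subspaces of `V`, choose one with the fewest independent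
  -- rotation-fixed vectors.
  obtain ⟨W, ⟨hWV, hWc, hWi, hWn⟩, hmin⟩ := (measure fun W : Submodule ℂ H =>
    Module.finrank ℂ (W ⊓ fixSub R : Submodule ℂ H)).wf.has_min S ⟨V, le_rfl, hV, hinv, hne⟩
  refine ⟨W, hWV, hWc, hWi, hWn, fun W' hle' hc' hi' => ?_⟩
  by_contra! hcon
  have hmin' := hmin W' ⟨hle'.trans hWV, hc', hi', hcon.1⟩
  have := D.finiteDimensional_fixSub n
  have : FiniteDimensional ℂ (W ⊓ fixSub R : Submodule ℂ H) :=
    Submodule.finiteDimensional_of_le (inf_le_inf_right _ (hWV.trans hle))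
  -- A proper non-zero W' would already contain all fixed vectors of `W`, while its orthogonal
  -- complement in `W`, being invariant and non-zero, contains a fixed vector too.
  have heq : W' ⊓ fixSub R = W ⊓ fixSub R :=
    Submodule.eq_of_le_of_finrank_le (inf_le_inf_right _ hle') (not_lt.1 hmin')
  have : CompleteSpace W' := hc'.completeSpace_coe
  have hne2 : W'ᗮ ⊓ W ≠ ⊥ := by
    intro h0
    have := Submodule.sup_orthogonal_inf_of_hasOrthogonalProjection hle'
    rw [h0, sup_bot_eq] at this
    exact hcon.2 this
  obtain ⟨e, he, he0, hef⟩ := D.exists_mem_fixSub (V := W'ᗮ ⊓ W)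
    ((Submodule.isClosed_orthogonal _).inter hWc)
    (fun g v hv => ⟨orthogonal_invariant hi' g hv.1, hWi g v hv.2⟩)
    (inf_le_right.trans (hWV.trans hle)) hne2
  have he' : e ∈ W' ⊓ fixSub R := by rw [heq]; exact ⟨he.2, hef⟩
  exact he0 (inner_self_eq_zero.1 (he.1 e he'.1))

lemma hol_sum {α : Type*} (s : Finset α) (f : α → X₁ → ℂ) (h : ∀ a, f a ∈ hol₁) :
    (fun x => ∑ a ∈ s, f a x) ∈ hol₁ := by
  classical
  induction s using Finset.induction_on with
  | empty => simpa using D.hol_const 0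
  | insert a s ha ih =>
    simp only [Finset.sum_insert ha]
    exact D.hol_add _ _ (h a) ih

lemma hol_poly {n : ℕ} {P : Z → ℂ} (hP : P ∈ polySpace Z n) (g : Γ) (y : Z) :
    (fun x => P (δ g x y)) ∈ hol₁ := by
  induction hP using Submodule.pow_induction_on_left' with
  | algebraMap r => exact D.hol_const r
  | add a b i _ _ h1 h2 => exact D.hol_add _ _ h1 h2
  | mem_mul m hm i a _ h =>
    obtain ⟨l, rfl⟩ := hm
    exact D.hol_mul _ _ (D.hol_delta g l y) h

omit D [InnerProductSpace ℂ H] [RKHS ℂ H X ℂ] [CompleteSpace H] [NormedAddCommGroup H]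
  [MulAction Γ X₁] [Group Γ] in
/-- The action on polynomials in the fibre variable. -/
def polyAct (μ : Γ → X₁ → ℂ) (δ : Γ → X₁ → Z →ₗ[ℂ] Z) (n : ℕ) (g : Γ) (x : X₁) :
    polySpace Z n →ₗ[ℂ] polySpace Z n where
  toFun p := μ g x • ⟨fun y => p.1 (δ g x y), polySpace_comp p.2 _⟩
  map_add' p q := by rw [← smul_add]; rfl
  map_smul' c p := by rw [RingHom.id_apply, smul_comm]; rfl

lemma polyAct_mul (n : ℕ) (g h : Γ) (x : X₁) :
    polyAct μ δ n (g * h) x = polyAct μ δ n g x ∘ₗ polyAct μ δ n h (g⁻¹ • x) := by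
  refine LinearMap.ext fun p => Subtype.ext (funext fun y => ?_)
  change μ (g * h) x * p.1 (δ (g * h) x y) =
    μ g x * (μ h (g⁻¹ • x) * p.1 (δ h (g⁻¹ • x) (δ g x y)))
  rw [D.mu_mul, D.delta_mul, mul_assoc]

lemma polyAct_one (n : ℕ) (x : X₁) : polyAct μ δ n (1 : Γ) x = LinearMap.id := by
  refine LinearMap.ext fun p => Subtype.ext (funext fun y => ?_)
  change μ 1 x * p.1 (δ 1 x y) = p.1 y
  rw [D.mu_one, D.delta_one, one_mul]

/-- Irreducible closed invariant spaces of homogeneous functions are holomorphic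
representations. -/
lemma isHolomorphicPiece [FiniteDimensional ℂ Z] {n : ℕ} {W : Submodule ℂ H}
    (hW : IsClosed (W : Set H)) (hinv : ∀ g, ∀ v ∈ W, π g v ∈ W) (hle : W ≤ homSub R n)
    (hne : W ≠ ⊥)
    (hirr : ∀ W' : Submodule ℂ H, W' ≤ W → IsClosed (W' : Set H) →
      (∀ g, ∀ w ∈ W', π g w ∈ W') → W' = ⊥ ∨ W' = W) :
    IsHolomorphicPiece hol₁ π W where
  isClosed := hW
  invariant := hinv
  ne_bot := hne
  irreducible := hirr
  realized := by
    have := finiteDimensional_polySpace Z n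
    let b := Module.finBasis ℂ (polySpace Z n)
    choose c hc using fun a => exists_sum_eval (b.coord a)
    -- The cocycle is the matrix of `polyAct` in a basis of the polynomials of degree n, and `T`
    -- takes the coordinates of the n-jet along the base.
    let J : Γ → X₁ → GL (Fin (Module.finrank ℂ (polySpace Z n))) ℂ := fun g x =>
      { val := LinearMap.toMatrix b b (polyAct μ δ n g x)
        inv := LinearMap.toMatrix b b (polyAct μ δ n g⁻¹ (g⁻¹ • x))
        val_inv := by
          rw [← LinearMap.toMatrix_comp, ← D.polyAct_mul, mul_inv_cancel, D.polyAct_one,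
            LinearMap.toMatrix_id]
        inv_val := by
          have h := D.polyAct_mul n g⁻¹ g (g⁻¹ • x)
          rw [inv_inv, smul_inv_smul, inv_mul_cancel, D.polyAct_one] at h
          rw [← LinearMap.toMatrix_comp, ← h, LinearMap.toMatrix_id] }
    let P : W → X₁ → polySpace Z n := fun v x =>
      ⟨jet ι n (v : H) (ι₁ x), D.jet_mem_polySpace n v (D.zero x)⟩
    let T : W →ₗ[ℂ] (X₁ → Fin (Module.finrank ℂ (polySpace Z n)) → ℂ) :=
      { toFun := fun v x => b.repr (P v x)
        map_add' := fun v w => by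
          ext x : 1
          have : P (v + w) x = P v x + P w x := Subtype.ext (D.jet_add n v w (D.zero x))
          simp only [this, map_add, Pi.add_apply, Finsupp.coe_add]
        map_smul' := fun a v => by
          ext x : 1
          have : P (a • v) x = a • P v x := Subtype.ext (D.jet_const_smul n a v (D.zero x))
          simp only [this, map_smul, Pi.smul_apply, Finsupp.coe_smul, RingHom.id_apply] }
    have hT : ∀ v x a, T v x a = ∑ y ∈ (c a).support, c a y * jet ι n (v : H) (ι₁ x) y :=
      fun v x a => hc a (P v x)
    refine ⟨_, J, T, fun g h x => ?_, fun g i j => ?_, ?_, fun x => ?_, fun v a => ?_,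
      fun g v x => ?_⟩
    · refine Units.ext ?_
      change LinearMap.toMatrix b b _ = LinearMap.toMatrix b b _ * LinearMap.toMatrix b b _
      rw [D.polyAct_mul, LinearMap.toMatrix_comp b b b]
    · have : (fun x => (J g x).1 i j) = fun x => ∑ y ∈ (c i).support,
          c i y * (μ g x * (b j).1 (δ g x y)) := by
        ext x
        change LinearMap.toMatrix b b (polyAct μ δ n g x) i j = _
        rw [LinearMap.toMatrix_apply]
        exact hc i _
      rw [this]
      exact D.hol_sum _ _ fun y => D.hol_mul _ _ (D.hol_const _)
        (D.hol_mul _ _ (D.hol_mu g) (D.hol_poly (b j).2 g y))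
    -- In degree n the jet is n! times the function, so a vanishing jet forces v = 0.
    · refine (injective_iff_map_eq_zero T).2 fun v hv => ?_
      refine Subtype.ext (RKHS.ext fun z => ?_)
      obtain ⟨x, hx⟩ := D.base z
      have hz : (ι₁ x, (ι z).2) ∈ Set.range ι := ⟨z, by rw [hx]⟩
      have h1 : P v x = 0 := b.repr.injective (by
        rw [map_zero]
        exact DFunLike.coe_injective (congrFun hv x))
      have h2 : jet ι n (v : H) (ι₁ x) = 0 := congrArg Subtype.val h1
      have h3 := D.jet_of_mem_homSub (hle v.2) hz
      rw [h2, hx, Prod.mk.eta, D.hat_apply, Pi.zero_apply] at h3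
      have h4 : (n.factorial : ℂ) ≠ 0 := Nat.cast_ne_zero.2 n.factorial_ne_zero
      rw [(mul_eq_zero.1 h3.symm).resolve_left h4]
      simp
    · refine continuous_pi fun a => ?_
      simp only [hT]
      refine continuous_finsetSum _ fun y _ => continuous_const.mul ?_
      obtain ⟨L, hL⟩ := D.exists_jet_clm n (D.zero x) y
      simp only [← hL]
      exact L.continuous.comp continuous_subtype_val
    · simp only [hT]
      exact D.hol_sum _ _ fun y => D.hol_mul _ _ (D.hol_const _)
        (D.hol_restrict _ (differentiableOn_dirD_iterate D.isOpen (D.hol v) _ n))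
    · have h1 : P ⟨π g v, hinv g v v.2⟩ x = polyAct μ δ n g x (P v (g⁻¹ • x)) :=
        Subtype.ext (funext fun y => D.jet_act n g v x y)
      change ⇑(b.repr (P ⟨π g v, hinv g v v.2⟩ x)) =
        LinearMap.toMatrix b b (polyAct μ δ n g x) *ᵥ ⇑(b.repr (P v (g⁻¹ • x)))
      rw [LinearMap.toMatrix_mulVec_repr, h1]

/-- The representation is a discrete sum of irreducible holomorphic representations. -/
theorem isDiscreteSumOfHolomorphic [FiniteDimensional ℂ Z] :
    IsDiscreteSumOfHolomorphic hol₁ π := by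
  let S : Set (Set (Submodule ℂ H)) := {s | (∀ V ∈ s, IsHolomorphicPiece hol₁ π V ∧
    ∃ n, V ≤ homSub R n) ∧ ∀ V ∈ s, ∀ W ∈ s, V ≠ W → V ⟂ W}
  -- Zorn's lemma for orthogonal families of pieces. Each piece is required to have a degree, so
  -- that it can be compared with the weight spaces.
  obtain ⟨s, hs⟩ := zorn_subset S fun c hcS hc => by
    refine ⟨⋃₀ c, ⟨?_, ?_⟩, fun t ht => Set.subset_sUnion_of_mem ht⟩
    · rintro V ⟨t, ht, hV⟩
      exact (hcS ht).1 V hV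
    · rintro V ⟨t, ht, hV⟩ W ⟨u, hu, hW⟩ hVW
      rcases hc.total ht hu with h | h
      · exact (hcS hu).2 V (h hV) W hW hVW
      · exact (hcS ht).2 V hV W (h hW) hVW
  refine ⟨s, fun V => V.1, fun V => (hs.prop.1 V V.2).1, OrthogonalFamily.of_pairwise
    fun V W hVW => hs.prop.2 V V.2 W W.2 fun h => hVW (Subtype.ext h), ?_⟩
  rw [Submodule.topologicalClosure_eq_top_iff, ← Submodule.iInf_orthogonal]
  by_contra hne
  obtain ⟨f, hf, hf0⟩ := Submodule.exists_mem_ne_zero_of_ne_bot hne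
  -- A vector orthogonal to the whole family has a non-zero jet of some order n; this is the degree
  -- in which a further piece is found.
  obtain ⟨n, x, y, hx, hjet⟩ := D.exists_jet_ne_zero hf0
  obtain ⟨η, hη, hηf⟩ := D.exists_jet_repr n (y := y) hx
  have : CompleteSpace (homSub R n) := (isClosed_homSub n).completeSpace_coe
  let M : Submodule ℂ H := (⨅ V : s, (V.1)ᗮ) ⊓ homSub R n
  have hMne : M ≠ ⊥ := by
    -- The projection to degree n stays orthogonal to the family: pieces of degree n are fixed by
    -- it, and pieces of any other degree are orthogonal to its image.
    have hp : (homSub R n).starProjection f ∈ M := by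
      refine ⟨(Submodule.mem_iInf _).2 fun V v hv => ?_, Submodule.starProjection_apply_mem _ _⟩
      obtain ⟨m, hm⟩ := (hs.prop.1 V V.2).2
      by_cases hmn : m = n
      · subst hmn
        rw [← Submodule.inner_starProjection_left_eq_right,
          Submodule.starProjection_eq_self_iff.2 (hm hv)]
        exact (Submodule.mem_iInf _).1 hf V v hv
      · exact D.inner_homSub hmn (hm hv) (Submodule.starProjection_apply_mem _ _)
    intro h0
    rw [h0, Submodule.mem_bot] at hp
    refine hjet ?_
    rw [← hηf, ← Submodule.starProjection_eq_self_iff.2 hη,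
      Submodule.inner_starProjection_left_eq_right, hp, inner_zero_right]
  have hMc : IsClosed (M : Set H) := by
    refine IsClosed.inter ?_ (isClosed_homSub n)
    rw [Submodule.coe_iInf]
    exact isClosed_iInter fun V => Submodule.isClosed_orthogonal _
  have hMi : ∀ g, ∀ v ∈ M, π g v ∈ M := fun g v hv =>
    ⟨(Submodule.mem_iInf _).2 fun V => orthogonal_invariant (hs.prop.1 V V.2).1.invariant g
      ((Submodule.mem_iInf _).1 hv.1 V), D.act_mem_homSub g hv.2⟩
  obtain ⟨W, hWM, hWc, hWi, hWn, hWirr⟩ := D.exists_irreducible hMc hMi inf_le_right hMne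
  have hWorth : ∀ V ∈ s, V ⟂ W := fun V hV => Submodule.isOrtho_iff_inner_eq.2 fun v hv w hw =>
    (Submodule.mem_iInf _).1 (hWM hw).1 ⟨V, hV⟩ v hv
  have hins : insert W s ∈ S := by
    refine ⟨?_, ?_⟩
    · rintro V (rfl | hV)
      · exact ⟨D.isHolomorphicPiece hWc hWi (hWM.trans inf_le_right) hWn hWirr,
          n, hWM.trans inf_le_right⟩
      · exact hs.prop.1 V hV
    · rintro V (rfl | hV) V' (rfl | hV') hVV'
      · exact absurd rfl hVV'
      · exact (hWorth _ hV').symm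
      · exact hWorth _ hV
      · exact hs.prop.2 V hV V' hV' hVV'
  have hWs : W ∈ s := hs.le_of_ge hins (Set.subset_insert _ _) (Set.mem_insert _ _)
  exact hWn (Submodule.isOrtho_self.1 (hWorth W hWs))

end BranchingData

end Branching


open Filter Topology Metric
open scoped InnerProductSpace

/-! ### The geometry of the matrix ball -/

/-- The determinants of accretive matrices avoid the cut of the logarithm. -/
class AccretiveDet (q : Type) [Fintype q] [DecidableEq q] : Prop where
  det_mem : ∀ A : Matrix q q ℂ, (A + Aᴴ).PosDef → A.det ∈ Complex.slitPlane

section Ball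

variable {p r q : Type} [Fintype p] [DecidableEq p] [Fintype r] [DecidableEq r]
  [Fintype q] [DecidableEq q]

/-- Twice the Hermitian part of 1 - w*z equals (1 - z*z) + (1 - w*w) + (z - w)*(z - w). -/
lemma accretive_of_mem_ball {z w : Matrix p q ℂ} (hz : z ∈ ballSet p q) (hw : w ∈ ballSet p q) :
    ((1 - wᴴ * z) + (1 - wᴴ * z)ᴴ).PosDef := by
  have h : (1 - wᴴ * z) + (1 - wᴴ * z)ᴴ =
      ((1 - zᴴ * z) + (1 - wᴴ * w)) + (z - w)ᴴ * (z - w) := by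
    simp only [conjTranspose_sub, conjTranspose_mul, conjTranspose_one,
      conjTranspose_conjTranspose, Matrix.sub_mul, Matrix.mul_sub]
    abel
  rw [h]
  exact (PosDef.add hz hw).add_posSemidef (posSemidef_conjTranspose_mul_self _)

lemma det_mem_slitPlane [AccretiveDet q] {z w : Matrix p q ℂ} (hz : z ∈ ballSet p q)
    (hw : w ∈ ballSet p q) : (1 - wᴴ * z).det ∈ Complex.slitPlane :=
  AccretiveDet.det_mem _ (accretive_of_mem_ball hz hw)

lemma fromRows_mem_ballSet_iff {x : Matrix p q ℂ} {y : Matrix r q ℂ} :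
    (fromRows x y : Matrix (p ⊕ r) q ℂ) ∈ ballSet (p ⊕ r) q ↔
      (1 - xᴴ * x - yᴴ * y).PosDef := by
  change (1 - (fromRows x y)ᴴ * (fromRows x y : Matrix (p ⊕ r) q ℂ)).PosDef ↔ _
  rw [conjTranspose_fromRows_eq_fromCols_conjTranspose, fromCols_mul_fromRows, sub_sub]

lemma posSemidef_one_sub_smul {s : ℂ} (hs : ‖s‖ ≤ 1) (x : Matrix p q ℂ) :
    (xᴴ * x - (s • x)ᴴ * (s • x)).PosSemidef := by
  have h : xᴴ * x - (s • x)ᴴ * (s • x) = ((1 - ‖s‖ ^ 2 : ℝ) : ℂ) • (xᴴ * x) := by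
    rw [conjTranspose_smul, Matrix.smul_mul, Matrix.mul_smul, smul_smul, Complex.ofReal_sub,
      sub_smul, Complex.ofReal_one, one_smul]
    congr 2
    rw [Complex.star_def, mul_comm, Complex.mul_conj, Complex.normSq_eq_norm_sq]
  rw [h]
  refine (posSemidef_conjTranspose_mul_self x).smul ?_
  rw [Complex.zero_le_real]
  nlinarith [norm_nonneg s]

lemma smul_fromRows_mem {x : Matrix p q ℂ} {y : Matrix r q ℂ} {s t : ℂ} (hs : ‖s‖ ≤ 1)
    (ht : ‖t‖ ≤ 1) (h : (fromRows x y : Matrix (p ⊕ r) q ℂ) ∈ ballSet (p ⊕ r) q) :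
    (fromRows (s • x) (t • y) : Matrix (p ⊕ r) q ℂ) ∈ ballSet (p ⊕ r) q := by
  rw [fromRows_mem_ballSet_iff] at *
  have h1 : 1 - (s • x)ᴴ * (s • x) - (t • y)ᴴ * (t • y) = (1 - xᴴ * x - yᴴ * y) +
      ((xᴴ * x - (s • x)ᴴ * (s • x)) + (yᴴ * y - (t • y)ᴴ * (t • y))) := by abel
  rw [h1]
  exact h.add_posSemidef ((posSemidef_one_sub_smul hs x).add (posSemidef_one_sub_smul ht y))

lemma smul_mem_ballSet {x : Matrix p q ℂ} {s : ℂ} (hs : ‖s‖ ≤ 1) (h : x ∈ ballSet p q) :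
    s • x ∈ ballSet p q := by
  have h1 : 1 - (s • x)ᴴ * (s • x) = (1 - xᴴ * x) + (xᴴ * x - (s • x)ᴴ * (s • x)) := by abel
  change (1 - (s • x)ᴴ * (s • x)).PosDef
  rw [h1]
  exact PosDef.add_posSemidef h (posSemidef_one_sub_smul hs x)

lemma zero_mem_ballSet : (0 : Matrix p q ℂ) ∈ ballSet p q := by
  change (1 - (0 : Matrix p q ℂ)ᴴ * (0 : Matrix p q ℂ)).PosDef
  simpa using PosDef.one

instance : Zero (Ball p q) := ⟨⟨0, zero_mem_ballSet⟩⟩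

lemma ball_zero_val : (0 : Ball p q).1 = 0 := rfl

instance : PreconnectedSpace (Ball p q) := by
  refine ⟨isPreconnected_of_forall (0 : Ball p q) fun z _ => ?_⟩
  let γ : Set.Icc (0 : ℝ) 1 → Ball p q := fun t => ⟨((t : ℝ) : ℂ) • z.1, smul_mem_ballSet (by
    rw [Complex.norm_real, Real.norm_eq_abs, abs_le]
    exact ⟨by linarith [t.2.1], t.2.2⟩) z.2⟩
  have hγ : Continuous γ := by
    refine Continuous.subtype_mk ?_ _
    exact (Complex.continuous_ofReal.comp continuous_subtype_val).smul continuous_const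
  refine ⟨Set.range γ, Set.subset_univ _, ⟨⟨0, by simp⟩, ?_⟩, ⟨⟨1, by simp⟩, ?_⟩,
    isPreconnected_range hγ⟩
  · apply Subtype.ext
    change (((0 : ℝ) : ℂ)) • z.1 = 0
    simp
  · apply Subtype.ext
    change (((1 : ℝ) : ℂ)) • z.1 = z.1
    simp

/-- Positivity of a Hermitian form need only be tested on the compact unit sphere, which makes it an
open condition. -/
lemma isOpen_ballSet : IsOpen (ballSet p q) := by
  have h0 : ∀ z : Matrix p q ℂ, z ∈ ballSet p q ↔ ∀ x ∈ sphere (0 : q → ℂ) 1,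
      0 < (star x ⬝ᵥ ((1 - zᴴ * z) *ᵥ x)).re := by
    intro z
    have hH : (1 - zᴴ * z).IsHermitian := isHermitian_one.sub (isHermitian_conjTranspose_mul_self z)
    constructor
    · intro h x hx
      exact h.re_dotProduct_pos (fun h0 => by simp [h0] at hx)
    · intro h
      refine PosDef.of_dotProduct_mulVec_pos hH fun x hx => ?_
      have him : (star x ⬝ᵥ ((1 - zᴴ * z) *ᵥ x)).im = 0 := hH.im_star_dotProduct_mulVec_self x
      have hn : 0 < ‖x‖ := norm_pos_iff.2 hx
      have h1 := h (((‖x‖⁻¹ : ℝ) : ℂ) • x) (by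
        rw [mem_sphere_zero_iff_norm, norm_smul, Complex.norm_real, norm_inv, norm_norm,
          inv_mul_cancel₀ hn.ne'])
      rw [mulVec_smul, star_smul, smul_dotProduct, dotProduct_smul, smul_smul, Complex.star_def,
        Complex.conj_ofReal, ← Complex.ofReal_mul, smul_eq_mul, Complex.re_ofReal_mul] at h1
      rw [Complex.pos_iff]
      exact ⟨(pos_iff_pos_of_mul_pos h1).1 (by positivity), him.symm⟩
  rw [isOpen_iff_mem_nhds]
  intro z hz
  have h1 := (isCompact_sphere (0 : q → ℂ) 1).eventually_forall_of_forall_eventually (x₀ := z)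
    (P := fun z x => 0 < (star x ⬝ᵥ ((1 - zᴴ * z) *ᵥ x)).re) fun x hx => by
      have hc : Continuous fun zx : Matrix p q ℂ × (q → ℂ) =>
          (star zx.2 ⬝ᵥ ((1 - zx.1ᴴ * zx.1) *ᵥ zx.2)).re := by fun_prop
      exact hc.continuousAt.eventually (lt_mem_nhds ((h0 z).1 hz x hx))
  filter_upwards [h1] with w hw
  exact (h0 w).2 hw

/-- The values lie in the discrete set 2πiℤ, so the zero set is open and closed; a real value in
2πiℤ is 0. -/
lemma eq_zero_of_exp_eq_one {X : Type*} [TopologicalSpace X] [PreconnectedSpace X] {Φ : X → ℂ}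
    (hcont : Continuous Φ) (hexp : ∀ x, Complex.exp (Φ x) = 1) {x₀ : X} (h0 : (Φ x₀).im = 0)
    (x : X) : Φ x = 0 := by
  have hint : ∀ y, ‖Φ y‖ < 2 * Real.pi → Φ y = 0 := by
    intro y hy
    obtain ⟨n, hn⟩ := Complex.exp_eq_one_iff.1 (hexp y)
    have h2 : |(n : ℝ)| < 1 := by
      have h3 : ‖Φ y‖ = |(n : ℝ)| * (2 * Real.pi) := by
        rw [hn]
        simp [abs_of_pos Real.pi_pos]
      rw [h3] at hy
      nlinarith [Real.two_pi_pos]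
    have h4 : n = 0 := by
      rw [← Int.abs_lt_one_iff]
      exact_mod_cast h2
    rw [hn, h4]; simp
  have h0' : Φ x₀ = 0 := by
    obtain ⟨n, hn⟩ := Complex.exp_eq_one_iff.1 (hexp x₀)
    rw [hn] at h0 ⊢
    have h2 : (n : ℝ) * (2 * Real.pi) = 0 := by simpa using h0
    have h3 : (n : ℝ) = 0 := (mul_eq_zero.1 h2).resolve_right Real.two_pi_pos.ne'
    have h4 : n = 0 := by exact_mod_cast h3
    simp [h4]
  have hclopen : IsClopen {x | Φ x = 0} := by
    refine ⟨isClosed_eq hcont continuous_const, isOpen_iff_mem_nhds.2 fun x hx => ?_⟩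
    have hx' : Φ x = 0 := hx
    have h1 := (hcont.continuousAt (x := x)).norm.eventually (gt_mem_nhds
      (show ‖Φ x‖ < 2 * Real.pi by rw [hx', norm_zero]; exact Real.two_pi_pos))
    exact h1.mono hint
  have : x ∈ {x | Φ x = 0} := by rw [hclopen.eq_univ ⟨x₀, h0'⟩]; trivial
  exact this

lemma num_den_polar (g : SU p q) (z w : Matrix p q ℂ) :
    (den g w)ᴴ * den g z - (num g w)ᴴ * num g z = 1 - wᴴ * z := by
  have hform : ∀ (x x' : Matrix p q ℂ) (y y' : Matrix q q ℂ),
      (fromRows x y)ᴴ * (formJ p q * (fromRows x' y' : Matrix (p ⊕ q) q ℂ)) =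
        xᴴ * x' - yᴴ * y' := by
    intro x x' y y'
    have h := fromBlocks_mul_fromRows x' y' (1 : Matrix p p ℂ) 0 0 (-1 : Matrix q q ℂ)
    rw [formJ, h, conjTranspose_fromRows_eq_fromCols_conjTranspose, fromCols_mul_fromRows]
    simp [sub_eq_add_neg]
  have h := hform (num g w) (num g z) (den g w) (den g z)
  rw [← mul_fromRows_one, ← mul_fromRows_one, conjTranspose_mul] at h
  have h3 : (fromRows w (1 : Matrix q q ℂ))ᴴ * (mat g)ᴴ * (formJ p q *
      (mat g * (fromRows z (1 : Matrix q q ℂ)))) = wᴴ * z - 1 := by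
    calc _ = (fromRows w (1 : Matrix q q ℂ))ᴴ * (((mat g)ᴴ * formJ p q *
        mat g) * (fromRows z (1 : Matrix q q ℂ))) := by simp only [Matrix.mul_assoc]
      _ = _ := by rw [mat_form, hform]; simp
  rw [← neg_sub, ← h, h3, neg_sub]

lemma den_kernel (g : SU p q) (z w : Ball p q) :
    (den g w.1)ᴴ * (1 - (g • w).1ᴴ * (g • z).1) * den g z.1 = 1 - w.1ᴴ * z.1 := by
  have hz := isUnit_det_den g z
  have hw := isUnit_det_den g w
  rw [← num_den_polar g z.1 w.1, smul_val, smul_val, Matrix.mul_sub, Matrix.sub_mul,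
    conjTranspose_mul, Matrix.mul_one]
  have h1 : (den g w.1)ᴴ * ((den g w.1)⁻¹)ᴴ = 1 := by
    rw [← conjTranspose_mul, nonsing_inv_mul _ hw, conjTranspose_one]
  congr 1
  calc _ = ((den g w.1)ᴴ * ((den g w.1)⁻¹)ᴴ) * ((num g w.1)ᴴ * num g z.1) *
        ((den g z.1)⁻¹ * den g z.1) := by simp only [Matrix.mul_assoc]
    _ = _ := by rw [h1, nonsing_inv_mul _ hz, Matrix.one_mul, Matrix.mul_one]

lemma det_den_kernel (g : SU p q) (z w : Ball p q) :
    star (den g w.1).det * (1 - (g • w).1ᴴ * (g • z).1).det * (den g z.1).det =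
      (1 - w.1ᴴ * z.1).det := by
  rw [← den_kernel g z w, det_mul, det_mul, det_conjTranspose]

/-- The determinant of `1 - w* z`. -/
noncomputable def kdet (z w : Ball p q) : ℂ := (1 - w.1ᴴ * z.1).det

lemma kdet_smul (g : SU p q) (z w : Ball p q) :
    star (den g w.1).det * kdet (g • z) (g • w) * (den g z.1).det = kdet z w :=
  det_den_kernel g z w

lemma continuous_kdet : Continuous fun x : Ball p q × Ball p q => kdet x.1 x.2 := by
  unfold kdet; fun_prop

lemma kdet_mem [AccretiveDet q] (z w : Ball p q) : kdet z w ∈ Complex.slitPlane :=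
  det_mem_slitPlane z.2 w.2

lemma kdet_ne_zero [AccretiveDet q] (z w : Ball p q) : kdet z w ≠ 0 :=
  Complex.slitPlane_ne_zero (kdet_mem z w)

/-- The principal logarithm of `det (1 - w* z)`. -/
noncomputable def logK (z w : Ball p q) : ℂ := Complex.log (kdet z w)

lemma continuous_logK [AccretiveDet q] :
    Continuous fun x : Ball p q × Ball p q => logK x.1 x.2 :=
  continuous_kdet.clog fun x => kdet_mem x.1 x.2

lemma exp_logK [AccretiveDet q] (z w : Ball p q) : Complex.exp (logK z w) = kdet z w :=
  Complex.exp_log (kdet_ne_zero z w)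

lemma logK_self_im (u : Ball p q) : (logK u u).im = 0 := by
  have h : 0 < kdet u u := PosDef.det_pos u.2
  rw [Complex.pos_iff] at h
  rw [logK, Complex.log_im, Complex.arg_eq_zero_iff]
  exact ⟨h.1.le, h.2.symm⟩

/-- An identity of exponentials determines the logarithms up to one constant in 2πiℤ by
connectedness. At (o, o) all the terms are real, L entering only through L + conj L, so the constant
is 0. -/
lemma eq_of_exp_mul_eq {X : Type*} [TopologicalSpace X] [PreconnectedSpace X]
    {K M : X × X → ℂ} {L : X → ℂ} (hK : Continuous K) (hM : Continuous M) (hL : Continuous L)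
    (h : ∀ x y, star (Complex.exp (L y)) * Complex.exp (K (x, y)) * Complex.exp (L x) =
      Complex.exp (M (x, y))) {o : X} (hKo : (K (o, o)).im = 0) (hMo : (M (o, o)).im = 0)
    (x y : X) : K (x, y) = M (x, y) - L x - star (L y) := by
  have hexp : ∀ x : X × X, Complex.exp (K x - (M x - L x.1 - star (L x.2))) = 1 := by
    intro x
    have h5 := h x.1 x.2
    have h1 := Complex.exp_ne_zero (L x.1)
    have h6 : Complex.exp (star (L x.2)) = star (Complex.exp (L x.2)) := by
      rw [Complex.star_def, Complex.exp_conj]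
    have h2 := Complex.exp_ne_zero (star (L x.2))
    rw [← h6] at h5
    have h3 := Complex.exp_ne_zero (K x)
    rw [Complex.exp_sub, Complex.exp_sub, Complex.exp_sub, ← h5]
    field_simp
  have hcont : Continuous fun x : X × X => K x - (M x - L x.1 - star (L x.2)) :=
    hK.sub ((hM.sub (hL.comp continuous_fst)).sub
      (continuous_star.comp (hL.comp continuous_snd)))
  have h0 : (K (o, o) - (M (o, o) - L o - star (L o))).im = 0 := by
    simp only [Complex.sub_im, hKo, hMo, Complex.star_def, Complex.conj_im]
    ring
  exact sub_eq_zero.1 (eq_zero_of_exp_eq_one (X := X × X) hcont hexp (x₀ := (o, o)) h0 (x, y))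

/-- The logarithm of `det (1 - w* z)` transforms by the logarithms of the denominators. -/
lemma logK_smul_of_exp [AccretiveDet q] (g : SU p q) {L : Ball p q → ℂ} (hL : Continuous L)
    (he : ∀ z, Complex.exp (L z) = (den g z.1).det) (z w : Ball p q) :
    logK (g • z) (g • w) = logK z w - L z - star (L w) := by
  have hs : Continuous fun z : Ball p q => g • z := continuous_smul_ball g
  have hp : Continuous fun x : Ball p q × Ball p q => (g • x.1, g • x.2) :=
    (hs.comp continuous_fst).prodMk (hs.comp continuous_snd)
  have hK := (continuous_logK (p := p) (q := q)).comp hp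
  refine eq_of_exp_mul_eq hK continuous_logK hL (fun x y => ?_)
    (logK_self_im (g • (0 : Ball p q))) (logK_self_im (0 : Ball p q)) z w
  rw [he, he, exp_logK]
  exact (congrArg (fun c => star (den g y.1).det * c * (den g x.1).det)
    (exp_logK (g • x) (g • y))).trans (kdet_smul g x y)

lemma logK_smul [AccretiveDet q] (γ : Cover p q) (z w : Ball p q) :
    logK (γ • z) (γ • w) = logK z w - γ.log z - star (γ.log w) :=
  logK_smul_of_exp γ.toSU γ.log.continuous γ.exp_log z w

end Ball


open Filter Topology Metric
open scoped InnerProductSpace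

/-! ### The scalar representations -/

section ScalarRep

variable {p q : Type} [Fintype p] [DecidableEq p] [Fintype q] [DecidableEq q]

lemma kern_eq [AccretiveDet q] (ν : ℝ) (z w : Ball p q) :
    kern p q ν z w = Complex.exp (-(ν : ℂ) * logK z w) := by
  rw [mul_comm]
  exact Complex.cpow_def_of_ne_zero (kdet_ne_zero z w) _

lemma mult_one (ν : ℝ) (z : Ball p q) : mult ν 1 z = 1 := by
  have h : (1 : Cover p q)⁻¹.log z = 0 := by rw [inv_one]; rfl
  rw [mult, h, mul_zero, Complex.exp_zero]

lemma mult_mul (ν : ℝ) (g h : Cover p q) (z : Ball p q) :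
    mult ν (g * h) z = mult ν g z * mult ν h (g⁻¹ • z) := by
  have h1 : (g * h)⁻¹.log z = h⁻¹.log (g⁻¹ • z) + g⁻¹.log z := by
    rw [_root_.mul_inv_rev, Cover.mul_log]; rfl
  rw [mult, mult, mult, h1, ← Complex.exp_add]
  congr 1; ring

lemma mult_ne_zero (ν : ℝ) (g : Cover p q) (z : Ball p q) : mult ν g z ≠ 0 :=
  Complex.exp_ne_zero _

lemma mult_smul (ν : ℝ) (g : Cover p q) (z : Ball p q) :
    mult ν g (g • z) = Complex.exp ((ν : ℂ) * g.log z) := by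
  have h : g⁻¹.log (g • z) = -g.log (g.toSU⁻¹ • g.toSU • z) := rfl
  rw [mult, h, inv_smul_smul, neg_mul_neg]

lemma kern_covariant [AccretiveDet q] (ν : ℝ) (g : Cover p q) (z w : Ball p q) :
    kern p q ν z w = mult ν g z * kern p q ν (g⁻¹ • z) (g⁻¹ • w) * star (mult ν g w) := by
  rw [kern_eq, kern_eq, logK_smul, mult, mult, Complex.star_def, ← Complex.exp_conj,
    ← Complex.exp_add, ← Complex.exp_add]
  simp only [map_mul, map_neg, Complex.conj_ofReal]
  congr 1; ring

lemma continuous_kern [AccretiveDet q] (ν : ℝ) :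
    Continuous fun x : Ball p q × Ball p q => kern p q ν x.1 x.2 := by
  simp only [kern_eq]
  exact Complex.continuous_exp.comp (continuous_const.mul continuous_logK)

lemma continuous_kern_self [AccretiveDet q] (ν : ℝ) :
    Continuous fun z : Ball p q => (kern p q ν z z).re := by
  have h : Continuous fun z : Ball p q => (z, z) := continuous_id.prodMk continuous_id
  have h2 := (continuous_kern (p := p) ν).comp h
  exact Complex.continuous_re.comp h2

lemma continuous_toSU_log : Continuous fun g : Cover p q => (g.toSU, g.log) :=
  continuous_induced_dom

lemma continuous_log_apply (z : Ball p q) : Continuous fun g : Cover p q => g.log z := by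
  have h : Continuous fun g : Cover p q => g.log := continuous_snd.comp continuous_toSU_log
  exact (ContinuousEvalConst.continuous_eval_const z).comp h

lemma continuous_mat : Continuous fun g : Cover p q => mat g.toSU := by
  have h : Continuous fun g : Cover p q => g.toSU := continuous_fst.comp continuous_toSU_log
  have h1 : Continuous fun g : SU p q => g.1 := continuous_subtype_val
  have h2 : Continuous fun g : SpecialLinearGroup (p ⊕ q) ℂ => g.1 := continuous_subtype_val
  exact h2.comp (h1.comp h)

lemma continuous_smul_apply (z : Ball p q) : Continuous fun g : Cover p q => g • z := by
  have hm := continuous_mat (p := p) (q := q)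
  have hd : Continuous fun g : Cover p q => den g.toSU z.1 := by
    refine continuous_matrix fun i j => ?_
    simp only [den, Matrix.add_apply, Matrix.mul_apply, toBlocks₂₁, toBlocks₂₂, of_apply]
    exact (continuous_finsetSum _ fun k _ => (hm.matrix_elem _ _).mul continuous_const).add
      (hm.matrix_elem _ _)
  have hn : Continuous fun g : Cover p q => num g.toSU z.1 := by
    refine continuous_matrix fun i j => ?_
    simp only [num, Matrix.add_apply, Matrix.mul_apply, toBlocks₁₁, toBlocks₁₂, of_apply]
    exact (continuous_finsetSum _ fun k _ => (hm.matrix_elem _ _).mul continuous_const).add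
      (hm.matrix_elem _ _)
  have h : Continuous fun g : Cover p q => num g.toSU z.1 * (den g.toSU z.1)⁻¹ := by
    refine hn.matrix_mul ?_
    simp only [Matrix.inv_def, Ring.inverse_eq_inv']
    exact (hd.matrix_det.inv₀ fun g => (isUnit_det_den g.toSU z).ne_zero).smul
      hd.matrix_adjugate
  exact Continuous.subtype_mk h _

lemma continuous_mult_smul (ν : ℝ) (z : Ball p q) :
    Continuous fun g : Cover p q => mult ν g (g • z) := by
  simp only [mult_smul]
  exact Complex.continuous_exp.comp (continuous_const.mul (continuous_log_apply z))

/-! ### Holomorphy and existence of the representations on one ball and on a product -/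

section Holomorphic

attribute [local instance] Matrix.normedAddCommGroup Matrix.normedSpace

lemma differentiableOn_det_cpow [AccretiveDet q] (ν : ℂ) (w : Ball p q) :
    DifferentiableOn ℂ (fun z : Matrix p q ℂ => (1 - w.1ᴴ * z).det ^ ν) (ballSet p q) := by
  intro z hz
  refine DifferentiableAt.differentiableWithinAt ?_
  refine DifferentiableAt.cpow_const ?_ (det_mem_slitPlane hz w.2)
  simp only [det_apply, Matrix.sub_apply, Matrix.mul_apply]
  fun_prop

lemma range_val_ball : Set.range (Subtype.val : Ball p q → Matrix p q ℂ) = ballSet p q :=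
  Subtype.range_coe

lemma exists_le_of_continuous {X E : Type*} [TopologicalSpace X] [TopologicalSpace E] {ι : X → E}
    (hι : IsInducing ι) {f : X → ℝ} (hf : Continuous f) (x : X) :
    ∃ t ∈ 𝓝 (ι x), ∃ C : ℝ, ∀ y, ι y ∈ t → f y ≤ C := by
  have h := (hf.continuousAt (x := x)).eventually (gt_mem_nhds (lt_add_one (f x)))
  rw [hι.nhds_eq_comap] at h
  obtain ⟨t, ht, hts⟩ := h
  exact ⟨t, ht, f x + 1, fun y hy => (hts hy).le⟩

lemma differentiableOn_extend_val [AccretiveDet q] (ν : ℝ) [IsPosDefKernel (kern p q ν)]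
    (f : KernelSpace (kern p q ν)) :
    DifferentiableOn ℂ (Function.extend (Subtype.val : Ball p q → Matrix p q ℂ) f 0)
      (ballSet p q) := by
  have h := differentiableOn_extend (k := kern p q ν) Subtype.val_injective
    (by rw [range_val_ball]; exact isOpen_ballSet)
    (fun w => ⟨fun z => (1 - w.1ᴴ * z).det ^ (-(ν : ℂ)), by
      rw [range_val_ball]; exact differentiableOn_det_cpow _ w, fun z => rfl⟩)
    (exists_le_of_continuous IsInducing.subtypeVal (continuous_kern_self ν)) f
  rwa [range_val_ball] at h

lemma mem_hol [AccretiveDet q] (ν : ℝ) [IsPosDefKernel (kern p q ν)]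
    (f : KernelSpace (kern p q ν)) : ⇑f ∈ hol p q :=
  ⟨_, differentiableOn_extend_val ν f, fun z => (Subtype.val_injective.extend_apply _ _ z).symm⟩

/-- The scalar holomorphic representation with parameter `ν`. -/
theorem exists_isScalarRep [AccretiveDet q] (ν : ℝ) [IsPosDefKernel (kern p q ν)] :
    ∃ U : Cover p q →* (KernelSpace (kern p q ν) ≃ₗᵢ[ℂ] KernelSpace (kern p q ν)),
      IsScalarRep (hol p q) (mult ν) U := by
  obtain ⟨U, hU⟩ := exists_weighted_rep (k := kern p q ν) (mult ν) (mult_one ν) (mult_mul ν)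
    (kern_covariant ν)
  refine ⟨U, mem_hol ν, continuous_rep hU (kern_covariant ν) (mult_ne_zero ν) fun z => ?_, hU⟩
  exact (continuous_star.comp ((continuous_mult_smul ν z).inv₀ fun g => mult_ne_zero ν g _)).smul
    ((continuous_ker (continuous_kern ν)).comp (continuous_smul_apply z))

/-- The coordinates in which the functions of Case `ℂ` are holomorphic. -/
noncomputable def coordC (z : Ball p q × Ball p q) : Matrix p q ℂ × Matrix p q ℂ :=
  (z.1.1, z.2.1.map star)

lemma map_star_mem {z : Matrix p q ℂ} (hz : z ∈ ballSet p q) : z.map star ∈ ballSet p q := by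
  have h : 1 - (z.map star)ᴴ * z.map star = (1 - zᴴ * z)ᵀ := by
    have h2 : (z.map star)ᴴ = zᵀ := by ext i j; simp
    rw [h2, transpose_sub, transpose_one, transpose_mul]
    have h3 : zᴴᵀ = z.map star := by ext i j; simp
    have h4 := (isHermitian_conjTranspose_mul_self z).eq
    ext i j
    simp [Matrix.mul_apply]
  change (1 - (z.map star)ᴴ * z.map star).PosDef
  rw [h]
  exact PosDef.transpose hz

lemma map_star_map_star (z : Matrix p q ℂ) : (z.map star).map star = z := by
  ext i j; simp

lemma coordC_injective : Function.Injective (coordC (p := p) (q := q)) := by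
  intro z w h
  have h2 := congrArg (fun x : Matrix p q ℂ => x.map star) (congrArg Prod.snd h)
  simp only [coordC, map_star_map_star] at h2
  exact Prod.ext (Subtype.ext (congrArg Prod.fst h)) (Subtype.ext h2)

lemma range_coordC : Set.range (coordC (p := p) (q := q)) = ballSet p q ×ˢ ballSet p q := by
  ext ⟨a, b⟩
  constructor
  · rintro ⟨z, hz⟩
    rw [← hz]
    exact ⟨z.1.2, map_star_mem z.2.2⟩
  · rintro ⟨ha, hb⟩
    exact ⟨(⟨a, ha⟩, ⟨b.map star, map_star_mem hb⟩), Prod.ext rfl (map_star_map_star b)⟩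

lemma isInducing_coordC : IsInducing (coordC (p := p) (q := q)) := by
  have hs : Continuous fun z : Matrix p q ℂ => z.map star :=
    continuous_id.matrix_map continuous_star
  have h : IsInducing (fun z : Matrix p q ℂ => z.map star) :=
    (Homeomorph.mk ⟨fun z : Matrix p q ℂ => z.map star, fun z => z.map star,
      map_star_map_star, map_star_map_star⟩ hs hs).isInducing
  exact IsInducing.subtypeVal.prodMap (h.comp IsInducing.subtypeVal)

lemma kernC_covariant [AccretiveDet q] (ν : ℝ) (g : Cover p q × Cover p q)
    (z w : Ball p q × Ball p q) :
    kernC p q ν z w = multC ν g z * kernC p q ν (g⁻¹ • z) (g⁻¹ • w) * star (multC ν g w) := by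
  have h1 := kern_covariant ν g.1 z.1 w.1
  have h2 := kern_covariant ν g.2 w.2 z.2
  rw [kernC, h1, h2]
  simp only [multC, kernC, star_mul', star_star]
  change _ = _ * (kern p q ν (g.1⁻¹ • z.1) (g.1⁻¹ • w.1) *
    kern p q ν (g.2⁻¹ • w.2) (g.2⁻¹ • z.2)) * _
  ring

lemma multC_one (ν : ℝ) (z : Ball p q × Ball p q) : multC ν 1 z = 1 := by
  rw [multC, Prod.fst_one, Prod.snd_one, mult_one, mult_one, star_one, one_mul]

lemma multC_mul (ν : ℝ) (g h : Cover p q × Cover p q) (z : Ball p q × Ball p q) :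
    multC ν (g * h) z = multC ν g z * multC ν h (g⁻¹ • z) := by
  rw [multC, Prod.fst_mul, Prod.snd_mul, mult_mul, mult_mul, star_mul']
  change _ = _ * (mult ν h.1 (g.1⁻¹ • z.1) * star (mult ν h.2 (g.2⁻¹ • z.2)))
  rw [multC]
  ring

lemma multC_ne_zero (ν : ℝ) (g : Cover p q × Cover p q) (z : Ball p q × Ball p q) :
    multC ν g z ≠ 0 :=
  mul_ne_zero (mult_ne_zero _ _ _) (star_ne_zero.2 (mult_ne_zero _ _ _))

lemma continuous_kernC [AccretiveDet q] (ν : ℝ) :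
    Continuous fun x : (Ball p q × Ball p q) × (Ball p q × Ball p q) =>
      kernC p q ν x.1 x.2 := by
  have h1 : Continuous fun x : (Ball p q × Ball p q) × (Ball p q × Ball p q) =>
      (x.1.1, x.2.1) := by fun_prop
  have h2 : Continuous fun x : (Ball p q × Ball p q) × (Ball p q × Ball p q) =>
      (x.2.2, x.1.2) := by fun_prop
  have h3 := (continuous_kern (p := p) ν).comp h1
  have h4 := (continuous_kern (p := p) ν).comp h2
  exact h3.mul h4

lemma continuous_kernC_self [AccretiveDet q] (ν : ℝ) :
    Continuous fun z : Ball p q × Ball p q => (kernC p q ν z z).re := by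
  have h : Continuous fun z : Ball p q × Ball p q => (z, z) :=
    continuous_id.prodMk continuous_id
  have h2 := (continuous_kernC (p := p) ν).comp h
  exact Complex.continuous_re.comp h2

lemma differentiableOn_kernC [AccretiveDet q] (ν : ℝ) (w : Ball p q × Ball p q) :
    DifferentiableOn ℂ (fun z : Matrix p q ℂ × Matrix p q ℂ =>
      (1 - w.1.1ᴴ * z.1).det ^ (-(ν : ℂ)) * (1 - z.2ᵀ * w.2.1).det ^ (-(ν : ℂ)))
      (ballSet p q ×ˢ ballSet p q) := by
  intro z hz
  refine DifferentiableAt.differentiableWithinAt ?_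
  refine DifferentiableAt.mul ?_ ?_
  · refine DifferentiableAt.cpow_const ?_ (det_mem_slitPlane hz.1 w.1.2)
    simp only [det_apply, Matrix.sub_apply, Matrix.mul_apply]
    fun_prop
  · have h := det_mem_slitPlane w.2.2 (map_star_mem hz.2)
    have h2 : (z.2.map star)ᴴ = z.2ᵀ := by ext i j; simp
    rw [h2] at h
    refine DifferentiableAt.cpow_const ?_ h
    simp only [det_apply, Matrix.sub_apply, Matrix.mul_apply, Matrix.transpose_apply]
    fun_prop

lemma differentiableOn_extend_coordC [AccretiveDet q] (ν : ℝ) [IsPosDefKernel (kernC p q ν)]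
    (f : KernelSpace (kernC p q ν)) :
    DifferentiableOn ℂ (Function.extend (coordC (p := p) (q := q)) f 0)
      (ballSet p q ×ˢ ballSet p q) := by
  have h := differentiableOn_extend (k := kernC p q ν) coordC_injective
    (by rw [range_coordC]; exact isOpen_ballSet.prod isOpen_ballSet)
    (fun w => ⟨_, by
      rw [range_coordC]; exact differentiableOn_kernC ν w, fun z => rfl⟩)
    (exists_le_of_continuous isInducing_coordC (continuous_kernC_self ν)) f
  rwa [range_coordC] at h

lemma mem_holC [AccretiveDet q] (ν : ℝ) [IsPosDefKernel (kernC p q ν)]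
    (f : KernelSpace (kernC p q ν)) : ⇑f ∈ holC p q :=
  ⟨_, differentiableOn_extend_coordC ν f, fun z => (coordC_injective.extend_apply _ _ z).symm⟩

/-- The scalar representation of the product of two covering groups with parameter `ν`. -/
theorem exists_isScalarRepC [AccretiveDet q] (ν : ℝ) [IsPosDefKernel (kernC p q ν)] :
    ∃ U : Cover p q × Cover p q →*
        (KernelSpace (kernC p q ν) ≃ₗᵢ[ℂ] KernelSpace (kernC p q ν)),
      IsScalarRep (holC p q) (multC ν) U := by
  obtain ⟨U, hU⟩ := exists_weighted_rep (k := kernC p q ν) (multC ν) (multC_one ν) (multC_mul ν)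
    (kernC_covariant ν)
  refine ⟨U, mem_holC ν, continuous_rep hU (kernC_covariant ν) (multC_ne_zero ν) fun z => ?_, hU⟩
  have h1 : Continuous fun g : Cover p q × Cover p q => multC ν g (g • z) :=
    ((continuous_mult_smul ν z.1).comp continuous_fst).mul
      (continuous_star.comp ((continuous_mult_smul ν z.2).comp continuous_snd))
  have h2 : Continuous fun g : Cover p q × Cover p q => g • z :=
    ((continuous_smul_apply z.1).comp continuous_fst).prodMk
      ((continuous_smul_apply z.2).comp continuous_snd)
  have h3 : Continuous (ker (kernC p q ν)) := continuous_ker (continuous_kernC ν)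
  have h4 : Continuous fun g : Cover p q × Cover p q => star (multC ν g (g • z))⁻¹ :=
    continuous_star.comp (h1.inv₀ fun g => multC_ne_zero ν g _)
  exact h4.smul (h3.comp h2)

end Holomorphic

end ScalarRep


open Filter Topology Metric
open scoped InnerProductSpace

/-! ### Transitivity and rotations -/

section Transitive

variable {p q : Type} [Fintype p] [DecidableEq p] [Fintype q] [DecidableEq q]

/-- The branch is explicit: with u = g⁻¹ • 0 the numerator vanishes at u, so the polarised form
identity reads conj(det den(u)) det den(z) = det(1 - u*z), whose principal logarithm is continuous
on the ball. -/
lemma exists_log_den [AccretiveDet q] (g : SU p q) : ∃ γ : Cover p q, γ.toSU = g := by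
  obtain ⟨u, hu⟩ : ∃ u : Ball p q, g • u = 0 := ⟨g⁻¹ • 0, smul_inv_smul g 0⟩
  have h0 : num g u.1 = 0 := by
    have h1 : num g u.1 * (den g u.1)⁻¹ = 0 := congrArg Subtype.val hu
    have h2 := congrArg (fun x => x * den g u.1) h1
    simpa [Matrix.mul_assoc, nonsing_inv_mul _ (isUnit_det_den g u)] using h2
  have h1 : ∀ z : Ball p q, star (den g u.1).det * (den g z.1).det = kdet z u := by
    intro z
    rw [kdet, ← num_den_polar g z.1 u.1, h0, conjTranspose_zero, Matrix.zero_mul, sub_zero,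
      det_mul, det_conjTranspose]
  have hd : star (den g u.1).det ≠ 0 := star_ne_zero.2 (isUnit_det_den g u).ne_zero
  have hc : Continuous fun z : Ball p q => logK z u := by
    have h : Continuous fun z : Ball p q => (z, u) := continuous_id.prodMk continuous_const
    have h2 := (continuous_logK (p := p) (q := q)).comp h
    exact h2
  refine ⟨⟨g, ⟨fun z => logK z u - Complex.log (star (den g u.1).det),
    hc.sub continuous_const⟩, fun z => ?_⟩, rfl⟩
  change Complex.exp (logK z u - Complex.log (star (den g u.1).det)) = _
  rw [Complex.exp_sub, exp_logK, Complex.exp_log hd, ← h1]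
  field_simp

lemma exists_conj_eq_one {n : Type} [Fintype n] [DecidableEq n] {A : Matrix n n ℂ}
    (hA : A.PosDef) : ∃ x : Matrix n n ℂ, IsUnit x.det ∧ xᴴ * A * x = 1 := by
  open scoped MatrixOrder in
  obtain ⟨B, hB⟩ := CStarAlgebra.nonneg_iff_eq_star_mul_self.1 hA.posSemidef.nonneg
  rw [star_eq_conjTranspose] at hB
  have hu : IsUnit B.det := by
    have h := (isUnit_iff_isUnit_det _).1 hA.isUnit
    rw [hB, det_mul] at h
    exact isUnit_of_mul_isUnit_right h
  refine ⟨B⁻¹, ?_, ?_⟩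
  · rw [det_nonsing_inv]; exact hu.ringInverse
  · rw [hB]
    calc _ = (B * B⁻¹)ᴴ * (B * B⁻¹) := by simp only [Matrix.mul_assoc, conjTranspose_mul]
      _ = 1 := by rw [mul_nonsing_inv _ hu]; simp

/-- 1 - w*w and 1 - ww* are the two Schur complements of the block matrix [1, w; w*, 1], so one is
semidefinite if the other is; they have the same determinant, which gives definiteness. -/
lemma posDef_one_sub_mul_conjTranspose {w : Matrix p q ℂ} (hw : w ∈ ballSet p q) :
    (1 - w * wᴴ).PosDef := by
  have : Invertible (1 : Matrix q q ℂ) := invertibleOne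
  have : Invertible (1 : Matrix p p ℂ) := invertibleOne
  have h1 : (fromBlocks 1 w wᴴ (1 : Matrix q q ℂ)).PosSemidef := by
    rw [PosDef.fromBlocks₁₁ w 1 (PosDef.one (n := p))]
    simpa using PosDef.posSemidef hw
  have h2 : (1 - w * wᴴ).PosSemidef := by
    have := (PosDef.fromBlocks₂₂ (1 : Matrix p p ℂ) w (PosDef.one (n := q))).1 h1
    simpa using this
  rw [h2.posDef_iff_det_ne_zero, det_one_sub_mul_comm]
  exact (PosDef.det_pos hw).ne'

/-- A matrix that preserves the form has a scalar multiple in `SU(p,q)`. -/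
lemma exists_smul_mem {M : Matrix (p ⊕ q) (p ⊕ q) ℂ} (hM : Mᴴ * formJ p q * M = formJ p q) :
    ∃ (c : ℂ) (g : SU p q), c ≠ 0 ∧ mat g = c • M := by
  have hJ : (formJ p q).det ≠ 0 := by
    rw [formJ, det_fromBlocks_zero₂₁, det_one, one_mul, det_neg, det_one, mul_one]
    exact pow_ne_zero _ (by norm_num)
  have h1 := congrArg det hM
  rw [det_mul, det_mul, det_conjTranspose] at h1
  have h2 : star M.det * M.det = 1 := by
    have : (formJ p q).det * (star M.det * M.det - 1) = 0 := by linear_combination h1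
    exact sub_eq_zero.1 ((mul_eq_zero.1 this).resolve_left hJ)
  have h3 : M.det ≠ 0 := right_ne_zero_of_mul (h2.symm ▸ one_ne_zero)
  have h4 : ‖M.det‖ = 1 := by
    have h5 := congrArg norm h2
    rw [norm_mul, norm_star, norm_one] at h5
    nlinarith [norm_nonneg M.det]
  have hc : ∃ c : ℂ, ‖c‖ = 1 ∧ c ^ Fintype.card (p ⊕ q) * M.det = 1 := by
    rcases Nat.eq_zero_or_pos (Fintype.card (p ⊕ q)) with h0 | h0
    · have := Fintype.card_eq_zero_iff.1 h0
      exact ⟨1, norm_one, by rw [det_isEmpty]; simp⟩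
    · obtain ⟨c, hc⟩ := IsAlgClosed.exists_pow_nat_eq (M.det)⁻¹ h0
      refine ⟨c, ?_, by rw [hc, inv_mul_cancel₀ h3]⟩
      have h5 := congrArg norm hc
      rw [norm_pow, norm_inv, h4, inv_one] at h5
      exact (pow_eq_one_iff_of_nonneg (norm_nonneg c) h0.ne').1 h5
  obtain ⟨c, hcn, hc⟩ := hc
  refine ⟨c, ⟨⟨c • M, by rw [det_smul, hc]⟩, ?_⟩, norm_ne_zero_iff.1 (by rw [hcn]; simp), rfl⟩
  change (c • M)ᴴ * formJ p q * (c • M) = formJ p q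
  rw [conjTranspose_smul, Matrix.smul_mul, Matrix.smul_mul, Matrix.mul_smul, smul_smul, hM,
    Complex.star_def, mul_comm, Complex.mul_conj, Complex.normSq_eq_norm_sq, hcn]
  simp

/-- With x*(1 - ww*)x = 1 and y*(1 - w*w)y = 1, the matrix [x, wy; w*x, y] preserves the form and
maps 0 to (wy)y⁻¹ = w. Scaling it to determinant 1 does not change its action. -/
lemma exists_smul_zero_eq [AccretiveDet q] (w : Ball p q) :
    ∃ γ : Cover p q, γ • (0 : Ball p q) = w := by
  obtain ⟨x, hx, hxx⟩ := exists_conj_eq_one (posDef_one_sub_mul_conjTranspose w.2)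
  obtain ⟨y, hy, hyy⟩ := exists_conj_eq_one (show (1 - w.1ᴴ * w.1).PosDef from w.2)
  have hM : (fromBlocks x (w.1 * y) (w.1ᴴ * x) y)ᴴ * formJ p q *
      fromBlocks x (w.1 * y) (w.1ᴴ * x) y = formJ p q := by
    rw [formJ, fromBlocks_conjTranspose, fromBlocks_multiply, fromBlocks_multiply]
    congr 1
    · refine Eq.trans ?_ hxx
      simp only [conjTranspose_mul, conjTranspose_conjTranspose, Matrix.mul_one, Matrix.mul_zero,
        add_zero, zero_add, Matrix.mul_neg, Matrix.neg_mul, Matrix.mul_add, Matrix.add_mul,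
        Matrix.mul_assoc, sub_eq_add_neg]
    · simp only [conjTranspose_mul, conjTranspose_conjTranspose, Matrix.mul_one, Matrix.mul_zero,
        add_zero, zero_add, Matrix.mul_neg, Matrix.neg_mul, Matrix.mul_assoc, add_neg_cancel]
    · simp only [conjTranspose_mul, Matrix.mul_one, Matrix.mul_zero,
        add_zero, zero_add, Matrix.mul_neg, Matrix.neg_mul, Matrix.mul_assoc, add_neg_cancel]
    · refine Eq.trans ?_ (congrArg Neg.neg hyy)
      simp only [conjTranspose_mul, Matrix.mul_one, Matrix.mul_zero,
        add_zero, zero_add, Matrix.mul_neg, Matrix.neg_mul, Matrix.mul_add, Matrix.add_mul,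
        Matrix.mul_assoc, sub_eq_add_neg, neg_add_rev, neg_neg]
  obtain ⟨c, g, hc, hg⟩ := exists_smul_mem hM
  obtain ⟨γ, rfl⟩ := exists_log_den g
  refine ⟨γ, Subtype.ext ?_⟩
  change num γ.toSU (0 : Matrix p q ℂ) * (den γ.toSU (0 : Matrix p q ℂ))⁻¹ = w.1
  have hu := isUnit_det_den γ.toSU (0 : Ball p q)
  rw [ball_zero_val] at hu
  have h1 : num γ.toSU (0 : Matrix p q ℂ) = w.1 * den γ.toSU (0 : Matrix p q ℂ) := by
    rw [num, den, hg, fromBlocks_smul]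
    simp
  rw [h1, Matrix.mul_assoc, mul_nonsing_inv _ hu, Matrix.mul_one]

/-- Rotations of the ball by a phase. -/
lemma exists_rotation [Nonempty q] (φ : ℝ) : ∃ (γ : Cover p q) (c : ℂ), ∀ z : Ball p q,
    (γ • z).1 = Complex.exp (φ * Complex.I) • z.1 ∧ γ.log z = c ∧ den γ.toSU z.1 =
      Complex.exp ((-((Fintype.card p : ℝ) * φ / (Fintype.card p + Fintype.card q)) : ℝ) * Complex.I) •
        (1 : Matrix q q ℂ) := by
  have hq : 0 < (Fintype.card q : ℝ) := Nat.cast_pos.2 Fintype.card_pos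
  set P : ℝ := (Fintype.card p : ℝ) with hP
  set Q : ℝ := (Fintype.card q : ℝ) with hQ
  have hPQ : P + Q ≠ 0 := by positivity
  -- The phases satisfy a/d = exp(iφ) and a^P d^Q = 1: the block-diagonal matrix rotates by φ and
  -- has determinant 1.
  set a : ℂ := Complex.exp ((Q * φ / (P + Q) : ℝ) * Complex.I) with ha
  set d : ℂ := Complex.exp ((-(P * φ / (P + Q)) : ℝ) * Complex.I) with hd
  have hunit : ∀ s : ℝ, Complex.exp (s * Complex.I) * (starRingEnd ℂ) (Complex.exp (s * Complex.I)) = 1 := by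
    intro s
    rw [Complex.mul_conj, Complex.normSq_eq_norm_sq, Complex.norm_exp_ofReal_mul_I]
    simp
  have ha1 : a * (starRingEnd ℂ) a = 1 := hunit _
  have hd1 : d * (starRingEnd ℂ) d = 1 := hunit _
  have hd0 : d ≠ 0 := Complex.exp_ne_zero _
  have hdet : (fromBlocks (a • 1) 0 0 (d • 1) : Matrix (p ⊕ q) (p ⊕ q) ℂ).det = 1 := by
    rw [det_fromBlocks_zero₂₁, det_smul, det_smul, det_one, det_one, mul_one, mul_one, ha, hd,
      ← Complex.exp_nat_mul, ← Complex.exp_nat_mul, ← Complex.exp_add, Complex.exp_eq_one_iff]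
    refine ⟨0, ?_⟩
    have h1 : (P + Q : ℂ) ≠ 0 := by exact_mod_cast hPQ
    have h2 : (Fintype.card p : ℂ) = P := by rw [hP]; simp
    have h3 : (Fintype.card q : ℂ) = Q := by rw [hQ]; simp
    rw [h2, h3]
    push_cast
    field_simp
    ring
  have hform : (fromBlocks (a • 1) 0 0 (d • 1) : Matrix (p ⊕ q) (p ⊕ q) ℂ)ᴴ * formJ p q *
      (fromBlocks (a • 1) 0 0 (d • 1) : Matrix (p ⊕ q) (p ⊕ q) ℂ) = formJ p q := by
    rw [formJ, fromBlocks_conjTranspose, fromBlocks_multiply, fromBlocks_multiply]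
    simp [smul_smul, ha1, hd1]
  let g : SU p q := ⟨⟨_, hdet⟩, hform⟩
  have hden : ∀ z, den g z = d • 1 := fun z => by
    change (fromBlocks (a • 1) 0 0 (d • 1) : Matrix (p ⊕ q) (p ⊕ q) ℂ).toBlocks₂₁ * z +
      (fromBlocks (a • 1) 0 0 (d • 1) : Matrix (p ⊕ q) (p ⊕ q) ℂ).toBlocks₂₂ = _
    simp
  have hnum : ∀ z, num g z = a • z := fun z => by
    change (fromBlocks (a • 1) 0 0 (d • 1) : Matrix (p ⊕ q) (p ⊕ q) ℂ).toBlocks₁₁ * z +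
      (fromBlocks (a • 1) 0 0 (d • 1) : Matrix (p ⊕ q) (p ⊕ q) ℂ).toBlocks₁₂ = _
    simp
  refine ⟨⟨g, ContinuousMap.const _ (Complex.log (d • (1 : Matrix q q ℂ)).det), fun z => ?_⟩,
    Complex.log (d • (1 : Matrix q q ℂ)).det, fun z => ⟨?_, rfl, hden z.1⟩⟩
  · rw [hden, ContinuousMap.const_apply, Complex.exp_log]
    rw [det_smul, det_one, mul_one]
    exact pow_ne_zero _ hd0
  · change num g z.1 * (den g z.1)⁻¹ = _
    have h1 : (d • (1 : Matrix q q ℂ))⁻¹ = d⁻¹ • 1 := by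
      refine inv_eq_right_inv ?_
      rw [smul_mul_smul_comm, mul_inv_cancel₀ hd0, Matrix.mul_one, one_smul]
    rw [hden, hnum, h1, Matrix.mul_smul, Matrix.mul_one, smul_smul, ha, hd, ← Complex.exp_neg,
      ← Complex.exp_add]
    congr 2
    have h1 : (P + Q : ℂ) ≠ 0 := by exact_mod_cast hPQ
    push_cast
    field_simp

end Transitive


open Filter Topology Metric
open scoped InnerProductSpace
open MeasureTheory

/-! ### Positive definite kernels -/

section PosDefKernels

variable {X : Type}

lemma posSemidef_integral {Θ : Type*} [MeasurableSpace Θ] {μ : Measure Θ} {K : Θ → X → X → ℂ}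
    (hK : ∀ᵐ θ ∂μ, (Matrix.of (K θ)).PosSemidef) (hi : ∀ x y, Integrable (fun θ => K θ x y) μ) :
    (Matrix.of fun x y => ∫ θ, K θ x y ∂μ).PosSemidef := by
  constructor
  · ext x y
    simp only [conjTranspose_apply, of_apply, Complex.star_def]
    rw [← integral_conj]
    refine integral_congr_ae (hK.mono fun θ hθ => ?_)
    have := congrFun (congrFun hθ.1 x) y
    simpa using this
  · intro v
    have h : (v.sum fun i vi => v.sum fun j vj => star vi * (∫ θ, K θ i j ∂μ) * vj) =
        ∫ θ, (v.sum fun i vi => v.sum fun j vj => star vi * K θ i j * vj) ∂μ := by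
      simp only [Finsupp.sum]
      rw [integral_finsetSum _ fun i _ => integrable_finsetSum _ fun j _ =>
        ((hi i j).const_mul _).mul_const _]
      refine Finset.sum_congr rfl fun i _ => ?_
      rw [integral_finsetSum _ fun j _ => ((hi i j).const_mul _).mul_const _]
      refine Finset.sum_congr rfl fun j _ => ?_
      rw [integral_mul_const, integral_const_mul]
    simp only [of_apply]
    rw [h]
    exact integral_nonneg_of_ae (hK.mono fun θ hθ => hθ.2 v)

lemma posSemidef_of_tendsto {K : ℕ → X → X → ℂ} {k : X → X → ℂ}
    (hK : ∀ n, (Matrix.of (K n)).PosSemidef) (h : ∀ x y, Tendsto (fun n => K n x y) atTop (𝓝 (k x y))) :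
    (Matrix.of k).PosSemidef := by
  constructor
  · ext x y
    have h1 := (continuous_star.tendsto _).comp (h y x)
    refine tendsto_nhds_unique h1 ((h x y).congr fun n => ?_)
    exact (congrFun (congrFun (hK n).1 x) y).symm
  · intro v
    have h1 : Tendsto (fun n => v.sum fun i vi => v.sum fun j vj => star vi * K n i j * vj) atTop
        (𝓝 (v.sum fun i vi => v.sum fun j vj => star vi * k i j * vj)) := by
      simp only [Finsupp.sum]
      exact tendsto_finsetSum _ fun i _ => tendsto_finsetSum _ fun j _ =>
        ((h i j).const_mul _).mul_const _
    exact ge_of_tendsto' h1 fun n => (hK n).2 v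

lemma posSemidef_mul {k l : X → X → ℂ} (hk : (Matrix.of k).PosSemidef)
    (hl : (Matrix.of l).PosSemidef) : (Matrix.of fun x y => k x y * l x y).PosSemidef :=
  hk.hadamard hl

lemma posSemidef_rankOne (f : X → ℂ) : (Matrix.of fun x y => f x * star (f y)).PosSemidef := by
  constructor
  · ext x y
    simp [mul_comm]
  · intro v
    have h : (v.sum fun i vi => v.sum fun j vj => star vi * (f i * star (f j)) * vj) =
        star (v.sum fun i vi => vi * star (f i)) * (v.sum fun i vi => vi * star (f i)) := by
      simp only [Finsupp.sum, star_sum, Finset.sum_mul_sum]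
      refine Finset.sum_congr rfl fun i _ => Finset.sum_congr rfl fun j _ => ?_
      simp only [star_mul', star_star]
      ring
    simp only [of_apply]
    rw [h]
    exact star_mul_self_nonneg _

lemma posSemidef_const {c : ℂ} (hc : 0 ≤ c) : (Matrix.of fun _ _ : X => c).PosSemidef := by
  have h : (Matrix.of fun _ _ : X => c) = c • Matrix.of fun _ _ : X => (1 : ℂ) * star 1 := by
    ext; simp
  rw [h]
  exact (posSemidef_rankOne fun _ => 1).smul hc

lemma posSemidef_gram {ι : Type*} [Fintype ι] (f : X → ι → ℂ) :
    (Matrix.of fun x y => ∑ i, f x i * star (f y i)).PosSemidef := by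
  have h : (Matrix.of fun x y => ∑ i, f x i * star (f y i)) =
      ∑ i, Matrix.of fun x y => f x i * star (f y i) := by
    ext x y
    simp [Matrix.sum_apply]
  rw [h]
  exact posSemidef_sum _ fun i _ => posSemidef_rankOne fun x => f x i

lemma posSemidef_pow {k : X → X → ℂ} (hk : (Matrix.of k).PosSemidef) (n : ℕ) :
    (Matrix.of fun x y => k x y ^ n).PosSemidef := by
  induction n with
  | zero => simpa using posSemidef_const (X := X) zero_le_one
  | succ n ih =>
    simp only [pow_succ]
    exact posSemidef_mul ih hk

/-- Entrywise powers are positive semidefinite by the Schur product theorem; the exponential is a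
limit of their non-negative combinations. -/
lemma posSemidef_exp {k : X → X → ℂ} (hk : (Matrix.of k).PosSemidef) :
    (Matrix.of fun x y => Complex.exp (k x y)).PosSemidef := by
  refine posSemidef_of_tendsto
    (K := fun n x y => ∑ i ∈ Finset.range n, k x y ^ i / i.factorial) (fun n => ?_) fun x y => ?_
  · have h : (Matrix.of fun x y => ∑ i ∈ Finset.range n, k x y ^ i / i.factorial) =
        ∑ i ∈ Finset.range n, Matrix.of fun x y => k x y ^ i * ((i.factorial : ℂ))⁻¹ := by
      ext x y
      simp [Matrix.sum_apply, div_eq_mul_inv]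
    rw [h]
    refine posSemidef_sum _ fun i _ => posSemidef_mul (posSemidef_pow hk i)
      (posSemidef_const (inv_nonneg.2 (Nat.cast_nonneg _)))
  · rw [Complex.exp_eq_exp_ℂ]
    exact (NormedSpace.expSeries_div_hasSum_exp (k x y)).tendsto_sum_nat

/-- The measure `t ^ (ν - 1) dt` on the positive reals. -/
noncomputable def powMeasure (ν : ℝ) : Measure ℝ :=
  (volume.restrict (Set.Ioi 0)).withDensity fun t => ENNReal.ofReal (t ^ (ν - 1))

lemma ae_powMeasure (ν : ℝ) : ∀ᵐ t ∂powMeasure ν, 0 < t :=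
  (withDensity_absolutelyContinuous _ _).ae_le (ae_restrict_mem measurableSet_Ioi)

lemma integral_exp_powMeasure_real {ν : ℝ} (hν : 0 < ν) {r : ℝ} (hr : 0 < r) :
    ∫ t, Real.exp (-r * t) ∂powMeasure ν = r ^ (-ν) * Real.Gamma ν := by
  rw [powMeasure, integral_withDensity_eq_integral_toReal_smul (by fun_prop)
    (ae_of_all _ fun _ => ENNReal.ofReal_lt_top)]
  have h := Real.integral_rpow_mul_exp_neg_mul_Ioi hν hr
  rw [one_div, Real.inv_rpow hr.le, ← Real.rpow_neg hr.le] at h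
  rw [← h]
  refine setIntegral_congr_fun measurableSet_Ioi fun t ht => ?_
  change (ENNReal.ofReal (t ^ (ν - 1))).toReal • Real.exp (-r * t) = _
  rw [ENNReal.toReal_ofReal (Real.rpow_nonneg (le_of_lt ht) _), smul_eq_mul, neg_mul]

lemma integrable_exp_powMeasure_real {ν : ℝ} (hν : 0 < ν) {r : ℝ} (hr : 0 < r) :
    Integrable (fun t => Real.exp (-r * t)) (powMeasure ν) := by
  refine Integrable.of_integral_ne_zero ?_
  rw [integral_exp_powMeasure_real hν hr]
  exact mul_ne_zero (Real.rpow_pos_of_pos hr _).ne' (Real.Gamma_pos_of_pos hν).ne'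

lemma integrable_exp_powMeasure {ν : ℝ} (hν : 0 < ν) {α : ℂ} (hα : 0 < α.re) :
    Integrable (fun t : ℝ => Complex.exp (-α * t)) (powMeasure ν) := by
  refine (integrable_exp_powMeasure_real hν hα).mono' (by fun_prop) (ae_of_all _ fun t => ?_)
  rw [Complex.norm_exp]
  simp

/-- For real α this is the Gamma integral. Both sides are analytic on the right half-plane and agree
at the real points 1 + 1/(n+1), which accumulate at 1. -/
lemma integral_exp_powMeasure {ν : ℝ} (hν : 0 < ν) {α : ℂ} (hα : 0 < α.re) :
    ∫ t, Complex.exp (-α * (t : ℝ)) ∂powMeasure ν = α ^ (-(ν : ℂ)) * Real.Gamma ν := by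
  have hopen : IsOpen {z : ℂ | 0 < z.re} := isOpen_lt continuous_const Complex.continuous_re
  have hset : Set.Iio (0 : ℝ) ⊆ interior (ProbabilityTheory.integrableExpSet id (powMeasure ν)) := by
    refine interior_maximal (fun t ht => ?_) isOpen_Iio
    have := integrable_exp_powMeasure_real hν (r := -t) (by simpa using ht)
    simpa [ProbabilityTheory.integrableExpSet] using this
  have hF : AnalyticOnNhd ℂ (fun z => ProbabilityTheory.complexMGF id (powMeasure ν) (-z))
      {z : ℂ | 0 < z.re} := by
    refine DifferentiableOn.analyticOnNhd (fun z hz => ?_) hopen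
    refine DifferentiableAt.differentiableWithinAt ?_
    refine DifferentiableAt.comp z (g := ProbabilityTheory.complexMGF id (powMeasure ν))
      (f := fun z => -z) ?_ differentiableAt_id.neg
    refine (ProbabilityTheory.analyticAt_complexMGF (hset ?_)).differentiableAt
    simpa using hz
  have hG : AnalyticOnNhd ℂ (fun z : ℂ => z ^ (-(ν : ℂ)) * Real.Gamma ν) {z : ℂ | 0 < z.re} := by
    refine DifferentiableOn.analyticOnNhd (fun z hz => ?_) hopen
    refine DifferentiableAt.differentiableWithinAt ?_
    exact (differentiableAt_id.cpow_const (Or.inl hz)).mul_const _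
  have hconn : IsPreconnected {z : ℂ | 0 < z.re} := (convex_halfSpace_re_gt 0).isPreconnected
  have hreal : ∀ r : ℝ, 0 < r → ProbabilityTheory.complexMGF id (powMeasure ν) (-(r : ℂ)) =
      (r : ℂ) ^ (-(ν : ℂ)) * Real.Gamma ν := by
    intro r hr
    have h := ProbabilityTheory.complexMGF_ofReal (X := id) (μ := powMeasure ν) (-r)
    rw [Complex.ofReal_neg] at h
    rw [h, ProbabilityTheory.mgf]
    have h2 := integral_exp_powMeasure_real hν hr
    simp only [id]
    rw [h2, Complex.ofReal_mul, Complex.ofReal_cpow hr.le, Complex.ofReal_neg]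
  have hfreq : ∃ᶠ z in 𝓝[≠] (1 : ℂ), ProbabilityTheory.complexMGF id (powMeasure ν) (-z) =
      z ^ (-(ν : ℂ)) * Real.Gamma ν := by
    have h1 : Tendsto (fun n : ℕ => ((1 + 1 / ((n : ℝ) + 1) : ℝ) : ℂ)) atTop (𝓝[≠] 1) := by
      refine tendsto_nhdsWithin_iff.2 ⟨?_, Eventually.of_forall fun n => ?_⟩
      · have h3 := tendsto_one_div_add_atTop_nhds_zero_nat (𝕜 := ℝ)
        have h4 := (Complex.continuous_ofReal.tendsto _).comp (h3.const_add 1)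
        simpa [Function.comp_def] using h4
      · have : (0 : ℝ) < 1 / ((n : ℝ) + 1) := by positivity
        simp only [Set.mem_compl_iff, Set.mem_singleton_iff]
        intro h
        have h5 : (1 + 1 / ((n : ℝ) + 1) : ℝ) = 1 := by exact_mod_cast h
        linarith
    exact h1.frequently (Frequently.of_forall fun n => hreal _ (by positivity))
  have h := hF.eqOn_of_preconnected_of_frequently_eq hG hconn (z₀ := 1) (by simp) hfreq hα
  refine Eq.trans ?_ h
  rfl

/-- The Laplace transform of the powers preserves positive definiteness. -/
lemma posSemidef_mul_cpow {B α : X → X → ℂ} (hα : ∀ x y, 0 < (α x y).re) {ν : ℝ} (hν : 0 < ν)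
    (h : ∀ t : ℝ, 0 < t → (Matrix.of fun x y => B x y * Complex.exp (-α x y * t)).PosSemidef) :
    (Matrix.of fun x y => B x y * α x y ^ (-(ν : ℂ))).PosSemidef := by
  have h1 := posSemidef_integral (μ := powMeasure ν)
    (K := fun t x y => B x y * Complex.exp (-α x y * (t : ℝ)))
    ((ae_powMeasure ν).mono h) fun x y => (integrable_exp_powMeasure hν (hα x y)).const_mul _
  simp only [integral_const_mul, integral_exp_powMeasure hν (hα _ _)] at h1
  have hG := Real.Gamma_pos_of_pos hν
  have h2 := posSemidef_mul h1 (posSemidef_const (c := ((Real.Gamma ν)⁻¹ : ℝ))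
    (Complex.zero_le_real.2 (inv_nonneg.2 hG.le)))
  convert h2 using 4 with x y
  have : (Real.Gamma ν : ℂ) ≠ 0 := by exact_mod_cast hG.ne'
  push_cast
  field_simp

/-- In the Laplace transform, exp(-t(1 - G)) = exp(-t) exp(tG) is a positive constant times an
exponential of a positive semidefinite kernel. -/
lemma posSemidef_one_sub_cpow {G : X → X → ℂ} (hG : (Matrix.of G).PosSemidef)
    (hre : ∀ x y, 0 < (1 - G x y).re) {ν : ℝ} (hν : 0 < ν) :
    (Matrix.of fun x y => (1 - G x y) ^ (-(ν : ℂ))).PosSemidef := by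
  have h := posSemidef_mul_cpow (B := fun _ _ => 1) hre hν fun t ht => by
    have h1 := posSemidef_mul (posSemidef_const (X := X) (c := (Real.exp (-t) : ℝ))
      (Complex.zero_le_real.2 (Real.exp_pos _).le)) (posSemidef_exp
      (posSemidef_mul hG (posSemidef_const (c := (t : ℝ)) (Complex.zero_le_real.2 ht.le))))
    convert h1 using 4 with x y
    rw [one_mul, Complex.ofReal_exp, ← Complex.exp_add]
    congr 1
    push_cast
    ring
  simpa only [one_mul] using h

/-- A Gaussian integral. For vectors `z₁, z₂` with `a = 1 - ⟨z₁, w₁⟩`, `b = -⟨z₂, w₁⟩`,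
`c = -⟨z₁, w₂⟩`, `d = 1 - ⟨z₂, w₂⟩`, the kernel `a⁻¹ exp (-s (d - b c / a))` is positive
definite. -/
lemma posSemidef_gauss {ι : Type*} [Fintype ι] (f g : X → ι → ℂ) {a b c d : X → X → ℂ}
    (ha : ∀ x y, a x y = 1 - ∑ i, f x i * star (f y i))
    (hb : ∀ x y, b x y = -∑ i, g x i * star (f y i))
    (hc : ∀ x y, c x y = -∑ i, f x i * star (g y i))
    (hd : ∀ x y, d x y = 1 - ∑ i, g x i * star (g y i))
    (hre : ∀ x y, 0 < (a x y).re) {s : ℝ} (hs : 0 < s) :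
    (Matrix.of fun x y => (a x y)⁻¹ *
      Complex.exp (-(d x y - b x y * c x y / a x y) * s)).PosSemidef := by
  have hsq : ((√s : ℝ) : ℂ) ^ 2 = s := by
    rw [← Complex.ofReal_pow, Real.sq_sqrt hs.le]
  have hre' : ∀ x y, (-a x y).re < 0 := fun x y => by simpa using hre x y
  -- The integrand is exp(-s - u² - v²) times the exponential of the Gram kernel of the vectors √s g
  -- - (u - iv) f. Its exponent expands to -a(u² + v²) + √s(b + c)u + i√s(b - c)v - sd; integrating
  -- over v and then u gives (π/a) exp(-s(d - bc/a)).
  have h0 : ∀ u v : ℝ, (Matrix.of fun x y => Complex.exp (-a x y * (v : ℂ) ^ 2 +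
      (Complex.I * √s * (b x y - c x y)) * v +
      (-a x y * (u : ℂ) ^ 2 + √s * (b x y + c x y) * u + -s * d x y))).PosSemidef := by
    intro u v
    have h1 := posSemidef_mul (posSemidef_const (X := X)
      (c := (Real.exp (-s - u ^ 2 - v ^ 2) : ℝ))
      (Complex.zero_le_real.2 (Real.exp_pos _).le)) (posSemidef_exp (posSemidef_gram
        fun x i => √s * g x i - ((u : ℂ) - v * Complex.I) * f x i))
    convert h1 using 4 with x y
    rw [Complex.ofReal_exp, ← Complex.exp_add]
    congr 1
    have h2 : ∑ i, (√s * g x i - ((u : ℂ) - v * Complex.I) * f x i) *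
        star (√s * g y i - ((u : ℂ) - v * Complex.I) * f y i) =
        (√s : ℂ) ^ 2 * ∑ i, g x i * star (g y i)
        - √s * ((u : ℂ) + v * Complex.I) * (∑ i, g x i * star (f y i))
        - √s * ((u : ℂ) - v * Complex.I) * (∑ i, f x i * star (g y i))
        + ((u : ℂ) - v * Complex.I) * ((u : ℂ) + v * Complex.I) *
          ∑ i, f x i * star (f y i) := by
      simp only [Finset.mul_sum, ← Finset.sum_sub_distrib, ← Finset.sum_add_distrib]
      refine Finset.sum_congr rfl fun i _ => ?_
      simp only [star_sub, star_mul', Complex.star_def, Complex.conj_ofReal, Complex.conj_I]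
      ring
    rw [h2, ha, hb, hc, hd, hsq]
    push_cast
    linear_combination (v : ℂ) ^ 2 * (∑ i, f x i * star (f y i)) * Complex.I_sq
  have h1 : ∀ u : ℝ, (Matrix.of fun x y => (Real.pi / -(-a x y)) ^ (1 / 2 : ℂ) *
      Complex.exp (-a x y * (u : ℂ) ^ 2 + √s * (b x y + c x y) * u +
        (-s * d x y - s * (b x y - c x y) ^ 2 / (4 * a x y)))).PosSemidef := by
    intro u
    have h2 := posSemidef_integral (μ := volume) (ae_of_all _ (h0 u)) fun x y =>
      integrable_cexp_quadratic' (hre' x y) _ _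
    convert h2 using 4 with x y
    rw [integral_cexp_quadratic (hre' x y)]
    congr 2
    have hne : a x y ≠ 0 := fun h => by have := hre x y; rw [h] at this; simp at this
    rw [mul_pow, mul_pow, hsq, Complex.I_sq]
    field_simp
    ring
  have h2 := posSemidef_integral (μ := volume) (ae_of_all _ h1) fun x y =>
      (integrable_cexp_quadratic' (hre' x y) _ _).const_mul _
  have h3 := posSemidef_mul h2 (posSemidef_const (c := ((Real.pi)⁻¹ : ℝ))
    (Complex.zero_le_real.2 (inv_nonneg.2 Real.pi_pos.le)))
  convert h3 using 4 with x y
  have hne : a x y ≠ 0 := fun h => by have := hre x y; rw [h] at this; simp at this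
  have hpi : (Real.pi : ℂ) ≠ 0 := by exact_mod_cast Real.pi_ne_zero
  rw [integral_const_mul, integral_cexp_quadratic (hre' x y), ← mul_assoc,
    ← Complex.cpow_add _ _ (by rw [neg_neg]; exact div_ne_zero hpi hne)]
  have h5 : (1 / 2 : ℂ) + 1 / 2 = 1 := by norm_num
  have h6 : -(d x y - b x y * c x y / a x y) * s = -s * d x y -
      s * (b x y - c x y) ^ 2 / (4 * a x y) -
      (√s * (b x y + c x y)) ^ 2 / (4 * -a x y) := by
    rw [mul_pow, hsq]
    field_simp
    ring
  rw [h5, Complex.cpow_one, h6]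
  push_cast
  field_simp

end PosDefKernels


open Filter Topology Metric
open scoped InnerProductSpace

/-! ### Positive definiteness of the powers of the determinant -/

section Accretive

instance : AccretiveDet (Fin 1) where
  det_mem A hA := by
    have h := hA.diag_pos (i := 0)
    rw [Complex.pos_iff] at h
    have h1 : 0 < (A 0 0).re := by
      have h2 := h.1
      simp only [Matrix.add_apply, conjTranspose_apply, Complex.add_re, Complex.star_def,
        Complex.conj_re] at h2
      linarith
    rw [det_fin_one]
    exact Or.inl h1

lemma accretive_apply_re {n : Type} [Fintype n] {A : Matrix n n ℂ} (hA : (A + Aᴴ).PosDef)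
    {x : n → ℂ} (hx : x ≠ 0) : 0 < (star x ⬝ᵥ (A *ᵥ x)).re := by
  have h := hA.re_dotProduct_pos hx
  have h2 : star x ⬝ᵥ (Aᴴ *ᵥ x) = star (star x ⬝ᵥ (A *ᵥ x)) := by
    rw [← star_dotProduct_star, star_star, star_mulVec, ← dotProduct_mulVec]
  rw [Matrix.add_mulVec, dotProduct_add, h2] at h
  simp only [Complex.star_def, RCLike.re_to_complex, Complex.add_re, Complex.conj_re] at h
  linarith

lemma accretive_diag_re {n : Type} [Fintype n] [DecidableEq n] {A : Matrix n n ℂ}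
    (hA : (A + Aᴴ).PosDef) (i : n) : 0 < (A i i).re := by
  have h := hA.diag_pos (i := i)
  rw [Complex.pos_iff] at h
  have h2 := h.1
  simp only [Matrix.add_apply, conjTranspose_apply, Complex.add_re, Complex.star_def,
    Complex.conj_re] at h2
  linarith

/-- The Schur complement is the value of the form at x = (-A₀₁/A₀₀, 1), because the first entry of A
x vanishes. -/
lemma accretive_schur_re {A : Matrix (Fin 2) (Fin 2) ℂ} (hA : (A + Aᴴ).PosDef) :
    0 < (A 1 1 - A 0 1 * A 1 0 / A 0 0).re := by
  have h0 := accretive_diag_re hA 0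
  have hne : A 0 0 ≠ 0 := fun h => by rw [h] at h0; simp at h0
  have h := accretive_apply_re hA (x := ![-(A 0 1 / A 0 0), 1]) fun h => by
    have := congrFun h 1
    simp at this
  have h2 : star ![-(A 0 1 / A 0 0), 1] ⬝ᵥ (A *ᵥ ![-(A 0 1 / A 0 0), 1]) =
      A 1 1 - A 0 1 * A 1 0 / A 0 0 := by
    simp only [dotProduct, mulVec, Fin.sum_univ_two, Pi.star_apply, Matrix.cons_val_zero,
      Matrix.cons_val_one, star_one]
    field_simp
    ring
  rwa [h2] at h

lemma mul_mem_slitPlane {u v : ℂ} (hu : 0 < u.re) (hv : 0 < v.re) :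
    u * v ∈ Complex.slitPlane := by
  by_contra h
  rw [Complex.mem_slitPlane_iff, not_or, not_lt, not_not, Complex.mul_re, Complex.mul_im] at h
  obtain ⟨h1, h2⟩ := h
  nlinarith [mul_pos hu hv, sq_nonneg (u.im * v.re), mul_pos hu (mul_pos hv hv),
    sq_nonneg v.im, mul_nonneg hu.le (sq_nonneg v.im)]

lemma det_fin_two_eq {A : Matrix (Fin 2) (Fin 2) ℂ} (h : A 0 0 ≠ 0) :
    A.det = A 0 0 * (A 1 1 - A 0 1 * A 1 0 / A 0 0) := by
  rw [det_fin_two]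
  field_simp

/-- The determinant is A₀₀ times its Schur complement. Both factors have positive real part, so
their arguments add up to less than π in absolute value. -/
instance : AccretiveDet (Fin 2) where
  det_mem A hA := by
    have h0 := accretive_diag_re hA 0
    have hne : A 0 0 ≠ 0 := fun h => by rw [h] at h0; simp at h0
    rw [det_fin_two_eq hne]
    exact mul_mem_slitPlane h0 (accretive_schur_re hA)

lemma mul_cpow_of_re_pos {u v : ℂ} (hu : 0 < u.re) (hv : 0 < v.re) (s : ℂ) :
    (u * v) ^ s = u ^ s * v ^ s := by
  have hu0 : u ≠ 0 := fun h => by rw [h] at hu; simp at hu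
  have hv0 : v ≠ 0 := fun h => by rw [h] at hv; simp at hv
  have h1 := abs_lt.1 (Complex.abs_arg_lt_pi_div_two_iff.2 (Or.inl hu))
  have h2 := abs_lt.1 (Complex.abs_arg_lt_pi_div_two_iff.2 (Or.inl hv))
  rw [Complex.cpow_def_of_ne_zero (mul_ne_zero hu0 hv0), Complex.cpow_def_of_ne_zero hu0,
    Complex.cpow_def_of_ne_zero hv0, ← Complex.exp_add, Complex.log_mul hu0 hv0
      ⟨by linarith [h1.1, h2.1], by linarith [h1.2, h2.2]⟩, add_mul]

end Accretive

section Kern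

variable {p q : Type} [Fintype p] [DecidableEq p] [Fintype q] [DecidableEq q]

lemma one_sub_apply (z w : Ball p q) (a b : q) :
    (1 - w.1ᴴ * z.1 : Matrix q q ℂ) a b = (1 : Matrix q q ℂ) a b - ∑ i, z.1 i b * star (w.1 i a) := by
  rw [Matrix.sub_apply, Matrix.mul_apply]
  congr 1
  exact Finset.sum_congr rfl fun i _ => by rw [conjTranspose_apply, mul_comm]

lemma posSemidef_kern_one {ν : ℝ} (hν : 0 < ν) :
    (Matrix.of (kern p (Fin 1) ν)).PosSemidef := by
  have h1 : ∀ z w : Ball p (Fin 1),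
      (1 - w.1ᴴ * z.1).det = 1 - ∑ i, z.1 i 0 * star (w.1 i 0) := fun z w => by
    rw [det_fin_one, one_sub_apply, one_apply_eq]
  have h := posSemidef_one_sub_cpow (posSemidef_gram fun (z : Ball p (Fin 1)) i => z.1 i 0)
    (fun z w => by
      have := accretive_diag_re (accretive_of_mem_ball z.2 w.2) 0
      rwa [one_sub_apply, one_apply_eq] at this) hν
  convert h using 4 with z w
  rw [kern, h1]

theorem isPosDefKernel_kern_one {ν : ℝ} (hν : 0 < ν) : IsPosDefKernel (kern p (Fin 1) ν) :=
  isPosDefKernel_of_posSemidef (posSemidef_kern_one hν)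

/-- With a the upper left entry and S the Schur complement, det^(-ν) = a^(-(ν-1)) · a⁻¹ S^(-ν). The
second factor is the Laplace transform of the Gaussian kernels a⁻¹ exp(-sS); the first is positive
definite because ν - 1 > 0. -/
theorem isPosDefKernel_kern_two {ν : ℝ} (hν : 1 < ν) : IsPosDefKernel (kern p (Fin 2) ν) := by
  refine isPosDefKernel_of_posSemidef ?_
  let A : Ball p (Fin 2) → Ball p (Fin 2) → Matrix (Fin 2) (Fin 2) ℂ := fun z w => 1 - w.1ᴴ * z.1
  have hA : ∀ z w, (A z w + (A z w)ᴴ).PosDef := fun z w => accretive_of_mem_ball z.2 w.2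
  have h0 : ∀ z w, 0 < (A z w 0 0).re := fun z w => accretive_diag_re (hA z w) 0
  have hne : ∀ z w, A z w 0 0 ≠ 0 := fun z w h => by have := h0 z w; rw [h] at this; simp at this
  have h1 := posSemidef_mul_cpow (B := fun z w => (A z w 0 0)⁻¹)
    (α := fun z w => A z w 1 1 - A z w 0 1 * A z w 1 0 / A z w 0 0)
    (fun z w => accretive_schur_re (hA z w)) (ν := ν) (by linarith) fun s hs =>
      posSemidef_gauss (fun (z : Ball p (Fin 2)) i => z.1 i 0) (fun z i => z.1 i 1)
        (fun z w => by simp only [A]; rw [one_sub_apply, one_apply_eq])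
        (fun z w => by simp only [A]; rw [one_sub_apply, one_apply_ne (by decide : (0 : Fin 2) ≠ 1), zero_sub])
        (fun z w => by simp only [A]; rw [one_sub_apply, one_apply_ne (by decide : (1 : Fin 2) ≠ 0), zero_sub])
        (fun z w => by simp only [A]; rw [one_sub_apply, one_apply_eq]) h0 hs
  have h2 := posSemidef_one_sub_cpow (posSemidef_gram fun (z : Ball p (Fin 2)) i => z.1 i 0)
    (fun z w => by
      have := h0 z w
      simp only [A] at this
      rwa [one_sub_apply, one_apply_eq] at this) (sub_pos.2 hν)
  have h3 := posSemidef_mul h2 h1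
  convert h3 using 4 with z w
  have h4 : 1 - ∑ i, z.1 i 0 * star (w.1 i 0) = A z w 0 0 := by
    simp only [A]; rw [one_sub_apply, one_apply_eq]
  rw [h4, ← mul_assoc, ← Complex.cpow_neg_one, ← Complex.cpow_add _ _ (hne z w)]
  have h5 : -((ν - 1 : ℝ) : ℂ) + -1 = -(ν : ℂ) := by push_cast; ring
  rw [h5, ← mul_cpow_of_re_pos (h0 z w) (accretive_schur_re (hA z w)), ← det_fin_two_eq (hne z w)]
  rfl

theorem isPosDefKernel_kernC_one {ν : ℝ} (hν : 0 < ν) : IsPosDefKernel (kernC p (Fin 1) ν) := by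
  have hp := posSemidef_kern_one (p := p) hν
  refine isPosDefKernel_of_posSemidef ?_
  have h1 := hp.submatrix (Prod.fst : Ball p (Fin 1) × Ball p (Fin 1) → _)
  have h2 := hp.transpose.submatrix (Prod.snd : Ball p (Fin 1) × Ball p (Fin 1) → _)
  exact h1.hadamard h2

end Kern


open Filter Topology Metric
open scoped InnerProductSpace

/-! ### Branching of the scalar representations on one ball -/

section Hol

variable {p q : Type} [Fintype p] [DecidableEq p] [Fintype q] [DecidableEq q]

attribute [local instance] Matrix.normedAddCommGroup Matrix.normedSpace

lemma hol_const (c : ℂ) : (fun _ => c) ∈ hol p q :=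
  ⟨fun _ => c, differentiableOn_const c, fun _ => rfl⟩

lemma hol_add {f g : Ball p q → ℂ} (hf : f ∈ hol p q) (hg : g ∈ hol p q) :
    (fun x => f x + g x) ∈ hol p q := by
  obtain ⟨F, hF, hf⟩ := hf
  obtain ⟨G, hG, hg⟩ := hg
  exact ⟨fun z => F z + G z, DifferentiableOn.fun_add hF hG, fun z => by simp only [hf, hg]⟩

lemma hol_mul {f g : Ball p q → ℂ} (hf : f ∈ hol p q) (hg : g ∈ hol p q) :
    (fun x => f x * g x) ∈ hol p q := by
  obtain ⟨F, hF, hf⟩ := hf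
  obtain ⟨G, hG, hg⟩ := hg
  exact ⟨fun z => F z * G z, DifferentiableOn.fun_mul hF hG, fun z => by simp only [hf, hg]⟩

lemma holC_const (c : ℂ) : (fun _ => c) ∈ holC p q :=
  ⟨fun _ => c, differentiableOn_const c, fun _ => rfl⟩

lemma holC_add {f g : Ball p q × Ball p q → ℂ} (hf : f ∈ holC p q) (hg : g ∈ holC p q) :
    (fun x => f x + g x) ∈ holC p q := by
  obtain ⟨F, hF, hf⟩ := hf
  obtain ⟨G, hG, hg⟩ := hg
  exact ⟨fun z => F z + G z, DifferentiableOn.fun_add hF hG, fun z => by simp only [hf, hg]⟩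

lemma holC_mul {f g : Ball p q × Ball p q → ℂ} (hf : f ∈ holC p q) (hg : g ∈ holC p q) :
    (fun x => f x * g x) ∈ holC p q := by
  obtain ⟨F, hF, hf⟩ := hf
  obtain ⟨G, hG, hg⟩ := hg
  exact ⟨fun z => F z * G z, DifferentiableOn.fun_mul hF hG, fun z => by simp only [hf, hg]⟩

lemma holC_fst {f : Ball p q → ℂ} (hf : f ∈ hol p q) : (fun x => f x.1) ∈ holC p q := by
  obtain ⟨F, hF, hf⟩ := hf
  refine ⟨fun z => F z.1, ?_, fun z => hf z.1⟩
  exact DifferentiableOn.comp (g := F) (t := ballSet p q) hF differentiableOn_fst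
    fun z hz => hz.1

lemma differentiableOn_star_comp {F : Matrix p q ℂ → ℂ} (hF : DifferentiableOn ℂ F (ballSet p q)) :
    DifferentiableOn ℂ (fun z => star (F (z.map star))) (ballSet p q) := by
  intro z hz
  have h := (hF.differentiableAt (isOpen_ballSet.mem_nhds (map_star_mem hz)))
  have h2 := DifferentiableAt.star_star (E := p → q → ℂ) (f := F) (z := z.map star) h
  have h3 : star (show p → q → ℂ from z.map star) = z := by
    funext i j
    exact star_star _
  rw [h3] at h2
  exact h2.differentiableWithinAt

lemma holC_snd {f : Ball p q → ℂ} (hf : f ∈ hol p q) : (fun x => star (f x.2)) ∈ holC p q := by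
  obtain ⟨F, hF, hf⟩ := hf
  refine ⟨fun z => star (F (z.2.map star)), ?_, fun z => ?_⟩
  · exact DifferentiableOn.comp (g := fun z : Matrix p q ℂ => star (F (z.map star)))
      (t := ballSet p q) (differentiableOn_star_comp hF) differentiableOn_snd fun z hz => hz.2
  · simp only [hf, map_star_map_star]

/-- The logarithm in the covering group is only assumed continuous. With g⁻¹ • u = 0, the
transformation law of `logK` shows it to be log det(1 - u*z) plus a constant. -/
lemma mult_mem_hol [AccretiveDet q] (ν : ℝ) (g : Cover p q) : mult ν g ∈ hol p q := by
  obtain ⟨u, hu⟩ : ∃ u : Ball p q, g⁻¹ • u = 0 := ⟨g • 0, inv_smul_smul g 0⟩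
  have h : ∀ z, g⁻¹.log z = logK z u - star (g⁻¹.log u) := by
    intro z
    have h1 := logK_smul g⁻¹ z u
    rw [hu] at h1
    have h2 : logK (g⁻¹ • z) 0 = 0 := by
      rw [logK, kdet, ball_zero_val, conjTranspose_zero, Matrix.zero_mul, sub_zero, det_one,
        Complex.log_one]
    rw [h2] at h1
    linear_combination h1
  refine ⟨fun z => Complex.exp (-(ν : ℂ) * (Complex.log (1 - u.1ᴴ * z).det - star (g⁻¹.log u))),
    fun z hz => DifferentiableAt.differentiableWithinAt ?_, fun z => by rw [mult, h]; rfl⟩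
  have h1 : DifferentiableAt ℂ (fun z : Matrix p q ℂ => (1 - u.1ᴴ * z).det) z := by
    simp only [det_apply, Matrix.sub_apply, Matrix.mul_apply]
    fun_prop
  exact (((h1.clog (det_mem_slitPlane hz u.2)).sub_const _).const_mul _).cexp

lemma differentiableAt_inv_apply {A : Matrix q q ℂ} (hA : IsUnit A.det) (i j : q) :
    DifferentiableAt ℂ (fun A : Matrix q q ℂ => A⁻¹ i j) A := by
  have h1 : DifferentiableAt ℂ (fun A : Matrix q q ℂ => A.det) A := by
    simp only [det_apply]
    fun_prop
  have h2 : DifferentiableAt ℂ (fun A : Matrix q q ℂ => A.adjugate i j) A := by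
    simp only [adjugate_apply, det_apply, updateRow_apply]
    refine DifferentiableAt.fun_sum fun σ _ => DifferentiableAt.const_smul ?_ _
    have h3 : ∀ k, DifferentiableAt ℂ
        (fun A : Matrix q q ℂ => if σ k = j then (Pi.single i 1 : q → ℂ) k else A (σ k) k) A := by
      intro k
      split_ifs <;> fun_prop
    exact (HasFDerivAt.finsetProd (u := Finset.univ) fun k _ =>
      (h3 k).hasFDerivAt).differentiableAt
  simp only [Matrix.inv_def, Ring.inverse_eq_inv', Matrix.smul_apply, smul_eq_mul]
  exact (h1.inv hA.ne_zero).mul h2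

lemma mul_den_inv_mem_hol {r : Type} [Fintype r] (g : SU p q) (l : Matrix r q ℂ →ₗ[ℂ] ℂ)
    (y : Matrix r q ℂ) : (fun x : Ball p q => l (y * (den g x.1)⁻¹)) ∈ hol p q := by
  refine ⟨fun x => l (y * (den g x)⁻¹), fun z hz => DifferentiableAt.differentiableWithinAt ?_,
    fun z => rfl⟩
  have hd : DifferentiableAt ℂ (fun x : Matrix p q ℂ => den g x) z := by
    refine differentiableAt_pi.2 fun i => differentiableAt_pi.2 fun j => ?_
    change DifferentiableAt ℂ (fun x => den g x i j) z
    simp only [den, Matrix.add_apply, Matrix.mul_apply]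
    fun_prop
  have h1 : DifferentiableAt ℂ (fun x : Matrix p q ℂ => y * (den g x)⁻¹) z := by
    refine differentiableAt_pi.2 fun i => differentiableAt_pi.2 fun j => ?_
    change DifferentiableAt ℂ (fun x => (y * (den g x)⁻¹) i j) z
    simp only [Matrix.mul_apply]
    refine DifferentiableAt.fun_sum fun k _ => DifferentiableAt.const_mul ?_ _
    exact (differentiableAt_inv_apply (isUnit_det_den g ⟨z, hz⟩) k j).comp z hd
  exact (LinearMap.toContinuousLinearMap l).differentiableAt.comp z h1

end Hol


open Filter Topology Metric
open scoped InnerProductSpace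

/-! ### Coordinates along and normal to the smaller ball -/

section BranchingBall

variable {p r q : Type} [Fintype p] [DecidableEq p] [Fintype r] [DecidableEq r]
  [Fintype q] [DecidableEq q]

/-- The coordinates `(z', z'')` of a point of the ball. -/
def coordRows (z : Ball (p ⊕ r) q) : Matrix p q ℂ × Matrix r q ℂ := (z.1.toRows₁, z.1.toRows₂)

lemma coordRows_injective : Function.Injective (coordRows (p := p) (r := r) (q := q)) := by
  intro z w h
  apply Subtype.ext
  rw [← fromRows_toRows z.1, ← fromRows_toRows w.1]
  exact congrArg₂ fromRows (congrArg Prod.fst h) (congrArg Prod.snd h)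

lemma mem_range_coordRows {e : Matrix p q ℂ × Matrix r q ℂ} :
    e ∈ Set.range (coordRows (p := p) (r := r) (q := q)) ↔
      (fromRows e.1 e.2 : Matrix (p ⊕ r) q ℂ) ∈ ballSet (p ⊕ r) q := by
  constructor
  · rintro ⟨z, rfl⟩
    rw [coordRows, fromRows_toRows]
    exact z.2
  · intro h
    exact ⟨⟨_, h⟩, rfl⟩

lemma coordRows_eq {z : Ball (p ⊕ r) q} {x : Matrix p q ℂ} {y : Matrix r q ℂ} :
    coordRows z = (x, y) ↔ z.1 = fromRows x y := by
  constructor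
  · intro h
    rw [← fromRows_toRows z.1]
    exact congrArg₂ fromRows (congrArg Prod.fst h) (congrArg Prod.snd h)
  · intro h
    rw [coordRows, h]
    rfl

lemma continuous_fromRows :
    Continuous fun e : Matrix p q ℂ × Matrix r q ℂ => (fromRows e.1 e.2 : Matrix (p ⊕ r) q ℂ) := by
  refine continuous_matrix fun i j => ?_
  cases i with
  | inl i => exact continuous_fst.matrix_elem i j
  | inr i => exact continuous_snd.matrix_elem i j

lemma isOpen_range_coordRows : IsOpen (Set.range (coordRows (p := p) (r := r) (q := q))) := by
  have h : Set.range (coordRows (p := p) (r := r) (q := q)) =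
      (fun e : Matrix p q ℂ × Matrix r q ℂ => (fromRows e.1 e.2 : Matrix (p ⊕ r) q ℂ)) ⁻¹'
        ballSet (p ⊕ r) q := by
    ext e
    exact mem_range_coordRows
  rw [h]
  exact isOpen_ballSet.preimage continuous_fromRows

lemma projBall_eq {z : Ball (p ⊕ r) q} {x : Ball p q} {y : Matrix r q ℂ}
    (h : coordRows z = (x.1, y)) : projBall z = x :=
  Subtype.ext (congrArg Prod.fst h)

/-- The denominator depends on z' only, so over a fixed z' the action on the normal block is linear.
-/
lemma toRows₂_smul (g : SU p q) (z : Ball (p ⊕ r) q) :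
    (embSU r g • z).1.toRows₂ = z.1.toRows₂ * (den g (projBall z).1)⁻¹ := by
  have h := fromBlocks_mul_fromRows z.1.toRows₁ z.1.toRows₂ (mat g).toBlocks₁₁ 0 0
    (1 : Matrix r r ℂ)
  rw [fromRows_toRows] at h
  change (((fromBlocks (mat g).toBlocks₁₁ 0 0 (1 : Matrix r r ℂ)) * z.1 +
    fromRows (mat g).toBlocks₁₂ 0) * (den (embSU r g) z.1)⁻¹).toRows₂ = _
  rw [h, den_emb]
  ext i j
  simp [Matrix.mul_apply, toRows₂]

lemma coordRows_smul (g : Cover p q) {z : Ball (p ⊕ r) q} {x : Ball p q} {y : Matrix r q ℂ}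
    (h : coordRows z = (x.1, y)) :
    coordRows ((embCover r g)⁻¹ • z) = ((g⁻¹ • x).1, y * (den g⁻¹.toSU x.1)⁻¹) := by
  have hp := projBall_eq h
  have hi : (embCover r g)⁻¹ • z = embSU r g⁻¹.toSU • z := by rw [← map_inv]; rfl
  have h1 : projBall ((embCover r g)⁻¹ • z) = g⁻¹ • x := by
    rw [hi, proj_smul, hp]; rfl
  have h2 : z.1.toRows₂ = y := congrArg Prod.snd h
  refine Prod.ext (congrArg Subtype.val h1) ?_
  change ((embCover r g)⁻¹ • z).1.toRows₂ = _
  rw [hi, toRows₂_smul, hp, h2]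

lemma mult_embCover (ν : ℝ) (g : Cover p q) (z : Ball (p ⊕ r) q) :
    mult ν (embCover r g) z = mult ν g (projBall z) := by
  rw [mult, ← map_inv]
  rfl

/-- The linear action of the group on the normal variables. -/
noncomputable def normalAct (r : Type) (g : Cover p q) (x : Ball p q) :
    Matrix r q ℂ →ₗ[ℂ] Matrix r q ℂ where
  toFun y := y * (den g⁻¹.toSU x.1)⁻¹
  map_add' a b := Matrix.add_mul a b _
  map_smul' c a := Matrix.smul_mul c a _

lemma normalAct_one (x : Ball p q) (y : Matrix r q ℂ) : normalAct r 1 x y = y := by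
  change y * (den (1 : Cover p q)⁻¹.toSU x.1)⁻¹ = y
  rw [inv_one]
  change y * (den (1 : SU p q) x.1)⁻¹ = y
  rw [den_one, inv_one, Matrix.mul_one]

lemma normalAct_mul (g h : Cover p q) (x : Ball p q) (y : Matrix r q ℂ) :
    normalAct r (g * h) x y = normalAct r h (g⁻¹ • x) (normalAct r g x y) := by
  change y * (den (g * h)⁻¹.toSU x.1)⁻¹ = y * (den g⁻¹.toSU x.1)⁻¹ *
    (den h⁻¹.toSU (g⁻¹.toSU • x).1)⁻¹
  have h1 : (g * h)⁻¹.toSU = h⁻¹.toSU * g⁻¹.toSU := by rw [_root_.mul_inv_rev]; rfl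
  rw [h1, (num_den_mul _ _ _).2, Matrix.mul_inv_rev, Matrix.mul_assoc]

lemma kernel_fromRows (a c : Matrix p q ℂ) (b d : Matrix r q ℂ) :
    (1 : Matrix q q ℂ) - (fromRows a b)ᴴ * (fromRows c d : Matrix (p ⊕ r) q ℂ) =
      1 - (aᴴ * c + bᴴ * d) := by
  rw [conjTranspose_fromRows_eq_fromCols_conjTranspose, fromCols_mul_fromRows]

/-- The rotation `(z', z'') ↦ (s z', t z'')`. -/
noncomputable def rotBall {s t : ℂ} (hs : ‖s‖ = 1) (ht : ‖t‖ = 1) (z : Ball (p ⊕ r) q) :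
    Ball (p ⊕ r) q :=
  ⟨fromRows (s • z.1.toRows₁) (t • z.1.toRows₂), smul_fromRows_mem hs.le ht.le (by
    rw [fromRows_toRows]; exact z.2)⟩

lemma kern_rotBall (ν : ℝ) {s t : ℂ} (hs : ‖s‖ = 1) (ht : ‖t‖ = 1) (z w : Ball (p ⊕ r) q) :
    kern (p ⊕ r) q ν (rotBall hs ht z) (rotBall hs ht w) = kern (p ⊕ r) q ν z w := by
  have hsq : ∀ c : ℂ, ‖c‖ = 1 → star c * c = 1 := fun c hc => by
    rw [Complex.star_def, mul_comm, Complex.mul_conj, Complex.normSq_eq_norm_sq, hc]; simp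
  have h : (1 : Matrix q q ℂ) - (rotBall hs ht w).1ᴴ * (rotBall hs ht z).1 =
      1 - w.1ᴴ * z.1 := by
    conv_rhs => rw [← fromRows_toRows z.1, ← fromRows_toRows w.1]
    rw [rotBall, rotBall, kernel_fromRows, kernel_fromRows, conjTranspose_smul,
      conjTranspose_smul, Matrix.smul_mul, Matrix.smul_mul, Matrix.mul_smul, Matrix.mul_smul,
      smul_smul, smul_smul, hsq s hs, hsq t ht, one_smul, one_smul]
  rw [kern, kern, h]

lemma coordRows_rotBall {s t : ℂ} (hs : ‖s‖ = 1) (ht : ‖t‖ = 1) {z w : Ball (p ⊕ r) q}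
    (h : coordRows w = (s • (coordRows z).1, t • (coordRows z).2)) : rotBall hs ht z = w :=
  Subtype.ext (coordRows_eq.1 h).symm

lemma rotBall_rotBall {s t : ℂ} (hs : ‖s‖ = 1) (ht : ‖t‖ = 1) (hs' : ‖s⁻¹‖ = 1)
    (ht' : ‖t⁻¹‖ = 1) (z : Ball (p ⊕ r) q) : rotBall hs' ht' (rotBall hs ht z) = z := by
  have hs0 : s ≠ 0 := norm_ne_zero_iff.1 (by rw [hs]; exact one_ne_zero)
  have ht0 : t ≠ 0 := norm_ne_zero_iff.1 (by rw [ht]; exact one_ne_zero)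
  apply Subtype.ext
  change fromRows (s⁻¹ • s • z.1.toRows₁) (t⁻¹ • t • z.1.toRows₂) = z.1
  rw [inv_smul_smul₀ hs0, inv_smul_smul₀ ht0, fromRows_toRows]

lemma exists_rot (ν : ℝ) [IsPosDefKernel (kern (p ⊕ r) q ν)] :
    ∃ R : ℂ → ℂ → KernelSpace (kern (p ⊕ r) q ν) →ₗᵢ[ℂ] KernelSpace (kern (p ⊕ r) q ν),
      ∀ s t : ℂ, ∀ (hs : ‖s‖ = 1) (ht : ‖t‖ = 1), ∀ f z, R s t f z = f (rotBall hs ht z) := by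
  have h : ∀ s t : ℂ, ∃ R : KernelSpace (kern (p ⊕ r) q ν) →ₗᵢ[ℂ] KernelSpace (kern (p ⊕ r) q ν),
      ∀ (hs : ‖s‖ = 1) (ht : ‖t‖ = 1), ∀ f z, R f z = f (rotBall hs ht z) := by
    intro s t
    by_cases h : ‖s‖ = 1 ∧ ‖t‖ = 1
    · have hs' : ‖s⁻¹‖ = 1 := by rw [norm_inv, h.1, inv_one]
      have ht' : ‖t⁻¹‖ = 1 := by rw [norm_inv, h.2, inv_one]
      -- `exists_comp_isometry` gives composition with the inverse map, hence the inverse phases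
      -- here. Off the unit circle the value of R is immaterial.
      obtain ⟨R, hR⟩ := exists_comp_isometry (k := kern (p ⊕ r) q ν) (rotBall hs' ht')
        (kern_rotBall ν hs' ht')
      refine ⟨R, fun hs ht f z => ?_⟩
      have := hR f (rotBall hs ht z)
      rwa [rotBall_rotBall] at this
    · exact ⟨LinearIsometry.id, fun hs ht => absurd ⟨hs, ht⟩ h⟩
  choose R hR using h
  exact ⟨R, hR⟩

attribute [local instance] Matrix.normedAddCommGroup Matrix.normedSpace

lemma differentiable_fromRows :
    Differentiable ℂ fun e : Matrix p q ℂ × Matrix r q ℂ =>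
      (fromRows e.1 e.2 : Matrix (p ⊕ r) q ℂ) := by
  refine differentiable_pi.2 fun i => differentiable_pi.2 fun j => ?_
  cases i with
  | inl i =>
    change Differentiable ℂ fun e : Matrix p q ℂ × Matrix r q ℂ => e.1 i j
    fun_prop
  | inr i =>
    change Differentiable ℂ fun e : Matrix p q ℂ × Matrix r q ℂ => e.2 i j
    fun_prop

lemma differentiableOn_hat [AccretiveDet q] (ν : ℝ) [IsPosDefKernel (kern (p ⊕ r) q ν)]
    (f : KernelSpace (kern (p ⊕ r) q ν)) :
    DifferentiableOn ℂ (hat (coordRows (p := p) (r := r) (q := q)) f) (Set.range coordRows) := by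
  have h := (differentiableOn_extend_val ν f).comp differentiable_fromRows.differentiableOn
    (s := Set.range (coordRows (p := p) (r := r) (q := q))) fun e he => mem_range_coordRows.1 he
  refine h.congr fun e he => ?_
  obtain ⟨z, rfl⟩ := he
  rw [hat, coordRows_injective.extend_apply, Function.comp_apply, coordRows, fromRows_toRows,
    Subtype.val_injective.extend_apply]

/-- Group elements that act as a phase and as the conjugate phase. -/
lemma exists_circle [Nonempty q] {s : ℂ} (hs : ‖s‖ = 1) :
    ∃ (g g' : Cover p q) (L L' t : ℂ), ‖t‖ = 1 ∧
      (∀ z : Ball p q, (g⁻¹ • z).1 = s • z.1 ∧ g⁻¹.log z = L ∧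
        den g⁻¹.toSU z.1 = t • (1 : Matrix q q ℂ)) ∧
      ∀ z : Ball p q, (g'⁻¹ • z).1 = star s • z.1 ∧ g'⁻¹.log z = L' ∧
        den g'⁻¹.toSU z.1 = star t • (1 : Matrix q q ℂ) := by
  have h1 : Complex.exp (s.arg * Complex.I) = s := by
    have := Complex.norm_mul_exp_arg_mul_I s
    rwa [hs, Complex.ofReal_one, one_mul] at this
  obtain ⟨γ, L, h⟩ := exists_rotation (p := p) (q := q) s.arg
  -- The opposite rotation is for the antiholomorphic factor of a product, where conjugated
  -- coordinates turn it into multiplication by s again.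
  obtain ⟨γ', L', h'⟩ := exists_rotation (p := p) (q := q) (-s.arg)
  have hneg : ∀ a : ℝ, Complex.exp ((-a : ℝ) * Complex.I) =
      star (Complex.exp (a * Complex.I)) := by
    intro a
    rw [Complex.star_def, ← Complex.exp_conj, map_mul, Complex.conj_I, Complex.conj_ofReal]
    congr 1
    push_cast
    ring
  refine ⟨γ⁻¹, γ'⁻¹, L, L', Complex.exp ((-((Fintype.card p : ℝ) * s.arg /
    (Fintype.card p + Fintype.card q)) : ℝ) * Complex.I), Complex.norm_exp_ofReal_mul_I _,
    fun z => ?_, fun z => ?_⟩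
  · rw [inv_inv]
    refine ⟨?_, (h z).2.1, (h z).2.2⟩
    rw [(h z).1, h1]
  · rw [inv_inv]
    refine ⟨?_, (h' z).2.1, ?_⟩
    · rw [(h' z).1, hneg, h1]
    · rw [(h' z).2.2, ← hneg]
      congr 4
      ring

lemma inv_smul_one {t : ℂ} (ht : t ≠ 0) :
    (t • (1 : Matrix q q ℂ))⁻¹ = t⁻¹ • 1 := by
  refine inv_eq_right_inv ?_
  rw [smul_mul_smul_comm, mul_inv_cancel₀ ht, Matrix.mul_one, one_smul]

lemma branchingData_kern [AccretiveDet q] [Nonempty q] (ν : ℝ)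
    [IsPosDefKernel (kern (p ⊕ r) q ν)]
    {U : Cover (p ⊕ r) q →* (KernelSpace (kern (p ⊕ r) q ν) ≃ₗᵢ[ℂ] KernelSpace (kern (p ⊕ r) q ν))}
    (hU : ∀ g f x, U g f x = mult ν g x * f (g⁻¹ • x))
    {R : ℂ → ℂ → KernelSpace (kern (p ⊕ r) q ν) →ₗᵢ[ℂ] KernelSpace (kern (p ⊕ r) q ν)}
    (hR : ∀ s t : ℂ, ∀ (hs : ‖s‖ = 1) (ht : ‖t‖ = 1), ∀ f z, R s t f z = f (rotBall hs ht z)) :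
    BranchingData (coordRows (p := p) (r := r) (q := q)) (Subtype.val : Ball p q → _) (hol p q)
      (U.comp (embCover r)) (mult ν) (normalAct r) R where
  inj := coordRows_injective
  isOpen := isOpen_range_coordRows
  scale z s t hs ht := mem_range_coordRows.2 (smul_fromRows_mem hs ht (by
    rw [coordRows, fromRows_toRows]; exact z.2))
  base z := ⟨projBall z, rfl⟩
  zero x := ⟨embBall r x, rfl⟩
  hol f := differentiableOn_hat ν f
  rot s t hs ht f z w h := by rw [hR s t hs ht, coordRows_rotBall hs ht h]
  act g f x y z w hz hw := by
    have h1 : (embCover r g)⁻¹ • z = w :=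
      coordRows_injective ((coordRows_smul g hz).trans hw.symm)
    rw [MonoidHom.comp_apply, hU, mult_embCover, projBall_eq hz, h1]
  act_mem g x y h := by
    obtain ⟨z, hz⟩ := h
    exact ⟨_, coordRows_smul g hz⟩
  mu_one := mult_one ν
  mu_mul := mult_mul ν
  delta_one := normalAct_one
  delta_mul := normalAct_mul
  hol_const := hol_const
  hol_add f g := hol_add
  hol_mul f g := hol_mul
  hol_restrict F hF := by
    refine ⟨fun x => F (x, 0), ?_, fun z => rfl⟩
    refine hF.comp (f := fun x : Matrix p q ℂ => (x, (0 : Matrix r q ℂ))) ?_ fun x hx => ?_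
    · exact (differentiable_id.prodMk (differentiable_const _)).differentiableOn
    · exact ⟨embBall r ⟨x, hx⟩, rfl⟩
  hol_mu := mult_mem_hol ν
  hol_delta g l y := mul_den_inv_mem_hol g⁻¹.toSU l y
  trans := ⟨0, rfl, fun x => by
    obtain ⟨γ, hγ⟩ := exists_smul_zero_eq x
    exact ⟨γ, by rw [← hγ, inv_smul_smul]⟩⟩
  circle s hs := by
    obtain ⟨g, -, L, -, t, ht, h, -⟩ := exists_circle (p := p) (q := q) hs
    have ht0 : t ≠ 0 := norm_ne_zero_iff.1 (by rw [ht]; exact one_ne_zero)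
    refine ⟨g, Complex.exp (-(ν : ℂ) * L), t⁻¹, by rw [norm_inv, ht, inv_one], fun x =>
      ⟨(h x).1, by rw [mult, (h x).2.1], fun y => ?_⟩⟩
    change y * (den g⁻¹.toSU x.1)⁻¹ = _
    rw [(h x).2.2, inv_smul_one ht0, Matrix.mul_smul, Matrix.mul_one]

theorem isDiscreteSum_kern [AccretiveDet q] [Nonempty q] (ν : ℝ)
    [IsPosDefKernel (kern (p ⊕ r) q ν)]
    {U : Cover (p ⊕ r) q →* (KernelSpace (kern (p ⊕ r) q ν) ≃ₗᵢ[ℂ] KernelSpace (kern (p ⊕ r) q ν))}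
    (hU : ∀ g f x, U g f x = mult ν g x * f (g⁻¹ • x)) :
    IsDiscreteSumOfHolomorphic (hol p q) (U.comp (embCover r)) := by
  obtain ⟨R, hR⟩ := exists_rot (p := p) (r := r) (q := q) ν
  have : FiniteDimensional ℂ (Matrix r q ℂ) := inferInstance
  exact (branchingData_kern ν hU hR).isDiscreteSumOfHolomorphic

end BranchingBall


open Filter Topology Metric
open scoped InnerProductSpace

/-! ### Branching of the scalar representations on a product of two balls -/

section BranchingProduct

variable {p r q : Type} [Fintype p] [DecidableEq p] [Fintype r] [DecidableEq r]
  [Fintype q] [DecidableEq q]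

lemma map_star_add (x y : Matrix p q ℂ) : (x + y).map star = x.map star + y.map star := by
  ext i j; simp

lemma map_star_smul (c : ℂ) (x : Matrix p q ℂ) : (c • x).map star = star c • x.map star := by
  ext i j; simp

lemma fromRows_map_star (x : Matrix p q ℂ) (y : Matrix r q ℂ) :
    (fromRows x y).map star = fromRows (x.map star) (y.map star) := by
  ext (i | i) j <;> rfl

/-- The coordinates on the product of two balls, holomorphic in the first and antiholomorphic in
the second variable. -/
def coordRowsC (z : Ball (p ⊕ r) q × Ball (p ⊕ r) q) :
    (Matrix p q ℂ × Matrix p q ℂ) × (Matrix r q ℂ × Matrix r q ℂ) :=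
  (((coordRows z.1).1, (coordRows z.2).1.map star), ((coordRows z.1).2, (coordRows z.2).2.map star))

lemma coordRowsC_eq {z : Ball (p ⊕ r) q × Ball (p ⊕ r) q}
    {x : Matrix p q ℂ × Matrix p q ℂ} {y : Matrix r q ℂ × Matrix r q ℂ} :
    coordRowsC z = (x, y) ↔ coordRows z.1 = (x.1, y.1) ∧
      coordRows z.2 = (x.2.map star, y.2.map star) := by
  simp only [coordRowsC, Prod.ext_iff]
  constructor
  · rintro ⟨⟨h1, h2⟩, h3, h4⟩
    exact ⟨⟨h1, h3⟩, by rw [← h2, map_star_map_star], by rw [← h4, map_star_map_star]⟩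
  · rintro ⟨⟨h1, h3⟩, h2, h4⟩
    exact ⟨⟨h1, by rw [h2, map_star_map_star]⟩, h3, by rw [h4, map_star_map_star]⟩

lemma coordRowsC_injective : Function.Injective (coordRowsC (p := p) (r := r) (q := q)) := by
  intro z w h
  have hw := coordRowsC_eq.1 (Prod.mk.eta (p := coordRowsC w)).symm
  have hz := coordRowsC_eq.1 (h.trans (Prod.mk.eta (p := coordRowsC w)).symm)
  exact Prod.ext (coordRows_injective (hz.1.trans hw.1.symm))
    (coordRows_injective (hz.2.trans hw.2.symm))

lemma fromRows_mem_iff_map_star {x : Matrix p q ℂ} {y : Matrix r q ℂ} :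
    (fromRows (x.map star) (y.map star) : Matrix (p ⊕ r) q ℂ) ∈ ballSet (p ⊕ r) q ↔
      (fromRows x y : Matrix (p ⊕ r) q ℂ) ∈ ballSet (p ⊕ r) q := by
  rw [← fromRows_map_star]
  refine ⟨fun h => ?_, map_star_mem⟩
  have := map_star_mem h
  rwa [map_star_map_star] at this

lemma mem_range_coordRowsC
    {e : (Matrix p q ℂ × Matrix p q ℂ) × (Matrix r q ℂ × Matrix r q ℂ)} :
    e ∈ Set.range (coordRowsC (p := p) (r := r) (q := q)) ↔
      (fromRows e.1.1 e.2.1 : Matrix (p ⊕ r) q ℂ) ∈ ballSet (p ⊕ r) q ∧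
      (fromRows e.1.2 e.2.2 : Matrix (p ⊕ r) q ℂ) ∈ ballSet (p ⊕ r) q := by
  rw [← fromRows_mem_iff_map_star (x := e.1.2)]
  constructor
  · rintro ⟨z, hz⟩
    have h := coordRowsC_eq.1 (hz.trans (Prod.mk.eta (p := e)).symm)
    rw [coordRows_eq, coordRows_eq] at h
    rw [← h.1, ← h.2]
    exact ⟨z.1.2, z.2.2⟩
  · rintro ⟨h1, h2⟩
    exact ⟨(⟨_, h1⟩, ⟨_, h2⟩), coordRowsC_eq.2 ⟨rfl, rfl⟩⟩

lemma isOpen_range_coordRowsC : IsOpen (Set.range (coordRowsC (p := p) (r := r) (q := q))) := by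
  have h : Set.range (coordRowsC (p := p) (r := r) (q := q)) =
      (fun e : (Matrix p q ℂ × Matrix p q ℂ) × (Matrix r q ℂ × Matrix r q ℂ) =>
        ((fromRows e.1.1 e.2.1 : Matrix (p ⊕ r) q ℂ),
          (fromRows e.1.2 e.2.2 : Matrix (p ⊕ r) q ℂ))) ⁻¹'
        (ballSet (p ⊕ r) q ×ˢ ballSet (p ⊕ r) q) := by
    ext e
    exact mem_range_coordRowsC
  rw [h]
  refine (isOpen_ballSet.prod isOpen_ballSet).preimage (Continuous.prodMk ?_ ?_)
  · exact continuous_fromRows.comp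
      ((continuous_fst.comp continuous_fst).prodMk (continuous_fst.comp continuous_snd))
  · exact continuous_fromRows.comp
      ((continuous_snd.comp continuous_fst).prodMk (continuous_snd.comp continuous_snd))

lemma coordRowsC_smul (g : Cover p q × Cover p q) {z : Ball (p ⊕ r) q × Ball (p ⊕ r) q}
    {x : Ball p q × Ball p q} {y : Matrix r q ℂ × Matrix r q ℂ}
    (h : coordRowsC z = (coordC x, y)) :
    coordRowsC ((((embCover r).prodMap (embCover r)) g)⁻¹ • z) = (coordC (g⁻¹ • x),
      (normalAct r g.1 x.1 y.1, (normalAct r g.2 x.2 (y.2.map star)).map star)) := by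
  obtain ⟨h1, h2⟩ := coordRowsC_eq.1 h
  rw [coordC, map_star_map_star] at h2
  rw [coordRowsC_eq, map_star_map_star, coordC, map_star_map_star]
  exact ⟨coordRows_smul g.1 h1, coordRows_smul g.2 h2⟩

/-- The linear action of the group on the normal variables. -/
noncomputable def normalActC (r : Type) (g : Cover p q × Cover p q) (x : Ball p q × Ball p q) :
    Matrix r q ℂ × Matrix r q ℂ →ₗ[ℂ] Matrix r q ℂ × Matrix r q ℂ where
  toFun y := (normalAct r g.1 x.1 y.1, (normalAct r g.2 x.2 (y.2.map star)).map star)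
  map_add' a b := by
    have h : ∀ a b : Matrix r q ℂ, (a + b).map star = a.map star + b.map star := fun a b => by
      ext i j; simp
    simp only [Prod.fst_add, Prod.snd_add, map_add, h, Prod.mk_add_mk]
  map_smul' c a := by
    have h : ∀ (c : ℂ) (a : Matrix r q ℂ), (c • a).map star = star c • a.map star :=
      fun c a => by ext i j; simp
    simp only [Prod.smul_fst, Prod.smul_snd, map_smul, h, star_star, Prod.smul_mk,
      RingHom.id_apply]

lemma normalActC_apply (g : Cover p q × Cover p q) (x : Ball p q × Ball p q)
    (y : Matrix r q ℂ × Matrix r q ℂ) : normalActC r g x y =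
      (normalAct r g.1 x.1 y.1, (normalAct r g.2 x.2 (y.2.map star)).map star) := rfl

lemma normalActC_one (x : Ball p q × Ball p q) (y : Matrix r q ℂ × Matrix r q ℂ) :
    normalActC r 1 x y = y := by
  rw [normalActC_apply, Prod.fst_one, Prod.snd_one, normalAct_one, normalAct_one,
    map_star_map_star]

lemma normalActC_mul (g h : Cover p q × Cover p q) (x : Ball p q × Ball p q)
    (y : Matrix r q ℂ × Matrix r q ℂ) :
    normalActC r (g * h) x y = normalActC r h (g⁻¹ • x) (normalActC r g x y) := by
  rw [normalActC_apply, normalActC_apply, normalActC_apply, Prod.fst_mul, Prod.snd_mul,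
    normalAct_mul, normalAct_mul, map_star_map_star]
  rfl

lemma norm_star_eq_one {s : ℂ} (hs : ‖s‖ = 1) : ‖star s‖ = 1 := by rwa [norm_star]

/-- The rotation of both balls that is linear in the coordinates. -/
noncomputable def rotBallC {s t : ℂ} (hs : ‖s‖ = 1) (ht : ‖t‖ = 1)
    (z : Ball (p ⊕ r) q × Ball (p ⊕ r) q) : Ball (p ⊕ r) q × Ball (p ⊕ r) q :=
  (rotBall hs ht z.1, rotBall (norm_star_eq_one hs) (norm_star_eq_one ht) z.2)

lemma coordRowsC_rotBallC {s t : ℂ} (hs : ‖s‖ = 1) (ht : ‖t‖ = 1)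
    {z w : Ball (p ⊕ r) q × Ball (p ⊕ r) q}
    (h : coordRowsC w = (s • (coordRowsC z).1, t • (coordRowsC z).2)) : rotBallC hs ht z = w := by
  obtain ⟨h1, h2⟩ := coordRowsC_eq.1 h
  refine Prod.ext (coordRows_rotBall hs ht h1) (coordRows_rotBall (norm_star_eq_one hs)
    (norm_star_eq_one ht) ?_)
  rw [h2]
  simp only [coordRowsC, Prod.smul_snd, map_star_smul, map_star_map_star]

lemma rotBallC_rotBallC {s t : ℂ} (hs : ‖s‖ = 1) (ht : ‖t‖ = 1) (hs' : ‖s⁻¹‖ = 1)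
    (ht' : ‖t⁻¹‖ = 1) (z : Ball (p ⊕ r) q × Ball (p ⊕ r) q) :
    rotBallC hs' ht' (rotBallC hs ht z) = z := by
  refine Prod.ext (rotBall_rotBall hs ht hs' ht' z.1) ?_
  have h := rotBall_rotBall (norm_star_eq_one hs) (norm_star_eq_one ht)
    (by rwa [← star_inv₀, norm_star]) (by rwa [← star_inv₀, norm_star]) z.2
  simp only [← star_inv₀] at h
  exact h

lemma exists_rotC (ν : ℝ) [IsPosDefKernel (kernC (p ⊕ r) q ν)] :
    ∃ R : ℂ → ℂ → KernelSpace (kernC (p ⊕ r) q ν) →ₗᵢ[ℂ] KernelSpace (kernC (p ⊕ r) q ν),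
      ∀ s t : ℂ, ∀ (hs : ‖s‖ = 1) (ht : ‖t‖ = 1), ∀ f z, R s t f z = f (rotBallC hs ht z) := by
  have h : ∀ s t : ℂ,
      ∃ R : KernelSpace (kernC (p ⊕ r) q ν) →ₗᵢ[ℂ] KernelSpace (kernC (p ⊕ r) q ν),
      ∀ (hs : ‖s‖ = 1) (ht : ‖t‖ = 1), ∀ f z, R f z = f (rotBallC hs ht z) := by
    intro s t
    by_cases h : ‖s‖ = 1 ∧ ‖t‖ = 1
    · have hs' : ‖s⁻¹‖ = 1 := by rw [norm_inv, h.1, inv_one]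
      have ht' : ‖t⁻¹‖ = 1 := by rw [norm_inv, h.2, inv_one]
      obtain ⟨R, hR⟩ := exists_comp_isometry (k := kernC (p ⊕ r) q ν) (rotBallC hs' ht')
        (fun x y => congrArg₂ (· * ·) (kern_rotBall ν hs' ht' x.1 y.1)
          (kern_rotBall ν (norm_star_eq_one hs') (norm_star_eq_one ht') y.2 x.2))
      refine ⟨R, fun hs ht f z => ?_⟩
      have := hR f (rotBallC hs ht z)
      rwa [rotBallC_rotBallC] at this
    · exact ⟨LinearIsometry.id, fun hs ht => absurd ⟨hs, ht⟩ h⟩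
  choose R hR using h
  exact ⟨R, hR⟩

attribute [local instance] Matrix.normedAddCommGroup Matrix.normedSpace

lemma differentiable_fromRowsC :
    Differentiable ℂ fun e : (Matrix p q ℂ × Matrix p q ℂ) × (Matrix r q ℂ × Matrix r q ℂ) =>
      ((fromRows e.1.1 e.2.1 : Matrix (p ⊕ r) q ℂ),
        (fromRows e.1.2 e.2.2 : Matrix (p ⊕ r) q ℂ)) := by
  have h1 : Differentiable ℂ
      fun e : (Matrix p q ℂ × Matrix p q ℂ) × (Matrix r q ℂ × Matrix r q ℂ) =>
      (e.1.1, e.2.1) := by fun_prop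
  have h2 : Differentiable ℂ
      fun e : (Matrix p q ℂ × Matrix p q ℂ) × (Matrix r q ℂ × Matrix r q ℂ) =>
      (e.1.2, e.2.2) := by fun_prop
  exact (differentiable_fromRows.comp h1).prodMk (differentiable_fromRows.comp h2)

lemma coordC_eq_fromRows (z : Ball (p ⊕ r) q × Ball (p ⊕ r) q) :
    coordC z = (fromRows (coordRowsC z).1.1 (coordRowsC z).2.1,
      fromRows (coordRowsC z).1.2 (coordRowsC z).2.2) := by
  rw [coordC, coordRowsC, ← fromRows_map_star]
  simp only [coordRows, fromRows_toRows]

lemma differentiableOn_hatC [AccretiveDet q] (ν : ℝ) [IsPosDefKernel (kernC (p ⊕ r) q ν)]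
    (f : KernelSpace (kernC (p ⊕ r) q ν)) :
    DifferentiableOn ℂ (hat (coordRowsC (p := p) (r := r) (q := q)) f)
      (Set.range coordRowsC) := by
  have h := (differentiableOn_extend_coordC ν f).comp differentiable_fromRowsC.differentiableOn
    (s := Set.range (coordRowsC (p := p) (r := r) (q := q))) fun e he => mem_range_coordRowsC.1 he
  refine h.congr fun e he => ?_
  obtain ⟨z, rfl⟩ := he
  rw [hat, coordRowsC_injective.extend_apply, Function.comp_apply, ← coordC_eq_fromRows,
    coordC_injective.extend_apply]

lemma normalActC_mem_holC (g : Cover p q × Cover p q)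
    (l : Matrix r q ℂ × Matrix r q ℂ →ₗ[ℂ] ℂ) (y : Matrix r q ℂ × Matrix r q ℂ) :
    (fun x => l (normalActC r g x y)) ∈ holC p q := by
  let l₁ : Matrix r q ℂ →ₗ[ℂ] ℂ := l.comp (LinearMap.inl ℂ _ _)
  -- Conjugating both argument and value keeps the functional complex linear; `holC_snd` then
  -- supplies the second conjugation.
  let l₂ : Matrix r q ℂ →ₗ[ℂ] ℂ :=
    { toFun := fun b => star (l (0, b.map star))
      map_add' := fun a b => by
        rw [map_star_add, ← star_add, ← map_add, Prod.mk_add_mk, add_zero]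
      map_smul' := fun c a => by
        have h : ((0 : Matrix r q ℂ), star c • a.map star) = star c • (0, a.map star) := by
          rw [Prod.smul_mk, smul_zero]
        rw [map_star_smul, h, map_smul, smul_eq_mul, star_mul', star_star]
        rfl }
  have h1 := holC_fst (mul_den_inv_mem_hol g.1⁻¹.toSU l₁ y.1)
  have h2 := holC_snd (mul_den_inv_mem_hol g.2⁻¹.toSU l₂ (y.2.map star))
  have h3 := holC_add h1 h2
  convert h3 using 2 with x
  have h4 : normalActC r g x y = (y.1 * (den g.1⁻¹.toSU x.1.1)⁻¹, 0) +
      (0, (y.2.map star * (den g.2⁻¹.toSU x.2.1)⁻¹).map star) := by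
    rw [Prod.mk_add_mk, add_zero, zero_add]; rfl
  rw [h4, map_add]
  congr 1
  exact (star_star _).symm

lemma branchingData_kernC [AccretiveDet q] [Nonempty q] (ν : ℝ)
    [IsPosDefKernel (kernC (p ⊕ r) q ν)]
    {U : Cover (p ⊕ r) q × Cover (p ⊕ r) q →*
      (KernelSpace (kernC (p ⊕ r) q ν) ≃ₗᵢ[ℂ] KernelSpace (kernC (p ⊕ r) q ν))}
    (hU : ∀ g f x, U g f x = multC ν g x * f (g⁻¹ • x))
    {R : ℂ → ℂ → KernelSpace (kernC (p ⊕ r) q ν) →ₗᵢ[ℂ] KernelSpace (kernC (p ⊕ r) q ν)}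
    (hR : ∀ s t : ℂ, ∀ (hs : ‖s‖ = 1) (ht : ‖t‖ = 1), ∀ f z, R s t f z = f (rotBallC hs ht z)) :
    BranchingData (coordRowsC (p := p) (r := r) (q := q)) (coordC (p := p) (q := q)) (holC p q)
      (U.comp ((embCover r).prodMap (embCover r))) (multC ν) (normalActC r) R where
  inj := coordRowsC_injective
  isOpen := isOpen_range_coordRowsC
  scale z s t hs ht := by
    have h := mem_range_coordRowsC.1 (Set.mem_range_self z)
    exact mem_range_coordRowsC.2 ⟨smul_fromRows_mem hs ht h.1, smul_fromRows_mem hs ht h.2⟩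
  base z := ⟨(projBall z.1, projBall z.2), rfl⟩
  zero x := ⟨(embBall r x.1, embBall r x.2), coordRowsC_eq.2 ⟨rfl, by
    rw [coordC, map_star_map_star]
    refine Prod.ext rfl ?_
    ext i j
    simp [coordRows, embBall]⟩⟩
  hol f := differentiableOn_hatC ν f
  rot s t hs ht f z w h := by rw [hR s t hs ht, coordRowsC_rotBallC hs ht h]
  act g f x y z w hz hw := by
    have h1 : (((embCover r).prodMap (embCover r)) g)⁻¹ • z = w :=
      coordRowsC_injective ((coordRowsC_smul g hz).trans hw.symm)
    obtain ⟨h2, h3⟩ := coordRowsC_eq.1 hz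
    rw [coordC, map_star_map_star] at h3
    have h4 : multC ν (((embCover r).prodMap (embCover r)) g) z = multC ν g x := by
      rw [multC, multC, ← projBall_eq h2, ← projBall_eq h3, ← mult_embCover, ← mult_embCover]
      rfl
    rw [MonoidHom.comp_apply, hU, h1, h4]
  act_mem g x y h := by
    obtain ⟨z, hz⟩ := h
    exact ⟨_, coordRowsC_smul g hz⟩
  mu_one := multC_one ν
  mu_mul := multC_mul ν
  delta_one := normalActC_one
  delta_mul := normalActC_mul
  hol_const := holC_const
  hol_add f g := holC_add
  hol_mul f g := holC_mul
  hol_restrict F hF := by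
    refine ⟨fun x => F (x, 0), ?_, fun z => rfl⟩
    refine hF.comp (f := fun x : Matrix p q ℂ × Matrix p q ℂ =>
      (x, (0 : Matrix r q ℂ × Matrix r q ℂ))) ?_ fun x hx => ?_
    · exact (differentiable_id.prodMk (differentiable_const _)).differentiableOn
    · exact mem_range_coordRowsC.2 ⟨(embBall r ⟨x.1, hx.1⟩).2, (embBall r ⟨x.2, hx.2⟩).2⟩
  hol_mu g := holC_mul (holC_fst (mult_mem_hol ν g.1)) (holC_snd (mult_mem_hol ν g.2))
  hol_delta g l y := normalActC_mem_holC g l y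
  trans := ⟨0, by
      refine Prod.ext rfl ?_
      ext i j
      simp [coordC, ball_zero_val], fun x => by
    obtain ⟨γ, hγ⟩ := exists_smul_zero_eq x.1
    obtain ⟨γ', hγ'⟩ := exists_smul_zero_eq x.2
    refine ⟨(γ, γ'), Prod.ext ?_ ?_⟩
    · change γ⁻¹ • x.1 = 0
      rw [← hγ, inv_smul_smul]
    · change γ'⁻¹ • x.2 = 0
      rw [← hγ', inv_smul_smul]⟩
  circle s hs := by
    obtain ⟨g, g', L, L', t, ht, h, h'⟩ := exists_circle (p := p) (q := q) hs
    have ht0 : t ≠ 0 := norm_ne_zero_iff.1 (by rw [ht]; exact one_ne_zero)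
    refine ⟨(g, g'), Complex.exp (-(ν : ℂ) * L) * star (Complex.exp (-(ν : ℂ) * L')), t⁻¹,
      by rw [norm_inv, ht, inv_one], fun x => ⟨Prod.ext (h x.1).1 ?_, ?_, fun y => ?_⟩⟩
    · change (g'⁻¹ • x.2).1.map star = s • x.2.1.map star
      rw [(h' x.2).1, map_star_smul, star_star]
    · rw [multC, mult, mult, (h x.1).2.1, (h' x.2).2.1]
    · change (y.1 * (den g⁻¹.toSU x.1.1)⁻¹, (y.2.map star * (den g'⁻¹.toSU x.2.1)⁻¹).map star) = _
      rw [(h x.1).2.2, (h' x.2).2.2, inv_smul_one ht0, inv_smul_one (star_ne_zero.2 ht0),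
        Matrix.mul_smul, Matrix.mul_one, Matrix.mul_smul, Matrix.mul_one, map_star_smul,
        map_star_map_star, ← star_inv₀, star_star]
      rfl

theorem isDiscreteSum_kernC [AccretiveDet q] [Nonempty q] (ν : ℝ)
    [IsPosDefKernel (kernC (p ⊕ r) q ν)]
    {U : Cover (p ⊕ r) q × Cover (p ⊕ r) q →*
      (KernelSpace (kernC (p ⊕ r) q ν) ≃ₗᵢ[ℂ] KernelSpace (kernC (p ⊕ r) q ν))}
    (hU : ∀ g f x, U g f x = multC ν g x * f (g⁻¹ • x)) :
    IsDiscreteSumOfHolomorphic (holC p q) (U.comp ((embCover r).prodMap (embCover r))) := by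
  obtain ⟨R, hR⟩ := exists_rotC (p := p) (r := r) (q := q) ν
  have : FiniteDimensional ℂ (Matrix r q ℂ) := inferInstance
  exact (branchingData_kernC ν hU hR).isDiscreteSumOfHolomorphic

end BranchingProduct


open Filter Topology Metric
open scoped InnerProductSpace

/-! ### The normal derivatives of powers of determinants -/

section NormalDerivativeFormulas

variable {p r q : Type} [Fintype p] [DecidableEq p] [Fintype r] [DecidableEq r]
  [Fintype q] [DecidableEq q]

attribute [local instance] Matrix.normedAddCommGroup Matrix.normedSpace

lemma pd_congr (a : r) (b : q) {U : Set (Matrix (p ⊕ r) q ℂ)} (hU : IsOpen U)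
    {F G : Matrix (p ⊕ r) q ℂ → ℂ} (h : Set.EqOn F G U) : Set.EqOn (pd a b F) (pd a b G) U :=
  dirD_congr hU h _

lemma pd_eq_of_hasDerivAt {a : r} {b : q} {F : Matrix (p ⊕ r) q ℂ → ℂ} {z : Matrix (p ⊕ r) q ℂ}
    {c : ℂ} (h : HasDerivAt (fun t : ℂ => F (z + t • Matrix.single (Sum.inr a) b 1)) c 0) :
    pd a b F z = c := h.deriv

lemma pd_comp {U : Set (Matrix (p ⊕ r) q ℂ)} {a : r} {b : q} {M K : Matrix (p ⊕ r) q ℂ → ℂ} {V : ℂ}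
    (hM : ∀ z (t : ℂ), M (z + t • Matrix.single (Sum.inr a) b 1) = M z + t * V)
    (hK : ∀ z (t : ℂ), K (z + t • Matrix.single (Sum.inr a) b 1) = K z)
    {φ φ' : ℂ → ℂ} (h1 : ∀ z ∈ U, HasDerivAt φ (φ' (M z)) (M z)) :
    Set.EqOn (pd a b fun z => φ (M z) * K z) (fun z => V * φ' (M z) * K z) U := by
  intro z hz
  refine pd_eq_of_hasDerivAt ?_
  simp only [hM, hK]
  have h2 : HasDerivAt (fun t : ℂ => M z + t * V) V 0 := by
    simpa using ((hasDerivAt_id (0 : ℂ)).mul_const V).const_add (M z)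
  have h3 : HasDerivAt φ (φ' (M z)) (M z + 0 * V) := by
    rw [zero_mul, add_zero]; exact h1 z hz
  have h4 : HasDerivAt (fun t : ℂ => φ (M z + t * V)) (φ' (M z) * V) 0 := h3.comp (0 : ℂ) h2
  exact (h4.mul_const (K z)).congr_deriv (by ring)

/-- A form of Cayley's identity. Moving along the entry (a, b) adds row a of `V` to column b of `M`.
In the antisymmetrised second derivatives the φ'' terms combine to det V · det M · φ'', and each of
the two products leaves det V · φ'. -/
lemma pdDet_comp {U : Set (Matrix (p ⊕ Fin 2) (Fin 2) ℂ)} (hU : IsOpen U)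
    {M : Matrix (p ⊕ Fin 2) (Fin 2) ℂ → Matrix (Fin 2) (Fin 2) ℂ}
    {V : Matrix (Fin 2) (Fin 2) ℂ} {K : Matrix (p ⊕ Fin 2) (Fin 2) ℂ → ℂ}
    (hM : ∀ a b z (t : ℂ) k l, M (z + t • Matrix.single (Sum.inr a) b 1) k l =
      M z k l + t * if l = b then V a k else 0)
    (hK : ∀ a b z (t : ℂ), K (z + t • Matrix.single (Sum.inr a) b 1) = K z)
    {φ φ' φ'' : ℂ → ℂ} (h1 : ∀ z ∈ U, HasDerivAt φ (φ' (M z).det) (M z).det)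
    (h2 : ∀ z ∈ U, HasDerivAt φ' (φ'' (M z).det) (M z).det) :
    Set.EqOn (pdDet fun z => φ (M z).det * K z)
      (fun z => V.det * ((M z).det * φ'' (M z).det + 2 * φ' (M z).det) * K z) U := by
  have hdet : ∀ a b z, HasDerivAt (fun t : ℂ => (M (z + t • Matrix.single (Sum.inr a) b 1)).det)
      ((if (0 : Fin 2) = b then V a 0 * M z 1 1 - V a 1 * M z 0 1 else
        V a 1 * M z 0 0 - V a 0 * M z 1 0)) 0 := by
    intro a b z
    have h3 : ∀ c d : ℂ, HasDerivAt (fun t : ℂ => c + t * d) d 0 := fun c d => by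
      simpa using ((hasDerivAt_id (0 : ℂ)).mul_const d).const_add c
    simp only [det_fin_two, hM]
    have h4 := ((h3 (M z 0 0) (if 0 = b then V a 0 else 0)).mul
      (h3 (M z 1 1) (if 1 = b then V a 1 else 0))).sub
      ((h3 (M z 0 1) (if 1 = b then V a 0 else 0)).mul
      (h3 (M z 1 0) (if 0 = b then V a 1 else 0)))
    refine h4.congr_deriv ?_
    fin_cases b <;> simp <;> ring
  have hφ : ∀ (ψ ψ' : ℂ → ℂ), (∀ z ∈ U, HasDerivAt ψ (ψ' (M z).det) (M z).det) →
      ∀ a b, ∀ z ∈ U, HasDerivAt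
        (fun t : ℂ => ψ (M (z + t • Matrix.single (Sum.inr a) b 1)).det)
        (ψ' (M z).det * (if (0 : Fin 2) = b then V a 0 * M z 1 1 - V a 1 * M z 0 1 else
          V a 1 * M z 0 0 - V a 0 * M z 1 0)) 0 := by
    intro ψ ψ' h a b z hz
    have h3 : HasDerivAt ψ (ψ' (M z).det)
        (M (z + (0 : ℂ) • Matrix.single (Sum.inr a) b 1)).det := by
      rw [zero_smul, add_zero]; exact h z hz
    exact h3.comp (0 : ℂ) (hdet a b z)
  have hfirst : ∀ a b, Set.EqOn (pd a b fun z => φ (M z).det * K z)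
      (fun z => φ' (M z).det * ((if (0 : Fin 2) = b then V a 0 * M z 1 1 - V a 1 * M z 0 1 else
          V a 1 * M z 0 0 - V a 0 * M z 1 0) * K z)) U := by
    intro a b z hz
    refine pd_eq_of_hasDerivAt ?_
    simp only [hK]
    refine ((hφ φ φ' h1 a b z hz).mul_const (K z)).congr_deriv ?_
    ring
  have h3 : ∀ c d : ℂ, HasDerivAt (fun t : ℂ => c + t * d) d 0 := fun c d => by
    simpa using ((hasDerivAt_id (0 : ℂ)).mul_const d).const_add c
  intro z hz
  have e1 : pd 0 0 (pd 1 1 fun z => φ (M z).det * K z) z =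
      φ'' (M z).det * (V 0 0 * M z 1 1 - V 0 1 * M z 0 1) *
        ((V 1 1 * M z 0 0 - V 1 0 * M z 1 0) * K z) +
      φ' (M z).det * ((V 1 1 * V 0 0 - V 1 0 * V 0 1) * K z) := by
    rw [pd_congr 0 0 hU (hfirst 1 1) hz]
    refine pd_eq_of_hasDerivAt ?_
    simp only [hK, hM]
    have h5 := ((((h3 (M z 0 0) (V 0 0)).const_mul (V 1 1)).sub
      ((h3 (M z 1 0) (V 0 1)).const_mul (V 1 0))).mul_const (K z))
    have h6 := (hφ φ' φ'' h2 0 0 z hz).fun_mul h5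
    refine (h6.congr_of_eventuallyEq (.of_forall fun t => by simp)).congr_deriv (by simp)
  have e2 : pd 0 1 (pd 1 0 fun z => φ (M z).det * K z) z =
      φ'' (M z).det * (V 0 1 * M z 0 0 - V 0 0 * M z 1 0) *
        ((V 1 0 * M z 1 1 - V 1 1 * M z 0 1) * K z) +
      φ' (M z).det * ((V 1 0 * V 0 1 - V 1 1 * V 0 0) * K z) := by
    rw [pd_congr 0 1 hU (hfirst 1 0) hz]
    refine pd_eq_of_hasDerivAt ?_
    simp only [hK, hM]
    have h5 := ((((h3 (M z 1 1) (V 0 1)).const_mul (V 1 0)).sub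
      ((h3 (M z 0 1) (V 0 0)).const_mul (V 1 1))).mul_const (K z))
    have h6 := (hφ φ' φ'' h2 0 1 z hz).fun_mul h5
    refine (h6.congr_of_eventuallyEq (.of_forall fun t => by simp)).congr_deriv (by simp)
  rw [pdDet, e1, e2]
  simp only [det_fin_two]
  ring

/-- A differential operator in the normal variables that acts on powers of determinants by
constants: `c s` on `det (1 - w* z) ^ (-s)` and `d n` on `det z_n ^ (n + 1)`. -/
structure NormalOp (D : (Matrix (p ⊕ q) q ℂ → ℂ) → Matrix (p ⊕ q) q ℂ → ℂ) (c : ℝ → ℝ)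
    (d : ℕ → ℝ) : Prop where
  congr : ∀ F G : Matrix (p ⊕ q) q ℂ → ℂ, Set.EqOn F G (ballSet (p ⊕ q) q) →
    Set.EqOn (D F) (D G) (ballSet (p ⊕ q) q)
  family : ∀ {H : Type} [NormedAddCommGroup H] [InnerProductSpace ℂ H] [CompleteSpace H]
    (A : H → Matrix (p ⊕ q) q ℂ → ℂ), IsHolFamily (ballSet (p ⊕ q) q) A →
    IsHolFamily (ballSet (p ⊕ q) q) fun f => D (A f)
  kernel : ∀ (s : ℝ) (w : Ball (p ⊕ q) q) (α : ℂ),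
    Set.EqOn (D fun z => (1 - w.1ᴴ * z).det ^ (-(s : ℂ)) * α)
      (fun z => (1 - w.1ᴴ * z).det ^ (-((s + 1 : ℝ) : ℂ)) * (c s * star w.1.toRows₂.det * α))
      (ballSet (p ⊕ q) q)
  power : ∀ (n : ℕ) (K : Matrix p q ℂ → ℂ),
    Set.EqOn (D fun z => z.toRows₂.det ^ (n + 1) * K z.toRows₁)
      (fun z => z.toRows₂.det ^ n * (d n * K z.toRows₁)) (ballSet (p ⊕ q) q)
  pos : ∀ n, 0 < d n

lemma toRows₁_add_single (a : r) (b : q) (z : Matrix (p ⊕ r) q ℂ) (t : ℂ) :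
    (z + t • Matrix.single (Sum.inr a) b 1).toRows₁ = z.toRows₁ := by
  ext i j
  simp

lemma toRows₂_add_single (a : r) (b : q) (z : Matrix (p ⊕ r) q ℂ) (t : ℂ) (k : r) (l : q) :
    (z + t • Matrix.single (Sum.inr a) b 1).toRows₂ k l =
      z.toRows₂ k l + t * if l = b then (1 : Matrix r r ℂ) a k else 0 := by
  by_cases h : l = b <;> by_cases h' : a = k <;>
    simp [one_apply, h, h', eq_comm (a := b)]

lemma one_sub_mul_add_single (w : Matrix (p ⊕ r) q ℂ) (a : r) (b : q) (z : Matrix (p ⊕ r) q ℂ)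
    (t : ℂ) (k l : q) : (1 - wᴴ * (z + t • Matrix.single (Sum.inr a) b 1) : Matrix q q ℂ) k l =
      (1 - wᴴ * z : Matrix q q ℂ) k l + t * if l = b then -star (w.toRows₂ a k) else 0 := by
  rw [Matrix.mul_add, Matrix.mul_smul]
  by_cases h : l = b
  · subst h
    simp
    ring
  · simp [h]

lemma hasDerivAt_cpow {s x : ℂ} (hx : x ∈ Complex.slitPlane) :
    HasDerivAt (fun x : ℂ => x ^ s) (s * x ^ (s - 1)) x := by
  simpa using (hasDerivAt_id x).cpow_const (c := s) hx

lemma normalOp_one : NormalOp (p := p) (pd (r := Fin 1) (q := Fin 1) 0 0) (fun s => s)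
    (fun n => n + 1) where
  congr F G h := pd_congr 0 0 isOpen_ballSet h
  family A hA := hA.dirD isOpen_ballSet _
  kernel s w α := by
    have h := pd_comp (p := p) (r := Fin 1) (q := Fin 1) (U := ballSet (p ⊕ Fin 1) (Fin 1))
      (a := 0) (b := 0) (M := fun z => (1 - w.1ᴴ * z).det) (K := fun _ => α)
      (V := -star w.1.toRows₂.det)
      (fun z t => by
        simp only [det_fin_one]
        rw [one_sub_mul_add_single, if_pos rfl]) (fun _ _ => rfl)
      (φ := fun x => x ^ (-(s : ℂ))) (φ' := fun x => -(s : ℂ) * x ^ (-(s : ℂ) - 1))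
      (fun z hz => hasDerivAt_cpow (det_mem_slitPlane hz w.2))
    refine h.trans fun z _ => ?_
    have h2 : -(s : ℂ) - 1 = -((s + 1 : ℝ) : ℂ) := by push_cast; ring
    simp only [h2]
    ring
  power n K := by
    have h := pd_comp (p := p) (r := Fin 1) (q := Fin 1) (U := ballSet (p ⊕ Fin 1) (Fin 1))
      (a := 0) (b := 0) (M := fun z => z.toRows₂.det) (K := fun z => K z.toRows₁)
      (V := 1)
      (fun z t => by
        simp only [det_fin_one]
        rw [toRows₂_add_single, if_pos rfl, one_apply_eq])
      (fun z t => by simp only [toRows₁_add_single])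
      (φ := fun x => x ^ (n + 1)) (φ' := fun x => ((n + 1 : ℕ) : ℂ) * x ^ n)
      (fun z hz => hasDerivAt_pow (n + 1) _)
    refine h.trans fun z _ => ?_
    push_cast
    ring
  pos n := by positivity

/-- With φ = x^(-s), xφ'' + 2φ' = (s(s+1) - 2s) x^(-s-1) = s(s-1) x^(-s-1). With φ = x^(n+1) the
factor is (n+1)n + 2(n+1) = (n+1)(n+2). -/
lemma normalOp_two : NormalOp (p := p) (q := Fin 2) pdDet (fun s => s * (s - 1))
    (fun n => (n + 1) * (n + 2)) where
  congr F G h z hz := by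
    rw [pdDet, pdDet, pd_congr 0 0 isOpen_ballSet (pd_congr 1 1 isOpen_ballSet h) hz,
      pd_congr 0 1 isOpen_ballSet (pd_congr 1 0 isOpen_ballSet h) hz]
  family A hA := ((hA.dirD isOpen_ballSet _).dirD isOpen_ballSet _).sub
    ((hA.dirD isOpen_ballSet _).dirD isOpen_ballSet _)
  kernel s w α := by
    have h := pdDet_comp (p := p) (U := ballSet (p ⊕ Fin 2) (Fin 2)) isOpen_ballSet
      (M := fun z => 1 - w.1ᴴ * z) (K := fun _ => α)
      (V := -(w.1.toRows₂.map star))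
      (fun a b z t k l => one_sub_mul_add_single w.1 a b z t k l) (fun _ _ _ _ => rfl)
      (φ := fun x => x ^ (-(s : ℂ))) (φ' := fun x => -(s : ℂ) * x ^ (-(s : ℂ) - 1))
      (φ'' := fun x => -(s : ℂ) * ((-(s : ℂ) - 1) * x ^ (-(s : ℂ) - 1 - 1)))
      (fun z hz => hasDerivAt_cpow (det_mem_slitPlane hz w.2))
      (fun z hz => (hasDerivAt_cpow (det_mem_slitPlane hz w.2)).const_mul _)
    refine h.trans fun z hz => ?_
    have h2 : -((s + 1 : ℝ) : ℂ) = -(s : ℂ) - 1 := by push_cast; ring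
    have h3 : (1 - w.1ᴴ * z).det * (1 - w.1ᴴ * z).det ^ (-(s : ℂ) - 1 - 1) =
        (1 - w.1ᴴ * z).det ^ (-(s : ℂ) - 1) := by
      have h4 := Complex.slitPlane_ne_zero (det_mem_slitPlane hz w.2)
      rw [Complex.cpow_sub _ _ h4, Complex.cpow_one]
      field_simp
    have h5 : (-(w.1.toRows₂.map star)).det = star w.1.toRows₂.det := by
      simp [det_fin_two]
    simp only [h2, h5]
    push_cast
    linear_combination (star w.1.toRows₂.det * s * (s + 1) * α) * h3
  power n K := by
    have h := pdDet_comp (p := p) (U := ballSet (p ⊕ Fin 2) (Fin 2)) isOpen_ballSet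
      (M := fun z => z.toRows₂) (K := fun z => K z.toRows₁)
      (V := 1) (fun a b z t k l => toRows₂_add_single a b z t k l)
      (fun a b z t => by simp only [toRows₁_add_single])
      (φ := fun x => x ^ (n + 1)) (φ' := fun x => ((n + 1 : ℕ) : ℂ) * x ^ n)
      (φ'' := fun x => ((n + 1 : ℕ) : ℂ) * (n * x ^ (n - 1)))
      (fun z hz => hasDerivAt_pow (n + 1) _)
      (fun z hz => (hasDerivAt_pow n _).const_mul _)
    refine h.trans fun z _ => ?_
    have h1 : ∀ x : ℂ, x * (n * x ^ (n - 1)) = n * x ^ n := by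
      intro x
      cases n with
      | zero => simp
      | succ n => rw [Nat.add_sub_cancel, pow_succ]; ring
    simp only [det_one]
    push_cast
    linear_combination ((n : ℂ) + 1) * K z.toRows₁ * h1 z.toRows₂.det
  pos n := by positivity

end NormalDerivativeFormulas


open Filter Topology Metric
open scoped InnerProductSpace

/-! ### The normal derivatives as intertwining operators -/

section NormalDerivativeOperator

attribute [local instance] Matrix.normedAddCommGroup Matrix.normedSpace

variable {p q : Type} [Fintype p] [DecidableEq p] [Fintype q] [DecidableEq q]
  {D : (Matrix (p ⊕ q) q ℂ → ℂ) → Matrix (p ⊕ q) q ℂ → ℂ} {c : ℝ → ℝ} {d : ℕ → ℝ}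

/-- The extra factor det(cz+d)^(-j) is the one by which the j-th power of det z'' transforms. -/
lemma mult_add_natCast (ν : ℝ) (j : ℕ) (g : Cover p q) (z : Ball p q) :
    mult (ν + j) g z = mult ν g z * (den g⁻¹.toSU z.1).det⁻¹ ^ j := by
  rw [mult, mult, ← g⁻¹.exp_log, ← Complex.exp_neg, ← Complex.exp_nat_mul, ← Complex.exp_add]
  congr 1
  push_cast
  ring

lemma kern_zero (ν : ℝ) : kern p q ν 0 0 = 1 := by
  rw [kern, ball_zero_val, Matrix.mul_zero, sub_zero, det_one, Complex.one_cpow]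

lemma conjTranspose_mul_fromRows_zero {r : Type} [Fintype r] (w : Matrix (p ⊕ r) q ℂ)
    (z : Matrix p q ℂ) : wᴴ * (fromRows z 0 : Matrix (p ⊕ r) q ℂ) = w.toRows₁ᴴ * z := by
  ext i j
  simp [Matrix.mul_apply]

lemma toRows₂_smul_pow (g : Cover p q) (j : ℕ) (z : Ball (p ⊕ q) q) :
    (g.toSU • projBall z : Ball p q) = projBall (embSU q g.toSU • z) ∧
      (embSU q g.toSU • z).1.toRows₂.det ^ j =
        z.1.toRows₂.det ^ j * (den g.toSU (projBall z).1).det⁻¹ ^ j := by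
  refine ⟨(proj_smul _ _).symm, ?_⟩
  rw [toRows₂_smul, det_mul, det_nonsing_inv, Ring.inverse_eq_inv', mul_pow]

lemma extBall_eqOn {f : Ball p q → ℂ} {F : Matrix p q ℂ → ℂ} (h : ∀ z, f z = F z.1) :
    Set.EqOn (extBall f) F (ballSet p q) := by
  rw [← range_val_ball]
  exact extend_eqOn Subtype.val_injective h

namespace NormalOp

lemma iterate_congr (hD : NormalOp D c d) (j : ℕ) {F G : Matrix (p ⊕ q) q ℂ → ℂ}
    (h : Set.EqOn F G (ballSet (p ⊕ q) q)) :
    Set.EqOn (D^[j] F) (D^[j] G) (ballSet (p ⊕ q) q) := by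
  induction j with
  | zero => exact h
  | succ j ih => simpa only [Function.iterate_succ_apply'] using hD.congr _ _ ih

lemma iterate_kernel (hD : NormalOp D c d) (s : ℝ) (w : Ball (p ⊕ q) q) (α : ℂ) (j : ℕ) :
    Set.EqOn (D^[j] fun z => (1 - w.1ᴴ * z).det ^ (-(s : ℂ)) * α)
      (fun z => (1 - w.1ᴴ * z).det ^ (-((s + j : ℝ) : ℂ)) *
        ((∏ i ∈ Finset.range j, c (s + i) : ℝ) * star w.1.toRows₂.det ^ j * α))
      (ballSet (p ⊕ q) q) := by
  induction j with
  | zero => intro z _; simp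
  | succ j ih =>
    rw [Function.iterate_succ_apply']
    refine (hD.congr _ _ ih).trans ((hD.kernel (s + j) w _).trans fun z _ => ?_)
    have h : s + (j : ℝ) + 1 = s + (j + 1 : ℕ) := by push_cast; ring
    simp only [h, Finset.prod_range_succ, pow_succ]
    push_cast
    ring

lemma iterate_power (hD : NormalOp D c d) (n j : ℕ) (K : Matrix p q ℂ → ℂ) :
    Set.EqOn (D^[j] fun z => z.toRows₂.det ^ (n + j) * K z.toRows₁)
      (fun z => z.toRows₂.det ^ n * ((∏ i ∈ Finset.range j, d (n + i) : ℝ) * K z.toRows₁))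
      (ballSet (p ⊕ q) q) := by
  induction j generalizing K with
  | zero => intro z _; simp
  | succ j ih =>
    rw [Function.iterate_succ_apply]
    refine (hD.iterate_congr j (hD.power (n + j) K)).trans
      ((ih fun y => d (n + j) * K y).trans fun z _ => ?_)
    simp only [Finset.prod_range_succ]
    push_cast
    ring

/-- The restriction of the powers of a normal differential operator to the smaller ball. -/
theorem exists_intertwining [AccretiveDet q] (hD : NormalOp D c d) {ν : ℝ} (j : ℕ)
    (hc : ∀ i : ℕ, 0 < c (ν + i)) [IsPosDefKernel (kern (p ⊕ q) q ν)]
    [IsPosDefKernel (kern p q (ν + j))]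
    {U : Cover (p ⊕ q) q →*
      (KernelSpace (kern (p ⊕ q) q ν) ≃ₗᵢ[ℂ] KernelSpace (kern (p ⊕ q) q ν))}
    {U₁ : Cover p q →*
      (KernelSpace (kern p q (ν + j)) ≃ₗᵢ[ℂ] KernelSpace (kern p q (ν + j)))}
    (hU : ∀ g f x, U g f x = mult ν g x * f (g⁻¹ • x))
    (hU₁ : ∀ g f x, U₁ g f x = mult (ν + j) g x * f (g⁻¹ • x)) :
    IsDiscreteSummand U₁ (U.comp (embCover q)) ∧
    ∃ T : KernelSpace (kern (p ⊕ q) q ν) →L[ℂ] KernelSpace (kern p q (ν + j)),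
      (∀ f z, T f z = (D^[j] (extBall f)) (embBall q z).1) ∧ T ≠ 0 ∧
      Intertwines T (U.comp (embCover q)) U₁ := by
  have hfam : IsHolFamily (ballSet (p ⊕ q) q)
      fun f : KernelSpace (kern (p ⊕ q) q ν) => D^[j] (extBall f) := by
    refine IsHolFamily.iterate ?_ (fun A hA => hD.family A hA) j
    have h := isHolFamily_extend (H := KernelSpace (kern (p ⊕ q) q ν))
      (ι := (Subtype.val : Ball (p ⊕ q) q → Matrix (p ⊕ q) q ℂ)) Subtype.val_injective
      (by rw [range_val_ball]; exact differentiableOn_extend_val ν)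
    rw [range_val_ball] at h
    exact h
  choose lam hlam using fun z : Ball p q => hfam.clm (embBall q z).1 (embBall q z).2
  -- The functional is the operator's j-th power evaluated at (z, 0). C collects its constants on
  -- the kernel, and D those on det z''^j, which is differentiated down to exponent 0.
  have h := exists_summand (k := kern (p ⊕ q) q ν) (k₁ := kern p q (ν + j)) (proj := projBall)
    (q := fun w => w.1.toRows₂.det ^ j) lam (C := ∏ i ∈ Finset.range j, c (ν + i))
    (D := ∏ i ∈ Finset.range j, d (0 + i)) (Finset.prod_pos fun i _ => hc i)
    (Finset.prod_pos fun i _ => hD.pos _) ?_ ?_ ⟨0, by rw [kern_zero]; exact one_ne_zero⟩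
    (π := U.comp (embCover q)) (σ := U₁) ?_
  · simp only [hlam] at h
    exact h
  · intro z w
    have h1 : Set.EqOn (extBall (ker (kern (p ⊕ q) q ν) w))
        (fun z => (1 - w.1ᴴ * z).det ^ (-(ν : ℂ)) * 1) (ballSet (p ⊕ q) q) :=
      extBall_eqOn fun z => by rw [ker_apply, mul_one]; rfl
    rw [hlam, hD.iterate_congr j h1 (embBall q z).2, hD.iterate_kernel ν w 1 j (embBall q z).2]
    simp only [embBall, conjTranspose_mul_fromRows_zero, star_pow, mul_one]
    rw [mul_comm]
    rfl
  · intro u z f hf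
    obtain ⟨K, hK⟩ : ∃ K : Matrix p q ℂ → ℂ, ∀ y : Ball p q, K y.1 = kern p q (ν + j) y z :=
      ⟨fun y => (1 - z.1ᴴ * y).det ^ (-((ν + j : ℝ) : ℂ)), fun y => rfl⟩
    have h1 : Set.EqOn (extBall f) (fun w => w.toRows₂.det ^ (0 + j) * K w.toRows₁)
        (ballSet (p ⊕ q) q) :=
      extBall_eqOn fun w => by rw [hf, zero_add, ← hK]; rfl
    rw [hlam, hD.iterate_congr j h1 (embBall q u).2,
      hD.iterate_power 0 j K (embBall q u).2]
    simp only [embBall, toRows₁_fromRows, pow_zero, one_mul, hK]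
  · intro g v f hf w
    obtain ⟨h1, h2⟩ := toRows₂_smul_pow g⁻¹ j w
    have h3 : (embCover q g)⁻¹ • w = embSU q g⁻¹.toSU • w := by
      rw [← map_inv]; rfl
    have h4 : g⁻¹ • projBall w = projBall (embSU q g⁻¹.toSU • w) := h1
    change U (embCover q g) f w = _
    rw [hU, hU₁, hf, h3, h4, h2, mult_embCover, mult_add_natCast]
    ring

end NormalOp

end NormalDerivativeOperator


open Filter Topology Metric
open scoped InnerProductSpace

/-! ### The normal derivative on the product of two balls -/

section ConjugateCoordinates

variable {p r q : Type} [Fintype p] [DecidableEq p] [Fintype r] [DecidableEq r]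
  [Fintype q] [DecidableEq q]

attribute [local instance] Matrix.normedAddCommGroup Matrix.normedSpace

/-- The entrywise conjugation of the ball. -/
noncomputable def conjBall (z : Ball p q) : Ball p q := ⟨z.1.map star, map_star_mem z.2⟩

lemma embBall_map_star (z : Ball p q) :
    (embBall r z).1.map star = (embBall r (conjBall z)).1 := by
  simp only [embBall, fromRows_map_star, conjBall]
  congr 1
  ext i j
  simp

lemma projBall_conjBall (z : Ball (p ⊕ r) q) : projBall (conjBall z) = conjBall (projBall z) :=
  rfl

lemma det_toRows₂_conjBall (z : Ball (p ⊕ q) q) :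
    (conjBall z).1.toRows₂.det = star z.1.toRows₂.det := by
  have h : (conjBall z).1.toRows₂ = z.1.toRows₂ᴴᵀ := rfl
  rw [h, det_transpose, det_conjTranspose]

/-- The antiholomorphic factor of the product kernel is thus the holomorphic kernel in the
conjugated variables, so Case ℂ reduces to two copies of the one-ball computation. -/
lemma kern_conjBall (ν : ℝ) (z w : Ball p q) :
    kern p q ν (conjBall w) (conjBall z) = kern p q ν z w := by
  have h : (1 - (conjBall z).1ᴴ * (conjBall w).1 : Matrix q q ℂ) = (1 - w.1ᴴ * z.1)ᵀ := by
    rw [transpose_sub, transpose_one, transpose_mul]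
    congr 2
    ext i j
    simp [conjBall]
  rw [kern, h, det_transpose, kern]

lemma kernC_zero (ν : ℝ) : kernC p q ν 0 0 = 1 := by
  rw [kernC, Prod.fst_zero, Prod.snd_zero, kern_zero, one_mul]

/-- A function of `(z, w)` as a function of `(z, conj w)`. -/
def conjSnd (F : Matrix p q ℂ × Matrix p q ℂ → ℂ) : Matrix p q ℂ × Matrix p q ℂ → ℂ :=
  fun z => F (z.1, z.2.map star)

/-- The mixed derivative in the normal coordinates of both variables. -/
noncomputable def pdPair (F : Matrix (p ⊕ Fin 1) (Fin 1) ℂ × Matrix (p ⊕ Fin 1) (Fin 1) ℂ → ℂ) :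
    Matrix (p ⊕ Fin 1) (Fin 1) ℂ × Matrix (p ⊕ Fin 1) (Fin 1) ℂ → ℂ :=
  dirD (Matrix.single (Sum.inr 0) 0 1, 0) (dirD (0, Matrix.single (Sum.inr 0) 0 1) F)

/-- The displacement star t in the second variable becomes t after conjugation, so the
antiholomorphic derivative becomes an ordinary complex one. -/
lemma conjSnd_pdC
    (F : Matrix (p ⊕ Fin 1) (Fin 1) ℂ × Matrix (p ⊕ Fin 1) (Fin 1) ℂ → ℂ) :
    conjSnd (pdC F) = pdPair (conjSnd F) := by
  ext z
  simp only [conjSnd, pdC, pdPair, pd, dirD, lineDeriv, Prod.smul_mk, smul_zero, Prod.fst_add,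
    Prod.snd_add, add_zero, map_star_add, map_star_smul]
  have h : (Matrix.single (Sum.inr 0) 0 1 : Matrix (p ⊕ Fin 1) (Fin 1) ℂ).map star =
      Matrix.single (Sum.inr 0) 0 1 := by
    ext i j
    simp [Matrix.single_apply, apply_ite]
  simp only [h]

lemma conjSnd_iterate_pdC (j : ℕ)
    (F : Matrix (p ⊕ Fin 1) (Fin 1) ℂ × Matrix (p ⊕ Fin 1) (Fin 1) ℂ → ℂ) :
    conjSnd (pdC^[j] F) = pdPair^[j] (conjSnd F) :=
  Function.Semiconj.iterate_right (f := conjSnd) conjSnd_pdC j F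

lemma pdPair_mul (A B : Matrix (p ⊕ Fin 1) (Fin 1) ℂ → ℂ) :
    pdPair (fun z => A z.1 * B z.2) = fun z => pd 0 0 A z.1 * pd 0 0 B z.2 := by
  ext z
  simp only [pdPair, pd, dirD, lineDeriv, Prod.smul_mk, smul_zero, Prod.fst_add,
    Prod.snd_add, add_zero, deriv_const_mul_field, deriv_mul_const_field]

lemma pdPair_iterate_mul (j : ℕ) (A B : Matrix (p ⊕ Fin 1) (Fin 1) ℂ → ℂ) :
    pdPair^[j] (fun z => A z.1 * B z.2) = fun z => ((pd 0 0)^[j] A) z.1 * ((pd 0 0)^[j] B) z.2 := by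
  induction j generalizing A B with
  | zero => rfl
  | succ j ih => simp only [Function.iterate_succ_apply, pdPair_mul, ih]

lemma isOpen_ballSet_prod : IsOpen (ballSet p q ×ˢ ballSet p q) :=
  isOpen_ballSet.prod isOpen_ballSet

lemma pdPair_iterate_congr (j : ℕ)
    {F G : Matrix (p ⊕ Fin 1) (Fin 1) ℂ × Matrix (p ⊕ Fin 1) (Fin 1) ℂ → ℂ}
    (h : Set.EqOn F G (ballSet (p ⊕ Fin 1) (Fin 1) ×ˢ ballSet (p ⊕ Fin 1) (Fin 1))) :
    Set.EqOn (pdPair^[j] F) (pdPair^[j] G)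
      (ballSet (p ⊕ Fin 1) (Fin 1) ×ˢ ballSet (p ⊕ Fin 1) (Fin 1)) := by
  induction j with
  | zero => exact h
  | succ j ih =>
    simp only [Function.iterate_succ_apply']
    exact dirD_congr isOpen_ballSet_prod (dirD_congr isOpen_ballSet_prod ih _) _

lemma extend_coordC_eqOn {f : Ball p q × Ball p q → ℂ} {F : Matrix p q ℂ × Matrix p q ℂ → ℂ}
    (h : ∀ z, f z = F (coordC z)) :
    Set.EqOn (Function.extend coordC f 0) F (ballSet p q ×ˢ ballSet p q) := by
  rw [← range_coordC]
  exact extend_eqOn coordC_injective h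

lemma extBallC_apply (f : Ball p q × Ball p q → ℂ) (z : Ball p q × Ball p q) :
    extBallC f (z.1.1, z.2.1) = f z :=
  (Subtype.val_injective.prodMap Subtype.val_injective).extend_apply f 0 z

lemma normalDerivC_eq (j : ℕ) (f : Ball (p ⊕ Fin 1) (Fin 1) × Ball (p ⊕ Fin 1) (Fin 1) → ℂ)
    (z : Ball p (Fin 1) × Ball p (Fin 1)) :
    normalDerivC j f z = (pdPair^[j] (Function.extend coordC f 0))
      ((embBall (Fin 1) z.1).1, (embBall (Fin 1) (conjBall z.2)).1) := by
  have h : Set.EqOn (Function.extend coordC f 0) (conjSnd (extBallC f))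
      (ballSet (p ⊕ Fin 1) (Fin 1) ×ˢ ballSet (p ⊕ Fin 1) (Fin 1)) :=
    extend_coordC_eqOn fun w => by
      rw [coordC, conjSnd, map_star_map_star, extBallC_apply]
  have hz := Set.mk_mem_prod (embBall (Fin 1) z.1).2 (embBall (Fin 1) (conjBall z.2)).2
  refine Eq.trans ?_ (pdPair_iterate_congr j h hz).symm
  rw [← conjSnd_iterate_pdC, ← embBall_map_star]
  simp only [conjSnd, map_star_map_star, normalDerivC]

lemma pdPair_iterate_extend (j : ℕ)
    {f : Ball (p ⊕ Fin 1) (Fin 1) × Ball (p ⊕ Fin 1) (Fin 1) → ℂ}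
    {A B A' B' : Matrix (p ⊕ Fin 1) (Fin 1) ℂ → ℂ}
    (h : ∀ w, f w = A w.1.1 * B (conjBall w.2).1)
    (hA : Set.EqOn ((pd 0 0)^[j] A) A' (ballSet (p ⊕ Fin 1) (Fin 1)))
    (hB : Set.EqOn ((pd 0 0)^[j] B) B' (ballSet (p ⊕ Fin 1) (Fin 1)))
    (z w : Ball (p ⊕ Fin 1) (Fin 1)) :
    (pdPair^[j] (Function.extend coordC f 0)) (z.1, w.1) = A' z.1 * B' w.1 := by
  have h1 : Set.EqOn (Function.extend coordC f 0) (fun w => A w.1 * B w.2)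
      (ballSet (p ⊕ Fin 1) (Fin 1) ×ˢ ballSet (p ⊕ Fin 1) (Fin 1)) :=
    extend_coordC_eqOn h
  refine (pdPair_iterate_congr j h1 (Set.mk_mem_prod z.2 w.2)).trans ?_
  rw [pdPair_iterate_mul]
  exact congrArg₂ (· * ·) (hA z.2) (hB w.2)

/-- The powers of the normal derivative in both variables, restricted to the product of the
smaller balls. -/
theorem exists_intertwiningC {ν : ℝ} (hν : 0 < ν) (j : ℕ)
    [IsPosDefKernel (kernC (p ⊕ Fin 1) (Fin 1) ν)] [IsPosDefKernel (kernC p (Fin 1) (ν + j))]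
    {U : Cover (p ⊕ Fin 1) (Fin 1) × Cover (p ⊕ Fin 1) (Fin 1) →*
      (KernelSpace (kernC (p ⊕ Fin 1) (Fin 1) ν) ≃ₗᵢ[ℂ]
        KernelSpace (kernC (p ⊕ Fin 1) (Fin 1) ν))}
    {U₁ : Cover p (Fin 1) × Cover p (Fin 1) →*
      (KernelSpace (kernC p (Fin 1) (ν + j)) ≃ₗᵢ[ℂ] KernelSpace (kernC p (Fin 1) (ν + j)))}
    (hU : ∀ g f x, U g f x = multC ν g x * f (g⁻¹ • x))
    (hU₁ : ∀ g f x, U₁ g f x = multC (ν + j) g x * f (g⁻¹ • x)) :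
    IsDiscreteSummand U₁ (U.comp ((embCover (Fin 1)).prodMap (embCover (Fin 1)))) ∧
    ∃ T : KernelSpace (kernC (p ⊕ Fin 1) (Fin 1) ν) →L[ℂ] KernelSpace (kernC p (Fin 1) (ν + j)),
      (∀ f z, T f z = normalDerivC j f z) ∧ T ≠ 0 ∧
      Intertwines T (U.comp ((embCover (Fin 1)).prodMap (embCover (Fin 1)))) U₁ := by
  have hD := normalOp_one (p := p)
  have hfam : IsHolFamily (ballSet (p ⊕ Fin 1) (Fin 1) ×ˢ ballSet (p ⊕ Fin 1) (Fin 1))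
      fun f : KernelSpace (kernC (p ⊕ Fin 1) (Fin 1) ν) =>
        pdPair^[j] (Function.extend coordC f 0) := by
    refine IsHolFamily.iterate ?_
      (fun A hA => (hA.dirD isOpen_ballSet_prod _).dirD isOpen_ballSet_prod _) j
    have h := isHolFamily_extend (H := KernelSpace (kernC (p ⊕ Fin 1) (Fin 1) ν))
      coordC_injective (by rw [range_coordC]; exact differentiableOn_extend_coordC ν)
    rw [range_coordC] at h
    exact h
  choose lam hlam using fun z : Ball p (Fin 1) × Ball p (Fin 1) =>
    hfam.clm _ (Set.mk_mem_prod (embBall (Fin 1) z.1).2 (embBall (Fin 1) (conjBall z.2)).2)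
  have hC : 0 < ∏ i ∈ Finset.range j, (ν + i) := Finset.prod_pos fun i _ => by positivity
  have hd : 0 < ∏ i ∈ Finset.range j, (((0 + i : ℕ) : ℝ) + 1) :=
    Finset.prod_pos fun i _ => by positivity
  -- Each of the two factors contributes the one-ball constant once, hence the squares.
  have h := exists_summand (k := kernC (p ⊕ Fin 1) (Fin 1) ν) (k₁ := kernC p (Fin 1) (ν + j))
    (proj := fun w => (projBall w.1, projBall w.2))
    (q := fun w => w.1.1.toRows₂.det ^ j * star (w.2.1.toRows₂.det ^ j)) lam
    (pow_pos hC 2) (pow_pos hd 2) ?_ ?_ ⟨0, by rw [kernC_zero]; exact one_ne_zero⟩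
    (π := U.comp ((embCover (Fin 1)).prodMap (embCover (Fin 1)))) (σ := U₁) ?_
  · simp only [hlam, ← normalDerivC_eq] at h
    exact h
  · intro z w
    have h1 := pdPair_iterate_extend j (f := ker (kernC (p ⊕ Fin 1) (Fin 1) ν) w)
      (fun z => by
        rw [ker_apply, kernC, ← kern_conjBall ν w.2, kern, kern]
        simp only [mul_one])
      (hD.iterate_kernel ν w.1 1 j) (hD.iterate_kernel ν (conjBall w.2) 1 j)
      (embBall (Fin 1) z.1) (embBall (Fin 1) (conjBall z.2))
    rw [hlam, h1, det_toRows₂_conjBall, kernC, ← kern_conjBall (ν + j) (projBall w.2)]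
    simp only [embBall, conjTranspose_mul_fromRows_zero, star_mul, star_pow, star_star, mul_one]
    change kern p (Fin 1) (ν + j) z.1 (projBall w.1) * _ *
      (kern p (Fin 1) (ν + j) (conjBall z.2) (conjBall (projBall w.2)) * _) = _
    push_cast
    ring
  · intro u z f hf
    obtain ⟨K, hK⟩ : ∃ K : Matrix p (Fin 1) ℂ → ℂ,
        ∀ y : Ball p (Fin 1), K y.1 = kern p (Fin 1) (ν + j) y z.1 :=
      ⟨fun y => (1 - z.1.1ᴴ * y).det ^ (-((ν + j : ℝ) : ℂ)), fun y => rfl⟩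
    obtain ⟨L, hL⟩ : ∃ L : Matrix p (Fin 1) ℂ → ℂ,
        ∀ y : Ball p (Fin 1), L y.1 = kern p (Fin 1) (ν + j) y (conjBall z.2) :=
      ⟨fun y => (1 - (conjBall z.2).1ᴴ * y).det ^ (-((ν + j : ℝ) : ℂ)), fun y => rfl⟩
    have h1 := pdPair_iterate_extend j (f := f)
      (fun w => by
        rw [hf, kernC, ← kern_conjBall (ν + j) z.2, ← projBall_conjBall,
          ← hK, ← hL, star_pow, ← det_toRows₂_conjBall, zero_add]
        exact mul_mul_mul_comm _ _ _ _)
      (hD.iterate_power 0 j K) (hD.iterate_power 0 j L)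
      (embBall (Fin 1) u.1) (embBall (Fin 1) (conjBall u.2))
    rw [hlam, h1, kernC, ← kern_conjBall (ν + j) z.2]
    simp only [embBall, toRows₁_fromRows, pow_zero, one_mul, hK, hL]
    push_cast
    ring
  · intro g v f hf w
    obtain ⟨h1, h2⟩ := toRows₂_smul_pow g.1⁻¹ j w.1
    obtain ⟨h1', h2'⟩ := toRows₂_smul_pow g.2⁻¹ j w.2
    have h3 : (((embCover (Fin 1)).prodMap (embCover (Fin 1))) g)⁻¹ • w =
        (embSU (Fin 1) g.1⁻¹.toSU • w.1, embSU (Fin 1) g.2⁻¹.toSU • w.2) := by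
      rw [← map_inv]; rfl
    have h4 : g⁻¹ • (projBall w.1, projBall w.2) = (projBall (embSU (Fin 1) g.1⁻¹.toSU • w.1),
        projBall (embSU (Fin 1) g.2⁻¹.toSU • w.2)) := Prod.ext h1 h1'
    have h5 : multC ν (((embCover (Fin 1)).prodMap (embCover (Fin 1))) g) w =
        mult ν g.1 (projBall w.1) * star (mult ν g.2 (projBall w.2)) := by
      rw [← mult_embCover, ← mult_embCover]; rfl
    change U (((embCover (Fin 1)).prodMap (embCover (Fin 1))) g) f w = _
    rw [hU, hU₁, hf, h3, h4, h5, h2, h2', multC]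
    simp only [mult_add_natCast, star_mul]
    ring

end ConjugateCoordinates

end HoloBranching

/-! ### The theorem -/

theorem theorem3p2 :
    -- `G = SU(n,1)`, `G₁ = SU(n-1,1)` with `n = m + 1`, and `Q = z_n`
    (∀ (m : ℕ) (ν : ℝ), 0 < ν →
      ∃ (_ : IsPosDefKernel (kern (Fin m ⊕ Fin 1) (Fin 1) ν))
        (_ : ∀ j : ℕ, IsPosDefKernel (kern (Fin m) (Fin 1) (ν + j)))
        (U : Cover (Fin m ⊕ Fin 1) (Fin 1) →*
          (KernelSpace (kern (Fin m ⊕ Fin 1) (Fin 1) ν) ≃ₗᵢ[ℂ]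
            KernelSpace (kern (Fin m ⊕ Fin 1) (Fin 1) ν)))
        (U₁ : ∀ j : ℕ, Cover (Fin m) (Fin 1) →*
          (KernelSpace (kern (Fin m) (Fin 1) (ν + j)) ≃ₗᵢ[ℂ]
            KernelSpace (kern (Fin m) (Fin 1) (ν + j)))),
        IsScalarRep (hol (Fin m ⊕ Fin 1) (Fin 1)) (mult ν) U ∧
        (∀ j : ℕ, IsScalarRep (hol (Fin m) (Fin 1)) (mult (ν + j)) (U₁ j)) ∧
        IsDiscreteSumOfHolomorphic (hol (Fin m) (Fin 1)) (U.comp (embCover (Fin 1))) ∧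
        (∀ j : ℕ, IsDiscreteSummand (U₁ j) (U.comp (embCover (Fin 1)))) ∧
        (∀ j : ℕ, ∃ T : KernelSpace (kern (Fin m ⊕ Fin 1) (Fin 1) ν) →L[ℂ]
            KernelSpace (kern (Fin m) (Fin 1) (ν + j)),
          (∀ f z, T f z = normalDeriv j f z) ∧ T ≠ 0 ∧
          Intertwines T (U.comp (embCover (Fin 1))) (U₁ j))) ∧
    -- `G = SU(n,1) × SU(n,1)`, `G₁ = SU(n-1,1) × SU(n-1,1)`, and `Q = z_n conj(w_n)`
    (∀ (m : ℕ) (ν : ℝ), 0 < ν →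
      ∃ (_ : IsPosDefKernel (kernC (Fin m ⊕ Fin 1) (Fin 1) ν))
        (_ : ∀ j : ℕ, IsPosDefKernel (kernC (Fin m) (Fin 1) (ν + j)))
        (U : Cover (Fin m ⊕ Fin 1) (Fin 1) × Cover (Fin m ⊕ Fin 1) (Fin 1) →*
          (KernelSpace (kernC (Fin m ⊕ Fin 1) (Fin 1) ν) ≃ₗᵢ[ℂ]
            KernelSpace (kernC (Fin m ⊕ Fin 1) (Fin 1) ν)))
        (U₁ : ∀ j : ℕ, Cover (Fin m) (Fin 1) × Cover (Fin m) (Fin 1) →*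
          (KernelSpace (kernC (Fin m) (Fin 1) (ν + j)) ≃ₗᵢ[ℂ]
            KernelSpace (kernC (Fin m) (Fin 1) (ν + j)))),
        IsScalarRep (holC (Fin m ⊕ Fin 1) (Fin 1)) (multC ν) U ∧
        (∀ j : ℕ, IsScalarRep (holC (Fin m) (Fin 1)) (multC (ν + j)) (U₁ j)) ∧
        IsDiscreteSumOfHolomorphic (holC (Fin m) (Fin 1))
          (U.comp ((embCover (Fin 1)).prodMap (embCover (Fin 1)))) ∧
        (∀ j : ℕ, IsDiscreteSummand (U₁ j)
          (U.comp ((embCover (Fin 1)).prodMap (embCover (Fin 1))))) ∧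
        (∀ j : ℕ, ∃ T : KernelSpace (kernC (Fin m ⊕ Fin 1) (Fin 1) ν) →L[ℂ]
            KernelSpace (kernC (Fin m) (Fin 1) (ν + j)),
          (∀ f z, T f z = normalDerivC j f z) ∧ T ≠ 0 ∧
          Intertwines T (U.comp ((embCover (Fin 1)).prodMap (embCover (Fin 1)))) (U₁ j))) ∧
    -- `G = SU(2n,2)`, `G₁ = SU(2(n-1),2)`, and `Q = det z_n`
    (∀ (m : ℕ) (ν : ℝ), 1 < ν →
      ∃ (_ : IsPosDefKernel (kern (Fin (2 * m) ⊕ Fin 2) (Fin 2) ν))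
        (_ : ∀ j : ℕ, IsPosDefKernel (kern (Fin (2 * m)) (Fin 2) (ν + j)))
        (U : Cover (Fin (2 * m) ⊕ Fin 2) (Fin 2) →*
          (KernelSpace (kern (Fin (2 * m) ⊕ Fin 2) (Fin 2) ν) ≃ₗᵢ[ℂ]
            KernelSpace (kern (Fin (2 * m) ⊕ Fin 2) (Fin 2) ν)))
        (U₁ : ∀ j : ℕ, Cover (Fin (2 * m)) (Fin 2) →*
          (KernelSpace (kern (Fin (2 * m)) (Fin 2) (ν + j)) ≃ₗᵢ[ℂ]
            KernelSpace (kern (Fin (2 * m)) (Fin 2) (ν + j)))),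
        IsScalarRep (hol (Fin (2 * m) ⊕ Fin 2) (Fin 2)) (mult ν) U ∧
        (∀ j : ℕ, IsScalarRep (hol (Fin (2 * m)) (Fin 2)) (mult (ν + j)) (U₁ j)) ∧
        IsDiscreteSumOfHolomorphic (hol (Fin (2 * m)) (Fin 2)) (U.comp (embCover (Fin 2))) ∧
        (∀ j : ℕ, IsDiscreteSummand (U₁ j) (U.comp (embCover (Fin 2)))) ∧
        (∀ j : ℕ, ∃ T : KernelSpace (kern (Fin (2 * m) ⊕ Fin 2) (Fin 2) ν) →L[ℂ]
            KernelSpace (kern (Fin (2 * m)) (Fin 2) (ν + j)),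
          (∀ f z, T f z = normalDerivH j f z) ∧ T ≠ 0 ∧
          Intertwines T (U.comp (embCover (Fin 2))) (U₁ j))) := by
  refine ⟨fun m ν hν => ?_, fun m ν hν => ?_, fun m ν hν => ?_⟩
  · have hνj : ∀ j : ℕ, 0 < ν + j := fun j => by positivity
    have hk : IsPosDefKernel (kern (Fin m ⊕ Fin 1) (Fin 1) ν) := isPosDefKernel_kern_one hν
    have hk₁ : ∀ j : ℕ, IsPosDefKernel (kern (Fin m) (Fin 1) (ν + j)) :=
      fun j => isPosDefKernel_kern_one (hνj j)
    obtain ⟨U, hU⟩ := exists_isScalarRep (p := Fin m ⊕ Fin 1) (q := Fin 1) ν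
    choose U₁ hU₁ using fun j : ℕ => exists_isScalarRep (p := Fin m) (q := Fin 1) (ν + j)
    have h := fun j => normalOp_one.exists_intertwining (p := Fin m) j hνj hU.apply (hU₁ j).apply
    exact ⟨hk, hk₁, U, U₁, hU, hU₁, isDiscreteSum_kern ν hU.apply, fun j => (h j).1,
      fun j => (h j).2⟩
  · have hk : IsPosDefKernel (kernC (Fin m ⊕ Fin 1) (Fin 1) ν) := isPosDefKernel_kernC_one hν
    have hk₁ : ∀ j : ℕ, IsPosDefKernel (kernC (Fin m) (Fin 1) (ν + j)) :=
      fun j => isPosDefKernel_kernC_one (by positivity)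
    obtain ⟨U, hU⟩ := exists_isScalarRepC (p := Fin m ⊕ Fin 1) (q := Fin 1) ν
    choose U₁ hU₁ using fun j : ℕ => exists_isScalarRepC (p := Fin m) (q := Fin 1) (ν + j)
    have h := fun j => exists_intertwiningC (p := Fin m) hν j hU.apply (hU₁ j).apply
    exact ⟨hk, hk₁, U, U₁, hU, hU₁, isDiscreteSum_kernC ν hU.apply, fun j => (h j).1,
      fun j => (h j).2⟩
  · have hνj : ∀ j : ℕ, 1 < ν + j := fun j => lt_add_of_lt_of_nonneg hν j.cast_nonneg
    have hk : IsPosDefKernel (kern (Fin (2 * m) ⊕ Fin 2) (Fin 2) ν) := isPosDefKernel_kern_two hν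
    have hk₁ : ∀ j : ℕ, IsPosDefKernel (kern (Fin (2 * m)) (Fin 2) (ν + j)) :=
      fun j => isPosDefKernel_kern_two (hνj j)
    obtain ⟨U, hU⟩ := exists_isScalarRep (p := Fin (2 * m) ⊕ Fin 2) (q := Fin 2) ν
    choose U₁ hU₁ using fun j : ℕ => exists_isScalarRep (p := Fin (2 * m)) (q := Fin 2) (ν + j)
    -- Positivity of (ν+i)(ν+i-1) for all i is where ν > 1 enters the differential operator.
    have h := fun j => normalOp_two.exists_intertwining (p := Fin (2 * m)) j
      (fun i => mul_pos (one_pos.trans (hνj i)) (sub_pos.2 (hνj i))) hU.apply (hU₁ j).apply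
    exact ⟨hk, hk₁, U, U₁, hU, hU₁, isDiscreteSum_kern ν hU.apply, fun j => (h j).1,
      fun j => (h j).2⟩
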